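/- **Setting.** For every $n\ge 1$ let $\mathbf y=\mathbf B_n\mathbf f+\boldsymbol\varepsilon$ be a factor model with factors $\mathbf f\in\mathbb R^{K}$, returns $\mathbf y\in\mathbb R^{p}$ and loadings $\mathbf B_n\in\mathbb R^{p\times K}$, where $p=p_n$, $K=K_n$ and the distributions may all depend on $n$. Assume: (A) $(\mathbf f_1,\mathbf y_1),\dots,(\mathbf f_n,\mathbf y_n)$ are i.i.d. copies of $(\mathbf f,\mathbf y)$; $E(\boldsymbol\varepsilon\mid\mathbf f)=0$; $\mathrm{cov}(\boldsymbol\varepsilon\mid\mathbf f)=\Sigma_{n,0}$ is a non-random diagonal matrix; the distribution of $\mathbf f$ is absolutely continuous; $K\le p$. (B) $E\|\mathbf y\|^2=O(p)$; $\max_{i}E f_i^4$ and $\max_i E\varepsilon_i^4$ are finite and bounded in $n$; the eigenvalues of $\mathrm{cov}(\mathbf f)$ are at least some constant $\sigma_1>0$ for all $n$. (C) The eigenvalues of $\Sigma_{n,0}$ are at least some constant $\sigma_2>0$ for all $n$. Put $\Sigma_n=\mathrm{cov}(\mathbf y)$, $\mu_n=E\mathbf y$, $\varphi_n=\mathbf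 1'\Sigma_n^{-1}\mathbf 1$, $\psi_n=\mathbf 1'\Sigma_n^{-1}\mu_n$, $\phi_n=\mu_n'\Sigma_n^{-1}\mu_n$, and let $\gamma_n\in\mathbb R$. For a $p\times p$ matrix $S$ and $m\in\mathbb R^p$ let $V(S,m,\gamma)=\xi'S\xi$, where $\xi$ is the mean-variance optimal portfolio, i.e. a minimizer of $\xi'S\xi$ subject to $\xi'\mathbf 1=1$ and $\xi'm=\gamma$ (with $V=0$ if there is no minimizer). With $\mathbf X=(\mathbf f_1,\dots,\mathbf f_n)$ and $\mathbf Y=(\mathbf y_1,\dots,\mathbf y_n)$ let $\widehat{\mathbf B}=\mathbf Y\mathbf X'(\mathbf X\mathbf X')^{-1}$ (with the inverse read as $0$ where $\mathbf X\mathbf X'$ is singular), $\widehat{\mathrm{cov}}(\mathbf f)=\frac1{n-1}\mathbf X\mathbf X'-\frac1{n(n-1)}\mathbf X\mathbf 1\mathbf 1'\mathbf X'$, $\widehat{\mathbf E}=\mathbf Y-\widehat{\mathbf B}\mathbf X$, and $$\widehat\Sigma_n=\widehat{\mathbf B}\,\widehat{\mathrm{cov}}(\mathbf f)\,\widehat{\mathbf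 B}'+\mathrm{diag}\bigl(n^{-1}\widehat{\mathbf E}\widehat{\mathbf E}'\bigr),\qquad \widehat\mu_n=\widehat{\mathbf B}\,\tfrac1n\sum_{i=1}^n\mathbf f_i,$$ $$\widehat\Sigma_{\rm sam}=\tfrac1{n-1}\mathbf Y\mathbf Y'-\tfrac1{n(n-1)}\mathbf Y\mathbf 1\mathbf 1'\mathbf Y',\qquad \widehat\mu_{\rm sam}=\tfrac1n\sum_{i=1}^n\mathbf y_i .$$ **Theorem 6 (Weak convergence to optimal portfolio).** Assume (A)–(C), that $\varphi_n\phi_n-\psi_n^2$ is bounded away from zero, and that $\varphi_n/(\varphi_n\phi_n-\psi_n^2)$, $\psi_n/(\varphi_n\phi_n-\psi_n^2)$, $\phi_n/(\varphi_n\phi_n-\psi_n^2)$ and $\gamma_n$ are bounded. Then, as $n\to\infty$, $$V(\widehat\Sigma_n,\widehat\mu_n,\gamma_n)-V(\Sigma_n,\mu_n,\gamma_n)=o_P\bigl\{(p^4K^4\log n/n)^{1/2}\bigr\},$$ whereas $$V(\widehat\Sigma_{\rm sam},\widehat\mu,\gamma_n)-V(\Sigma_n,\mu_n,\gamma_n)=o_P\bigl\{(p^6K^2\log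 n/n)^{1/2}\bigr\}$$ both for $\widehat\mu=\widehat\mu_{\rm sam}$ and for $\widehat\mu=\widehat\mu_n$. -/

import Mathlib

open MeasureTheory ProbabilityTheory Filter Topology Asymptotics Matrix

noncomputable section

/-! ### Conditional covariances, covariance matrices, stochastic order -/

/-- The conditional covariance `cov(U, V | m)` of two real random variables given a σ-algebra. -/
def condCovariance {Ω : Type*} [MeasurableSpace Ω] (P : Measure Ω) (m : MeasurableSpace Ω)
    (U V : Ω → ℝ) : Ω → ℝ :=
  P[fun ω => (U ω - (P[U | m]) ω) * (V ω - (P[V | m]) ω) | m]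

/-- The covariance matrix of a random vector. -/
def covMatrix {Ω : Type*} [MeasurableSpace Ω] (P : Measure Ω) {q : ℕ} (Z : Ω → Fin q → ℝ) :
    Matrix (Fin q) (Fin q) ℝ :=
  Matrix.of fun i j => covariance (fun ω => Z ω i) (fun ω => Z ω j) P

/-- The mean vector of a random vector. -/
def meanVector {Ω : Type*} [MeasurableSpace Ω] (P : Measure Ω) {q : ℕ} (Z : Ω → Fin q → ℝ) :
    Fin q → ℝ :=
  fun i => ∫ ω, Z ω i ∂P

/-- `Z n = o_P(a n)` as `n → ∞`, where `Z n` lives on its own probability space. -/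
def IsLittleOInProb {Ω : ℕ → Type*} [∀ n, MeasurableSpace (Ω n)] (P : ∀ n, Measure (Ω n))
    (Z : ∀ n, Ω n → ℝ) (a : ℕ → ℝ) : Prop :=
  ∀ ε : ℝ, 0 < ε → Tendsto (fun n => P n {ω | ε * a n < |Z n ω|}) atTop (𝓝 0)

/-! ### Estimators, as functions of the data matrices `X` (`K × n`) and `Y` (`p × n`) -/

/-- The least-squares loadings `Y X' (X X')⁻¹`. -/
def loadingsEst {K p n : ℕ} (X : Matrix (Fin K) (Fin n) ℝ) (Y : Matrix (Fin p) (Fin n) ℝ) :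
    Matrix (Fin p) (Fin K) ℝ :=
  Y * Xᵀ * (X * Xᵀ)⁻¹

/-- The sample covariance matrix `(n-1)⁻¹ Z Z' - {n(n-1)}⁻¹ Z 1 1' Z'` of the columns of `Z`. -/
def sampleCov {q n : ℕ} (Z : Matrix (Fin q) (Fin n) ℝ) : Matrix (Fin q) (Fin q) ℝ :=
  ((n : ℝ) - 1)⁻¹ • (Z * Zᵀ)
    - ((n : ℝ) * ((n : ℝ) - 1))⁻¹ • (Z * (Matrix.of fun _ _ => 1 : Matrix (Fin n) (Fin n) ℝ) * Zᵀ)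

/-- The sample mean of the columns of `Z`. -/
def sampleMean {q n : ℕ} (Z : Matrix (Fin q) (Fin n) ℝ) : Fin q → ℝ :=
  (n : ℝ)⁻¹ • (Z *ᵥ 1)

/-- The matrix of residuals. -/
def residuals {K p n : ℕ} (X : Matrix (Fin K) (Fin n) ℝ) (Y : Matrix (Fin p) (Fin n) ℝ) :
    Matrix (Fin p) (Fin n) ℝ :=
  Y - loadingsEst X Y * X

/-- The diagonal matrix of `n⁻¹ Ê Ê'`, with `Ê` the residuals. -/
def noiseCovEst {K p n : ℕ} (X : Matrix (Fin K) (Fin n) ℝ) (Y : Matrix (Fin p) (Fin n) ℝ) :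
    Matrix (Fin p) (Fin p) ℝ :=
  Matrix.diagonal (Matrix.diag ((n : ℝ)⁻¹ • (residuals X Y * (residuals X Y)ᵀ)))

/-- The factor-model (substitution) estimator of the covariance matrix. -/
def factorCovEst {K p n : ℕ} (X : Matrix (Fin K) (Fin n) ℝ) (Y : Matrix (Fin p) (Fin n) ℝ) :
    Matrix (Fin p) (Fin p) ℝ :=
  loadingsEst X Y * sampleCov X * (loadingsEst X Y)ᵀ + noiseCovEst X Y

/-- The factor-model (substitution) estimator of the mean vector. -/
def factorMeanEst {K p n : ℕ} (X : Matrix (Fin K) (Fin n) ℝ) (Y : Matrix (Fin p) (Fin n) ℝ) :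
    Fin p → ℝ :=
  loadingsEst X Y *ᵥ sampleMean X

/-! ### The mean-variance optimal portfolio -/

/-- `ξ` minimizes the variance `ξ' S ξ` subject to `ξ' 1 = 1` and `ξ' m = γ`. -/
def IsMeanVarianceOptimal {p : ℕ} (S : Matrix (Fin p) (Fin p) ℝ) (m : Fin p → ℝ) (γ : ℝ)
    (ξ : Fin p → ℝ) : Prop :=
  (ξ ⬝ᵥ 1 = 1 ∧ ξ ⬝ᵥ m = γ) ∧
    ∀ η : Fin p → ℝ, η ⬝ᵥ 1 = 1 → η ⬝ᵥ m = γ → ξ ⬝ᵥ (S *ᵥ ξ) ≤ η ⬝ᵥ (S *ᵥ η)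

open Classical in
/-- A mean-variance optimal portfolio for `(S, m, γ)`; the zero vector if there is none.
For positive definite `S` the optimal portfolio is unique; in any case all the optimal portfolios
have the same variance `ξ' S ξ`. -/
def optimalPortfolio {p : ℕ} (S : Matrix (Fin p) (Fin p) ℝ) (m : Fin p → ℝ) (γ : ℝ) :
    Fin p → ℝ :=
  if h : ∃ ξ, IsMeanVarianceOptimal S m γ ξ then h.choose else 0

/-- The variance `ξ' S ξ` of the mean-variance optimal portfolio `ξ` for `(S, m, γ)`. -/
def optimalVariance {p : ℕ} (S : Matrix (Fin p) (Fin p) ℝ) (m : Fin p → ℝ) (γ : ℝ) : ℝ :=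
  optimalPortfolio S m γ ⬝ᵥ (S *ᵥ optimalPortfolio S m γ)

/-! ### The factor model -/

/-- The data of a `K`-factor model for `p` assets with a sample of size `n`. -/
structure FactorSample (Ω : Type*) (K p n : ℕ) where
  /-- the factor loadings -/
  B : Matrix (Fin p) (Fin K) ℝ
  /-- the conditional covariance matrix of the idiosyncratic noise -/
  noiseCov : Matrix (Fin p) (Fin p) ℝ
  /-- the population factors -/
  f : Ω → Fin K → ℝ
  /-- the population idiosyncratic noise -/
  noise : Ω → Fin p → ℝ
  /-- the sampled factors -/
  fs : Fin n → Ω → Fin K → ℝ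
  /-- the sampled returns -/
  ys : Fin n → Ω → Fin p → ℝ

namespace FactorSample

variable {Ω : Type*} {K p n : ℕ}

/-- The population returns `y = B f + ε`. -/
def y (M : FactorSample Ω K p n) (ω : Ω) : Fin p → ℝ :=
  M.B *ᵥ M.f ω + M.noise ω

/-- The data matrix `X = (f₁, …, f_n)`. -/
def X (M : FactorSample Ω K p n) (ω : Ω) : Matrix (Fin K) (Fin n) ℝ :=
  Matrix.of fun a i => M.fs i ω a

/-- The data matrix `Y = (y₁, …, y_n)`. -/
def Y (M : FactorSample Ω K p n) (ω : Ω) : Matrix (Fin p) (Fin n) ℝ :=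
  Matrix.of fun k i => M.ys i ω k

variable [MeasurableSpace Ω]

/-- The σ-algebra generated by the population factors. -/
abbrev factorSigma (M : FactorSample Ω K p n) : MeasurableSpace Ω :=
  MeasurableSpace.comap M.f inferInstance

/-- Condition (A). -/
structure ConditionA (M : FactorSample Ω K p n) (P : Measure Ω) : Prop where
  measurable_f : Measurable M.f
  measurable_noise : Measurable M.noise
  /-- the sample is independent … -/
  indep : iIndepFun (fun i ω => (M.fs i ω, M.ys i ω)) P
  /-- … and every member of it is distributed as `(f, y)` -/
  identDistrib : ∀ i, IdentDistrib (fun ω => (M.fs i ω, M.ys i ω)) (fun ω => (M.f ω, M.y ω)) P P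
  /-- `E(ε | f) = 0` -/
  condMean : ∀ k, P[fun ω => M.noise ω k | M.factorSigma] =ᵐ[P] 0
  /-- `cov(ε | f)` is the constant matrix `noiseCov` … -/
  condCov : ∀ k l, condCovariance P M.factorSigma (fun ω => M.noise ω k) (fun ω => M.noise ω l)
    =ᵐ[P] fun _ => M.noiseCov k l
  /-- … which is diagonal -/
  isDiag : M.noiseCov.IsDiag
  /-- the distribution of `f` is continuous, that is, it has a Lebesgue density -/
  continuousLaw : P.map M.f ≪ volume
  le : K ≤ p

/-- `b = E ‖y‖²`. -/
def b (M : FactorSample Ω K p n) (P : Measure Ω) : ℝ :=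
  ∫ ω, ∑ k, (M.y ω k) ^ 2 ∂P

/-- `c = max_i E f_i⁴`. -/
def c (M : FactorSample Ω K p n) (P : Measure Ω) : ℝ :=
  ⨆ a, ∫ ω, (M.f ω a) ^ 4 ∂P

/-- `d = max_i E ε_i⁴`. -/
def d (M : FactorSample Ω K p n) (P : Measure Ω) : ℝ :=
  ⨆ k, ∫ ω, (M.noise ω k) ^ 4 ∂P

/-- `Σ = cov(y)`. -/
def Sig (M : FactorSample Ω K p n) (P : Measure Ω) : Matrix (Fin p) (Fin p) ℝ :=
  covMatrix P M.y

/-- `μ = E y`. -/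
def mu (M : FactorSample Ω K p n) (P : Measure Ω) : Fin p → ℝ :=
  meanVector P M.y

/-- `φ = 1' Σ⁻¹ 1`. -/
def varphi (M : FactorSample Ω K p n) (P : Measure Ω) : ℝ :=
  1 ⬝ᵥ ((M.Sig P)⁻¹ *ᵥ 1)

/-- `ψ = 1' Σ⁻¹ μ`. -/
def psi (M : FactorSample Ω K p n) (P : Measure Ω) : ℝ :=
  1 ⬝ᵥ ((M.Sig P)⁻¹ *ᵥ M.mu P)

/-- `ϕ = μ' Σ⁻¹ μ`. -/
def phi (M : FactorSample Ω K p n) (P : Measure Ω) : ℝ :=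
  M.mu P ⬝ᵥ ((M.Sig P)⁻¹ *ᵥ M.mu P)

/-- The denominator `φ ϕ - ψ²`. -/
def denom (M : FactorSample Ω K p n) (P : Measure Ω) : ℝ :=
  M.varphi P * M.phi P - M.psi P ^ 2

end FactorSample

/-- Condition (B), on a sequence of models: the fourth moments are finite, `b_n = O(p_n)`,
`c_n` and `d_n` are bounded, and the eigenvalues of `cov(f)` are bounded below by some `σ₁ > 0`. -/
structure ConditionB {Ω : ℕ → Type*} [∀ n, MeasurableSpace (Ω n)] (P : ∀ n, Measure (Ω n))
    {K p : ℕ → ℕ} (M : ∀ n, FactorSample (Ω n) (K n) (p n) n) : Prop where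
  memLp_f : ∀ n ≥ 1, ∀ a, MemLp (fun ω => (M n).f ω a) 4 (P n)
  memLp_noise : ∀ n ≥ 1, ∀ k, MemLp (fun ω => (M n).noise ω k) 4 (P n)
  b_isBigO : (fun n => (M n).b (P n)) =O[atTop] fun n => (p n : ℝ)
  c_bounded : ∃ C : ℝ, ∀ n ≥ 1, (M n).c (P n) ≤ C
  d_bounded : ∃ C : ℝ, ∀ n ≥ 1, (M n).d (P n) ≤ C
  eigenvalues : ∃ σ₁ : ℝ, 0 < σ₁ ∧ ∀ n ≥ 1, ∀ t ∈ spectrum ℝ (covMatrix (P n) (M n).f), σ₁ ≤ t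

/-- Condition (C), on a sequence of models: the eigenvalues of the noise covariance matrices are
bounded below by some `σ₂ > 0`. -/
def ConditionC {Ω : ℕ → Type*} {K p : ℕ → ℕ}
    (M : ∀ n, FactorSample (Ω n) (K n) (p n) n) : Prop :=
  ∃ σ₂ : ℝ, 0 < σ₂ ∧ ∀ n ≥ 1, ∀ t ∈ spectrum ℝ (M n).noiseCov, σ₂ ≤ t

end

set_option linter.unusedSectionVars false

noncomputable section

/-! ### Quadratic forms and the mean-variance problem -/

/-! Write s = (log n / n)^{1/2}, and let Δ be the error of a mean estimator. Everything is reduced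
to one deterministic perturbation bound and second-moment estimates for averages, and no relation
between p, K and n is needed beyond K ≤ p.

Deterministic part. The population optimum ξ satisfies Σξ = α1 + βμ, and there is a direction θ with
θ'1 = 0, θ'μ = 1. The assumptions on φ, ψ, ϕ and γ bound β, ξ'Σξ and θ'Σθ (`exists_lagrangeData`).
Let T be a positive semidefinite matrix whose quadratic form is within e‖x‖² of that of Σ. Moving ξ
along θ produces a portfolio feasible for the perturbed mean, which bounds the new optimum from
above. The tangent inequality η'Ση ≥ 2η'Σξ - ξ'Σξ at the new minimizer η bounds it from below. Hence
the optimal variances differ by O(e) once ‖Δ‖ and |ξ'Δ| are at most e and |ξ'Δ|, |θ'Δ| are at most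
1/2 (`LagrangeData.abs_sub_le`).

Probabilistic part. For e proportional to η p²K²s these conditions fail with vanishing probability.
Chebyshev in Frobenius norm bounds the failure of each empirical moment by const/(η² n s²) =
const/(η² log n), so the logarithm is what turns O_P into o_P. The thresholds 1/2 must hold however
fast p grows: ξ'Δ and θ'Δ have second moments at most 2ξ'Σξ/n and 2θ'Σθ/n, free of the dimension.
For the factor-model mean this uses that its noise part is a sum of conditionally centred errors
with weights depending on the factors only (`integral_sq_weighted_sum`).

Invertibility of the Gram matrix XX' is controlled only when Ks ≤ σ/2. If Ks > σ/2, the target rate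
p²K²s is at least σ²p/(4s), so crude bounds suffice: the factor covariance estimator is at most
(3/n)‖Y‖² because projections contract, and a singular XX' gives mean estimate 0, for which the
optimal variance stays bounded up to e (`LagrangeData.abs_sub_le_of_mean_zero`).

Both covariance estimators are handled at the rate p²K²s. Since K ≤ p, this is at most the rate p³Ks
claimed for the sample covariance matrix. -/

lemma dotProduct_sq_le {ι : Type*} [Fintype ι] (x y : ι → ℝ) :
    (x ⬝ᵥ y) ^ 2 ≤ (x ⬝ᵥ x) * (y ⬝ᵥ y) := by
  have h := Finset.sum_mul_sq_le_sq_mul_sq Finset.univ x y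
  simpa [dotProduct, sq] using h

lemma dotProduct_self_nonneg_real {ι : Type*} [Fintype ι] (x : ι → ℝ) : 0 ≤ x ⬝ᵥ x :=
  Finset.sum_nonneg fun i _ => mul_self_nonneg (x i)

lemma dotProduct_mulVec_symm {ι : Type*} [Fintype ι] {S : Matrix ι ι ℝ} (hS : S.IsSymm)
    (x y : ι → ℝ) : x ⬝ᵥ (S *ᵥ y) = y ⬝ᵥ (S *ᵥ x) := by
  rw [dotProduct_mulVec, ← mulVec_transpose, hS.eq, dotProduct_comm]

lemma quadForm_add_smul {ι : Type*} [Fintype ι] {S : Matrix ι ι ℝ} (hS : S.IsSymm)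
    (x y : ι → ℝ) (t : ℝ) :
    (x + t • y) ⬝ᵥ (S *ᵥ (x + t • y))
      = x ⬝ᵥ (S *ᵥ x) + 2 * t * (y ⬝ᵥ (S *ᵥ x)) + t ^ 2 * (y ⬝ᵥ (S *ᵥ y)) := by
  simp only [mulVec_add, mulVec_smul, add_dotProduct, dotProduct_add, smul_dotProduct,
    dotProduct_smul, smul_eq_mul]
  rw [dotProduct_mulVec_symm hS x y]
  ring

/-- Two minimizers each bound the other, so the choice inside `optimalPortfolio` is immaterial. -/
lemma IsMeanVarianceOptimal.optimalVariance_eq {p : ℕ} {S : Matrix (Fin p) (Fin p) ℝ}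
    {m : Fin p → ℝ} {γ : ℝ} {ξ : Fin p → ℝ} (h : IsMeanVarianceOptimal S m γ ξ) :
    optimalVariance S m γ = ξ ⬝ᵥ (S *ᵥ ξ) := by
  have hex : ∃ ξ, IsMeanVarianceOptimal S m γ ξ := ⟨ξ, h⟩
  have hc := hex.choose_spec
  have : optimalPortfolio S m γ = hex.choose := dif_pos hex
  rw [optimalVariance, this]
  exact le_antisymm (hc.2 ξ h.1.1 h.1.2) (h.2 _ hc.1.1 hc.1.2)

lemma optimalVariance_of_not_exists {p : ℕ} {S : Matrix (Fin p) (Fin p) ℝ}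
    {m : Fin p → ℝ} {γ : ℝ} (h : ¬ ∃ ξ, IsMeanVarianceOptimal S m γ ξ) :
    optimalVariance S m γ = 0 := by
  have : optimalPortfolio S m γ = 0 := dif_neg h
  simp [optimalVariance, this]

lemma optimalVariance_nonneg {p : ℕ} {S : Matrix (Fin p) (Fin p) ℝ}
    (hS : ∀ x, 0 ≤ x ⬝ᵥ (S *ᵥ x)) (m : Fin p → ℝ) (γ : ℝ) : 0 ≤ optimalVariance S m γ :=
  hS _

/-- The default value 0 also lies below every value of a nonnegative form, so a feasible portfolio
gives an upper bound without knowing that a minimizer exists. -/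
lemma optimalVariance_le {p : ℕ} {S : Matrix (Fin p) (Fin p) ℝ}
    (hS : ∀ x, 0 ≤ x ⬝ᵥ (S *ᵥ x)) {m : Fin p → ℝ} {γ : ℝ} {x : Fin p → ℝ}
    (h1 : x ⬝ᵥ 1 = 1) (hm : x ⬝ᵥ m = γ) : optimalVariance S m γ ≤ x ⬝ᵥ (S *ᵥ x) := by
  by_cases h : ∃ ξ, IsMeanVarianceOptimal S m γ ξ
  · obtain ⟨ξ, hξ⟩ := h
    rw [hξ.optimalVariance_eq]
    exact hξ.2 x h1 hm
  · rw [optimalVariance_of_not_exists h]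
    exact hS x

/-- A coercive form has compact sublevel sets; minimizing over the feasible points no worse than the
given x is enough. -/
lemma exists_isMeanVarianceOptimal {p : ℕ} {S : Matrix (Fin p) (Fin p) ℝ} {σ : ℝ} (hσ : 0 < σ)
    (hS : ∀ x, σ * (x ⬝ᵥ x) ≤ x ⬝ᵥ (S *ᵥ x)) {m : Fin p → ℝ} {γ : ℝ} {x : Fin p → ℝ}
    (h1 : x ⬝ᵥ 1 = 1) (hm : x ⬝ᵥ m = γ) : ∃ ξ, IsMeanVarianceOptimal S m γ ξ := by
  have hcont : Continuous fun y : Fin p → ℝ => y ⬝ᵥ (S *ᵥ y) := by fun_prop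
  set q := x ⬝ᵥ (S *ᵥ x) with hq
  let F : Set (Fin p → ℝ) := {y | y ⬝ᵥ 1 = 1 ∧ y ⬝ᵥ m = γ ∧ y ⬝ᵥ (S *ᵥ y) ≤ q}
  have hclosed : IsClosed F := by
    refine IsClosed.inter ?_ (IsClosed.inter ?_ ?_)
    · exact isClosed_eq (by fun_prop) continuous_const
    · exact isClosed_eq (by fun_prop) continuous_const
    · exact isClosed_le hcont continuous_const
  have hbdd : Bornology.IsBounded F := by
    refine (Metric.isBounded_iff_subset_closedBall 0).2 ⟨√(q / σ), fun y hy => ?_⟩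
    rw [mem_closedBall_zero_iff, pi_norm_le_iff_of_nonneg (Real.sqrt_nonneg _)]
    intro i
    rw [Real.norm_eq_abs]
    apply Real.abs_le_sqrt
    have h2 : y i ^ 2 ≤ y ⬝ᵥ y := by
      rw [sq]
      exact Finset.single_le_sum (f := fun i => y i * y i) (fun j _ => mul_self_nonneg (y j))
        (Finset.mem_univ i)
    rw [le_div_iff₀ hσ]
    nlinarith [hS y, hy.2.2]
  obtain ⟨ξ, hξ, hmin⟩ := (Metric.isCompact_of_isClosed_isBounded hclosed hbdd).exists_isMinOn
    ⟨x, h1, hm, le_rfl⟩ hcont.continuousOn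
  refine ⟨ξ, ⟨hξ.1, hξ.2.1⟩, fun η hη1 hηm => ?_⟩
  by_cases hle : η ⬝ᵥ (S *ᵥ η) ≤ q
  · exact hmin ⟨hη1, hηm, hle⟩
  · exact hξ.2.2.trans (not_le.1 hle).le

/-- A Lagrange certificate for the mean-variance problem `(S, m, γ)`, together with a solution of
the problem with constraints `θ' 1 = 0`, `θ' m = 1` that is used to move along the constraints. -/
structure LagrangeData {p : ℕ} (S : Matrix (Fin p) (Fin p) ℝ) (m : Fin p → ℝ) (γ σ C : ℝ) where
  /-- the optimal portfolio -/
  ξ : Fin p → ℝ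
  /-- the direction that changes the mean by one -/
  θ : Fin p → ℝ
  /-- the multiplier of the budget constraint -/
  α : ℝ
  /-- the multiplier of the mean constraint -/
  β : ℝ
  symm : S.IsSymm
  σ_pos : 0 < σ
  lower : ∀ x, σ * (x ⬝ᵥ x) ≤ x ⬝ᵥ (S *ᵥ x)
  mulVec_ξ : S *ᵥ ξ = α • 1 + β • m
  ξ_one : ξ ⬝ᵥ 1 = 1
  ξ_m : ξ ⬝ᵥ m = γ
  θ_one : θ ⬝ᵥ 1 = 0
  θ_m : θ ⬝ᵥ m = 1
  β_le : |β| ≤ C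
  V_le : ξ ⬝ᵥ (S *ᵥ ξ) ≤ C
  θ_le : θ ⬝ᵥ (S *ᵥ θ) ≤ C

namespace LagrangeData

variable {p : ℕ} {S : Matrix (Fin p) (Fin p) ℝ} {m : Fin p → ℝ} {γ σ C : ℝ}

/-- This is (x - ξ)'S(x - ξ) ≥ 0 expanded: the convex form lies above its tangent at ξ. -/
lemma two_mul_sub_le (D : LagrangeData S m γ σ C) (x : Fin p → ℝ) :
    2 * (x ⬝ᵥ (S *ᵥ D.ξ)) - D.ξ ⬝ᵥ (S *ᵥ D.ξ) ≤ x ⬝ᵥ (S *ᵥ x) := by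
  have h := quadForm_add_smul D.symm x D.ξ (-1)
  have h2 := D.lower (x + (-1 : ℝ) • D.ξ)
  have h3 := mul_nonneg D.σ_pos.le (dotProduct_self_nonneg_real (x + (-1 : ℝ) • D.ξ))
  rw [dotProduct_mulVec_symm D.symm x D.ξ]
  linarith

/-- Since Sξ is a combination of 1 and m, η'Sξ takes the same value at every feasible η, and the
tangent inequality concludes. -/
lemma isOptimal (D : LagrangeData S m γ σ C) : IsMeanVarianceOptimal S m γ D.ξ := by
  refine ⟨⟨D.ξ_one, D.ξ_m⟩, fun η h1 hm => ?_⟩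
  have h := D.two_mul_sub_le η
  have e1 : η ⬝ᵥ (S *ᵥ D.ξ) = D.α + D.β * γ := by
    rw [D.mulVec_ξ]; simp [dotProduct_add, dotProduct_smul, h1, hm]
  have e2 : D.ξ ⬝ᵥ (S *ᵥ D.ξ) = D.α + D.β * γ := by
    rw [D.mulVec_ξ]; simp [dotProduct_add, dotProduct_smul, D.ξ_one, D.ξ_m]
  linarith

lemma C_nonneg (D : LagrangeData S m γ σ C) : 0 ≤ C := (abs_nonneg _).trans D.β_le

/-- If `m` is replaced by `0`, the optimal variance stays bounded. -/
lemma abs_sub_le_of_mean_zero (D : LagrangeData S m γ σ C) {T : Matrix (Fin p) (Fin p) ℝ}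
    (hT0 : ∀ x, 0 ≤ x ⬝ᵥ (T *ᵥ x)) {b e : ℝ} (hb0 : 0 ≤ b) (he : 0 ≤ e)
    (hb : (1 : Fin p → ℝ) ⬝ᵥ (S *ᵥ 1) ≤ b * p ^ 2)
    (hTS : ∀ x, |x ⬝ᵥ (T *ᵥ x) - x ⬝ᵥ (S *ᵥ x)| ≤ e * (x ⬝ᵥ x)) :
    |optimalVariance T 0 γ - optimalVariance S m γ| ≤ b + C + e := by
  have hV := D.isOptimal.optimalVariance_eq
  have hV0 : 0 ≤ D.ξ ⬝ᵥ (S *ᵥ D.ξ) :=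
    (mul_nonneg D.σ_pos.le (dotProduct_self_nonneg_real _)).trans (D.lower _)
  have hVC := D.V_le
  have hC := D.C_nonneg
  have hp : (1 : ℝ) ≤ p := by
    rcases Nat.eq_zero_or_pos p with h0 | h0
    · subst h0
      have := D.ξ_one
      simp [dotProduct] at this
    · exact_mod_cast h0
  have hup : optimalVariance T 0 γ ≤ b + e := by
    by_cases hex : ∃ ξ, IsMeanVarianceOptimal T 0 γ ξ
    · obtain ⟨η, hη⟩ := hex
      -- Feasibility for mean 0 forces γ = 0, and then the equally weighted portfolio is feasible;
      -- its S-variance is p⁻² 1'S1 ≤ b.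
      have hγ : γ = 0 := by rw [← hη.1.2]; simp
      have hle := optimalVariance_le hT0 (m := 0) (γ := γ) (x := (p : ℝ)⁻¹ • 1)
        (by simp [dotProduct]; field_simp) (by simp [hγ])
      have h1 := (abs_le.1 (hTS ((p : ℝ)⁻¹ • 1))).2
      simp only [mulVec_smul, dotProduct_smul, smul_dotProduct, smul_eq_mul] at h1 hle
      have h11 : (1 : Fin p → ℝ) ⬝ᵥ 1 = p := by simp [dotProduct]
      rw [h11] at h1
      have h2 : (p : ℝ)⁻¹ * ((p : ℝ)⁻¹ * (1 ⬝ᵥ S *ᵥ 1)) ≤ b := by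
        rw [← mul_assoc, ← mul_inv, ← sq, inv_mul_le_iff₀ (by positivity)]
        linarith
      have h3 : e * ((p : ℝ)⁻¹ * ((p : ℝ)⁻¹ * p)) ≤ e := by
        rw [inv_mul_cancel₀ (by positivity), mul_one]
        exact mul_le_of_le_one_right he (inv_le_one_of_one_le₀ hp)
      linarith
    · rw [optimalVariance_of_not_exists hex]; positivity
  have hlo := optimalVariance_nonneg hT0 0 γ
  rw [abs_le]; constructor <;> linarith

/-- The constant in the perturbation bound. -/
def pertConst (σ C : ℝ) : ℝ :=
  2 * C / σ + (6 * C + 4 * C / σ) + 2 * C * (1 + 12 * C / σ) + 12 * C / σ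

/-- Perturbation of the optimal variance. -/
lemma abs_sub_le (D : LagrangeData S m γ σ C) {T : Matrix (Fin p) (Fin p) ℝ}
    (hT0 : ∀ x, 0 ≤ x ⬝ᵥ (T *ᵥ x)) {m' : Fin p → ℝ} {e : ℝ} (he : 0 ≤ e)
    (hTS : ∀ x, |x ⬝ᵥ (T *ᵥ x) - x ⬝ᵥ (S *ᵥ x)| ≤ e * (x ⬝ᵥ x))
    (hΔ : (m' - m) ⬝ᵥ (m' - m) ≤ e ^ 2)
    (hξ : |D.ξ ⬝ᵥ (m' - m)| ≤ e) (hξ' : |D.ξ ⬝ᵥ (m' - m)| ≤ 1 / 2)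
    (hθ : |D.θ ⬝ᵥ (m' - m)| ≤ 1 / 2) :
    |optimalVariance T m' γ - optimalVariance S m γ| ≤ pertConst σ C * e := by
  have hσ := D.σ_pos
  have hC := D.C_nonneg
  have hβ := D.β_le
  have hVC := D.V_le
  rw [D.isOptimal.optimalVariance_eq]
  set V := D.ξ ⬝ᵥ (S *ᵥ D.ξ) with hVdef
  have hξξ : D.ξ ⬝ᵥ D.ξ ≤ C / σ := by
    rw [le_div_iff₀ hσ]; linarith [D.lower D.ξ]
  have hθθ : D.θ ⬝ᵥ D.θ ≤ C / σ := by
    rw [le_div_iff₀ hσ]; linarith [D.lower D.θ, D.θ_le]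
  have hV0 : 0 ≤ V := (mul_nonneg hσ.le (dotProduct_self_nonneg_real _)).trans (D.lower _)
  set a := D.ξ ⬝ᵥ (m' - m)
  set c := D.θ ⬝ᵥ (m' - m)
  have hc1 : 1 / 2 ≤ 1 + c := by linarith [(abs_le.1 hθ).1]
  have hc0 : 0 < 1 + c := by linarith
  -- The mean of ξ + tθ under m' is γ + a + t(1 + c); this t makes it γ.
  set t := -a / (1 + c)
  have htabs : |t| ≤ 2 * |a| := by
    rw [abs_div, abs_neg, abs_of_pos hc0, div_le_iff₀ hc0]
    nlinarith [abs_nonneg a]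
  have ht1 : |t| ≤ 1 := by linarith
  have hte : |t| ≤ 2 * e := by linarith
  have ht2 : t ^ 2 ≤ |t| := by
    rw [← sq_abs]; nlinarith [abs_nonneg t]
  set x := D.ξ + t • D.θ
  have hx1 : x ⬝ᵥ 1 = 1 := by
    simp [x, add_dotProduct, smul_dotProduct, D.ξ_one, D.θ_one]
  have hxm : x ⬝ᵥ m' = γ := by
    have e1 : D.ξ ⬝ᵥ m' = γ + a := by simp [a, dotProduct_sub, D.ξ_m]
    have e2 : D.θ ⬝ᵥ m' = 1 + c := by simp [c, dotProduct_sub, D.θ_m]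
    simp only [x, add_dotProduct, smul_dotProduct, smul_eq_mul, e1, e2, t]
    field_simp; ring
  -- The variance is V + 2tβ + t²θ'Sθ. With |t| ≤ 2e and t² ≤ |t| the linear term costs 4Ce and the
  -- quadratic one 2Ce.
  have hxS : x ⬝ᵥ (S *ᵥ x) ≤ V + 6 * C * e := by
    rw [quadForm_add_smul D.symm]
    have e1 : D.θ ⬝ᵥ (S *ᵥ D.ξ) = D.β := by
      rw [D.mulVec_ξ]; simp [dotProduct_add, dotProduct_smul, D.θ_one, D.θ_m]
    rw [e1]
    have h1 : t * D.β ≤ (2 * e) * C :=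
      (le_abs_self _).trans (by rw [abs_mul]; gcongr)
    have h2 : t ^ 2 * (D.θ ⬝ᵥ (S *ᵥ D.θ)) ≤ (2 * e) * C := by
      calc _ ≤ t ^ 2 * C := by gcongr; exact D.θ_le
        _ ≤ _ := by gcongr; linarith
    linarith
  have hxx : x ⬝ᵥ x ≤ 4 * C / σ := by
    have h1 : x ⬝ᵥ x = D.ξ ⬝ᵥ D.ξ + 2 * t * (D.θ ⬝ᵥ D.ξ) + t ^ 2 * (D.θ ⬝ᵥ D.θ) := by
      have := quadForm_add_smul (S := (1 : Matrix (Fin p) (Fin p) ℝ)) (by simp) D.ξ D.θ t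
      simpa only [one_mulVec] using this
    have h2 : 2 * t * (D.θ ⬝ᵥ D.ξ) ≤ D.ξ ⬝ᵥ D.ξ + t ^ 2 * (D.θ ⬝ᵥ D.θ) := by
      have h := dotProduct_self_nonneg_real (D.ξ + (-t) • D.θ)
      have := quadForm_add_smul (S := (1 : Matrix (Fin p) (Fin p) ℝ)) (by simp) D.ξ D.θ (-t)
      simp only [one_mulVec] at this
      rw [this] at h
      linarith
    have h3 : t ^ 2 * (D.θ ⬝ᵥ D.θ) ≤ C / σ :=
      (mul_le_of_le_one_left (dotProduct_self_nonneg_real _) (by linarith)).trans hθθ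
    have : 4 * C / σ = 4 * (C / σ) := by ring
    linarith
  have hup : optimalVariance T m' γ ≤ V + (6 * C + 4 * C / σ) * e := by
    have h1 := optimalVariance_le hT0 hx1 hxm
    have h2 := (abs_le.1 (hTS x)).2
    have h3 : e * (x ⬝ᵥ x) ≤ e * (4 * C / σ) := by gcongr
    linarith
  have hlo0 := optimalVariance_nonneg hT0 m' γ
  have hc2 : 0 ≤ 4 * C / σ := by positivity
  have hc3 : 0 ≤ 2 * C / σ := by positivity
  have hc4 : 0 ≤ 12 * C / σ := by positivity
  have hc5 : 0 ≤ 2 * C * (1 + 12 * C / σ) := by positivity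
  have hpert : 6 * C + 4 * C / σ ≤ pertConst σ C := by
    unfold pertConst; linarith
  have hup' : optimalVariance T m' γ - V ≤ pertConst σ C * e := by
    nlinarith [mul_le_mul_of_nonneg_right hpert he]
  rw [abs_le]
  refine ⟨?_, hup'⟩
  -- For e ≥ σ/2 the lower bound is trivial, since V ≤ C ≤ (2C/σ)e and the other variance is
  -- nonnegative. Otherwise T inherits the lower bound σ/2 and has a minimizer.
  rcases le_or_gt (σ / 2) e with hbig | hsmall
  · have h1 : V ≤ 2 * C / σ * e := by
      calc V ≤ 2 * C / σ * (σ / 2) := by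
            have : 2 * C / σ * (σ / 2) = C := by field_simp
            linarith
        _ ≤ _ := by gcongr
    have h4 : 2 * C / σ ≤ pertConst σ C := by
      unfold pertConst; linarith
    linarith [mul_le_mul_of_nonneg_right h4 he]
  · have hlowT : ∀ z, σ / 2 * (z ⬝ᵥ z) ≤ z ⬝ᵥ (T *ᵥ z) := fun z => by
      have h1 := (abs_le.1 (hTS z)).1
      have h2 := D.lower z
      have h3 : e * (z ⬝ᵥ z) ≤ σ / 2 * (z ⬝ᵥ z) :=
        mul_le_mul_of_nonneg_right hsmall.le (dotProduct_self_nonneg_real z)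
      linarith
    obtain ⟨η, hη⟩ := exists_isMeanVarianceOptimal (by linarith) hlowT hx1 hxm
    rw [hη.optimalVariance_eq] at hup ⊢
    -- A bound free of e, needed to control ‖η‖: with |t| ≤ 1 the S-variance of x is at most V + 3C
    -- ≤ 4C, and replacing S by T adds at most (σ/2)(4C/σ) = 2C.
    have hQle : η ⬝ᵥ (T *ᵥ η) ≤ 6 * C := by
      have hxS' : x ⬝ᵥ (S *ᵥ x) ≤ V + 3 * C := by
        rw [quadForm_add_smul D.symm]
        have e1 : D.θ ⬝ᵥ (S *ᵥ D.ξ) = D.β := by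
          rw [D.mulVec_ξ]; simp [dotProduct_add, dotProduct_smul, D.θ_one, D.θ_m]
        rw [e1]
        have h1 : t * D.β ≤ 1 * C := (le_abs_self _).trans (by rw [abs_mul]; gcongr)
        have h2 : t ^ 2 * (D.θ ⬝ᵥ (S *ᵥ D.θ)) ≤ 1 * C := by
          calc _ ≤ t ^ 2 * C := by gcongr; exact D.θ_le
            _ ≤ _ := by gcongr; linarith
        linarith
      have h3 := hη.2 x hx1 hxm
      have h4 := (abs_le.1 (hTS x)).2
      have h5 : e * (x ⬝ᵥ x) ≤ σ / 2 * (4 * C / σ) :=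
        mul_le_mul hsmall.le hxx (dotProduct_self_nonneg_real x) (by linarith)
      have h6 : σ / 2 * (4 * C / σ) = 2 * C := by field_simp; ring
      linarith
    have hηη : η ⬝ᵥ η ≤ 12 * C / σ := by
      have := hlowT η
      rw [le_div_iff₀ hσ]; linarith
    have h1 := D.two_mul_sub_le η
    -- η has mean γ under m', hence γ - η'(m' - m) under m, so η'Sξ differs from V only by βη'(m' -
    -- m).
    have e1 : η ⬝ᵥ (S *ᵥ D.ξ) = D.α + D.β * (γ - η ⬝ᵥ (m' - m)) := by
      rw [D.mulVec_ξ]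
      simp only [dotProduct_add, dotProduct_smul, smul_eq_mul, hη.1.1, dotProduct_sub, hη.1.2]
      ring
    have e2 : V = D.α + D.β * γ := by
      rw [hVdef, D.mulVec_ξ]; simp [dotProduct_add, dotProduct_smul, D.ξ_one, D.ξ_m]
    have hcs := dotProduct_sq_le η (m' - m)
    have habs : |η ⬝ᵥ (m' - m)| ≤ (1 + 12 * C / σ) * e := by
      apply abs_le_of_sq_le_sq _ (by positivity)
      calc _ ≤ (12 * C / σ) * e ^ 2 :=
            hcs.trans (mul_le_mul hηη hΔ (dotProduct_self_nonneg_real _) hc4)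
        _ ≤ (1 + 12 * C / σ) ^ 2 * e ^ 2 :=
            mul_le_mul_of_nonneg_right (by nlinarith only [hc4]) (sq_nonneg e)
        _ = _ := by ring
    have h5 : D.β * (η ⬝ᵥ (m' - m)) ≤ C * ((1 + 12 * C / σ) * e) :=
      (le_abs_self _).trans (by rw [abs_mul]; gcongr)
    have h6 := (abs_le.1 (hTS η)).1
    have h7 : e * (η ⬝ᵥ η) ≤ e * (12 * C / σ) := mul_le_mul_of_nonneg_left hηη he
    have h8 : 2 * C * (1 + 12 * C / σ) + 12 * C / σ ≤ pertConst σ C := by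
      unfold pertConst; linarith
    have h9 := mul_le_mul_of_nonneg_right h8 he
    rw [e1] at h1
    linarith

end LagrangeData

/-! ### Solving the population problem by Lagrange multipliers -/

lemma isUnit_of_lower_bound {ι : Type*} [Fintype ι] [DecidableEq ι] {S : Matrix ι ι ℝ} {σ : ℝ}
    (hσ : 0 < σ) (hS : ∀ x, σ * (x ⬝ᵥ x) ≤ x ⬝ᵥ (S *ᵥ x)) : IsUnit S := by
  rw [← mulVec_injective_iff_isUnit]
  have h0 : ∀ x, S *ᵥ x = 0 → x = 0 := fun x hx => by
    have h := hS x
    rw [hx, dotProduct_zero] at h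
    have h2 := dotProduct_self_nonneg_real x
    exact dotProduct_self_eq_zero.1 (by nlinarith)
  intro x y hxy
  exact sub_eq_zero.1 (h0 _ (by rw [mulVec_sub]; exact sub_eq_zero.2 hxy))

/-- The portfolio S⁻¹(α1 + βm) is feasible when (α, β) solves a 2 × 2 system with matrix entries a,
b, c and determinant d = ac - b². The multipliers are combinations of a/d, b/d, c/d with
coefficients 1 and γ, whence the bounds; moreover ξ'Sξ = α + βγ, and the direction θ has θ'Sθ = a/d.
-/
lemma exists_lagrangeData {p : ℕ} {S : Matrix (Fin p) (Fin p) ℝ} (hS : S.IsSymm) {σ : ℝ}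
    (hσ : 0 < σ) (hlow : ∀ x, σ * (x ⬝ᵥ x) ≤ x ⬝ᵥ (S *ᵥ x)) (m : Fin p → ℝ) (γ : ℝ) {A G : ℝ}
    {a b c : ℝ} (ha : a = 1 ⬝ᵥ (S⁻¹ *ᵥ 1)) (hb : b = 1 ⬝ᵥ (S⁻¹ *ᵥ m)) (hc : c = m ⬝ᵥ (S⁻¹ *ᵥ m))
    (hd : a * c - b ^ 2 ≠ 0) (hA1 : |a / (a * c - b ^ 2)| ≤ A) (hA2 : |b / (a * c - b ^ 2)| ≤ A)
    (hA3 : |c / (a * c - b ^ 2)| ≤ A) (hG : |γ| ≤ G) :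
    Nonempty (LagrangeData S m γ σ (A * (1 + G) ^ 2)) := by
  have hu : IsUnit S.det := (isUnit_iff_isUnit_det S).1 (isUnit_of_lower_bound hσ hlow)
  have hinv : (S⁻¹).IsSymm := by
    rw [IsSymm, transpose_nonsing_inv, hS.eq]
  have hSS : ∀ x, S *ᵥ (S⁻¹ *ᵥ x) = x := fun x => by
    rw [mulVec_mulVec, mul_nonsing_inv _ hu, one_mulVec]
  have hb' : b = m ⬝ᵥ (S⁻¹ *ᵥ 1) := by rw [hb, dotProduct_mulVec_symm hinv]
  set d := a * c - b ^ 2 with hdd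
  have hdot : ∀ (s t : ℝ) (x : Fin p → ℝ), (S⁻¹ *ᵥ (s • 1 + t • m)) ⬝ᵥ x
      = s * (x ⬝ᵥ (S⁻¹ *ᵥ 1)) + t * (x ⬝ᵥ (S⁻¹ *ᵥ m)) := fun s t x => by
    rw [dotProduct_comm, mulVec_add, mulVec_smul, mulVec_smul, dotProduct_add, dotProduct_smul,
      dotProduct_smul, smul_eq_mul, smul_eq_mul]
  have hA : 0 ≤ A := (abs_nonneg _).trans hA1
  have hG0 : 0 ≤ G := (abs_nonneg _).trans hG
  set α := (c - γ * b) / d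
  set β := (γ * a - b) / d
  have e1 : α = c / d - γ * (b / d) := by simp only [α]; ring
  have e2 : β = γ * (a / d) - b / d := by simp only [β]; ring
  have hβ : |β| ≤ A * (1 + G) := by
    rw [e2]
    calc _ ≤ |γ * (a / d)| + |b / d| := abs_sub _ _
      _ ≤ G * A + A := by rw [abs_mul]; gcongr
      _ = _ := by ring
  have hα : |α| ≤ A * (1 + G) := by
    rw [e1]
    calc _ ≤ |c / d| + |γ * (b / d)| := abs_sub _ _
      _ ≤ A + G * A := by rw [abs_mul]; gcongr
      _ = _ := by ring
  have hξ1 : (S⁻¹ *ᵥ (α • 1 + β • m)) ⬝ᵥ 1 = 1 := by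
    rw [hdot, ← ha, ← hb]; simp only [α, β]; field_simp; rw [hdd]; ring
  have hξm : (S⁻¹ *ᵥ (α • 1 + β • m)) ⬝ᵥ m = γ := by
    rw [hdot, ← hb', ← hc]; simp only [α, β]; field_simp; rw [hdd]; ring
  have hθ1 : (S⁻¹ *ᵥ ((-(b / d)) • 1 + (a / d) • m)) ⬝ᵥ 1 = 0 := by
    rw [hdot, ← ha, ← hb]; ring
  have hθm : (S⁻¹ *ᵥ ((-(b / d)) • 1 + (a / d) • m)) ⬝ᵥ m = 1 := by
    rw [hdot, ← hb', ← hc]; field_simp; rw [hdd]; ring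
  refine ⟨⟨_, _, α, β, hS, hσ, hlow, hSS _, hξ1, hξm, hθ1, hθm, ?_, ?_, ?_⟩⟩
  · refine hβ.trans ?_
    rw [sq]; gcongr; nlinarith
  · rw [hSS, dotProduct_add, dotProduct_smul, dotProduct_smul, hξ1, hξm]
    simp only [smul_eq_mul, mul_one]
    calc _ ≤ |α| + |β| * |γ| := by
          rw [← abs_mul]; exact add_le_add (le_abs_self _) (le_abs_self _)
      _ ≤ A * (1 + G) + A * (1 + G) * G := by gcongr
      _ = _ := by ring
  · rw [hSS, dotProduct_add, dotProduct_smul, dotProduct_smul, hθ1, hθm]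
    simp only [smul_eq_mul, mul_one, mul_zero, zero_add]
    calc _ ≤ A := (le_abs_self _).trans hA1
      _ ≤ A * (1 + G) ^ 2 := by nlinarith [mul_nonneg hA hG0, mul_nonneg hA (sq_nonneg G)]

/-! ### Frobenius norms and the estimators -/

section Algebra

open scoped Matrix.Norms.Frobenius

lemma frobenius_norm_sq {ι κ : Type*} [Fintype ι] [Fintype κ] (A : Matrix ι κ ℝ) :
    ‖A‖ ^ 2 = ∑ i, ∑ j, A i j ^ 2 := by
  rw [frobenius_norm_def, ← Real.sqrt_eq_rpow, Real.sq_sqrt]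
  · simp
  · positivity

/-- Cauchy–Schwarz for the entrywise pairing of A with xx', whose Frobenius norm is x'x. -/
lemma abs_quadForm_le {ι : Type*} [Fintype ι] (A : Matrix ι ι ℝ) (x : ι → ℝ) :
    |x ⬝ᵥ (A *ᵥ x)| ≤ ‖A‖ * (x ⬝ᵥ x) := by
  refine abs_le_of_sq_le_sq ?_ (mul_nonneg (norm_nonneg _) (dotProduct_self_nonneg_real x))
  have h := Finset.sum_mul_sq_le_sq_mul_sq Finset.univ (fun ij : ι × ι => A ij.1 ij.2)
    (fun ij => x ij.1 * x ij.2)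
  have e1 : x ⬝ᵥ (A *ᵥ x) = ∑ ij : ι × ι, A ij.1 ij.2 * (x ij.1 * x ij.2) := by
    rw [Fintype.sum_prod_type]
    simp only [dotProduct, mulVec, Finset.mul_sum]
    exact Finset.sum_congr rfl fun i _ => Finset.sum_congr rfl fun j _ => by ring
  have e2 : ∑ ij : ι × ι, (x ij.1 * x ij.2) ^ 2 = (x ⬝ᵥ x) ^ 2 := by
    rw [Fintype.sum_prod_type, sq (x ⬝ᵥ x), dotProduct, Finset.sum_mul_sum]
    exact Finset.sum_congr rfl fun i _ => Finset.sum_congr rfl fun j _ => by ring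
  rw [e1, mul_pow, ← e2, frobenius_norm_sq, ← Fintype.sum_prod_type']
  exact h

lemma frobenius_norm_vecMulVec {ι κ : Type*} [Fintype ι] [Fintype κ] (x : ι → ℝ) (y : κ → ℝ) :
    ‖vecMulVec x y‖ = √(x ⬝ᵥ x) * √(y ⬝ᵥ y) := by
  rw [← Real.sqrt_mul (dotProduct_self_nonneg_real x), eq_comm,
    Real.sqrt_eq_iff_eq_sq (mul_nonneg (dotProduct_self_nonneg_real x)
      (dotProduct_self_nonneg_real y)) (norm_nonneg _), frobenius_norm_sq, dotProduct, dotProduct,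
    Finset.sum_mul_sum]
  exact Finset.sum_congr rfl fun i _ => Finset.sum_congr rfl fun j _ => by
    rw [vecMulVec_apply]; ring

lemma frobenius_norm_diagonal_diag_le {ι : Type*} [Fintype ι] [DecidableEq ι]
    (A : Matrix ι ι ℝ) : ‖diagonal (diag A)‖ ≤ ‖A‖ := by
  refine le_of_sq_le_sq ?_ (norm_nonneg _)
  rw [frobenius_norm_sq, frobenius_norm_sq]
  refine Finset.sum_le_sum fun i _ => Finset.sum_le_sum fun j _ => ?_
  by_cases h : i = j
  · subst h; simp
  · rw [diagonal_apply_ne _ h]; nlinarith only [sq_nonneg (A i j)]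

/-! ### The sample covariance matrix -/

lemma sampleCov_eq {q n : ℕ} (hn : 2 ≤ n) (Z : Matrix (Fin q) (Fin n) ℝ) :
    sampleCov Z = ((n : ℝ) / (n - 1)) • ((n : ℝ)⁻¹ • (Z * Zᵀ)
      - vecMulVec (sampleMean Z) (sampleMean Z)) := by
  have h0 : (n : ℝ) ≠ 0 := by positivity
  have h1 : (n : ℝ) - 1 ≠ 0 := by
    have : (2 : ℝ) ≤ n := by exact_mod_cast hn
    linarith
  have hJ : Z * (Matrix.of fun _ _ => 1 : Matrix (Fin n) (Fin n) ℝ) * Zᵀ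
      = vecMulVec (Z *ᵥ 1) (Z *ᵥ 1) := by
    have : (Matrix.of fun _ _ => 1 : Matrix (Fin n) (Fin n) ℝ) = vecMulVec 1 1 := by
      ext i j; simp [vecMulVec_apply]
    rw [this, mul_vecMulVec, vecMulVec_mul, vecMul_transpose]
  ext i j
  rw [sampleCov, hJ]
  simp only [sampleMean, Matrix.sub_apply, Matrix.smul_apply, vecMulVec_apply, Pi.smul_apply,
    smul_eq_mul]
  field_simp

/-- Deviation of the sample covariance matrix in terms of the deviations of the first two
empirical moments. -/
lemma norm_sampleCov_sub_le {q n : ℕ} (hn : 2 ≤ n) (Z : Matrix (Fin q) (Fin n) ℝ)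
    (G : Matrix (Fin q) (Fin q) ℝ) (m : Fin q → ℝ) :
    ‖sampleCov Z - (G - vecMulVec m m)‖ ≤ 2 / n * ‖G - vecMulVec m m‖
      + 2 * (‖(n : ℝ)⁻¹ • (Z * Zᵀ) - G‖
        + 2 * (√(m ⬝ᵥ m) * √((sampleMean Z - m) ⬝ᵥ (sampleMean Z - m)))
        + (sampleMean Z - m) ⬝ᵥ (sampleMean Z - m)) := by
  have hn2 : (2 : ℝ) ≤ n := by exact_mod_cast hn
  have h1 : 0 < (n : ℝ) - 1 := by linarith
  set d := sampleMean Z - m with hd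
  set A := (n : ℝ)⁻¹ • (Z * Zᵀ) - G with hA
  have hm : sampleMean Z = m + d := by rw [hd]; abel
  have hA' : (n : ℝ)⁻¹ • (Z * Zᵀ) = G + A := by rw [hA]; abel
  -- Insert sample mean = m + d and use n/(n - 1) = 1 + 1/(n - 1); the factor 1/(n - 1) on the
  -- population covariance is the price of that normalization.
  have key : sampleCov Z - (G - vecMulVec m m) = ((n : ℝ) - 1)⁻¹ • (G - vecMulVec m m)
      + ((n : ℝ) / (n - 1)) • (A - vecMulVec m d - vecMulVec d m - vecMulVec d d) := by
    rw [sampleCov_eq hn, hm, hA']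
    ext i j
    simp only [Matrix.sub_apply, Matrix.add_apply, Matrix.smul_apply, vecMulVec_apply,
      Pi.add_apply, smul_eq_mul]
    field_simp
    ring
  have hc1 : ((n : ℝ) - 1)⁻¹ ≤ 2 / n := by
    rw [inv_le_comm₀ h1 (by positivity), inv_div]; linarith
  have hc2 : (n : ℝ) / (n - 1) ≤ 2 := by rw [div_le_iff₀ h1]; linarith
  rw [key]
  refine (norm_add_le _ _).trans (add_le_add ?_ ?_)
  · rw [norm_smul, Real.norm_of_nonneg (by positivity)]
    gcongr
  · rw [norm_smul, Real.norm_of_nonneg (by positivity)]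
    have h3 : ‖A - vecMulVec m d - vecMulVec d m - vecMulVec d d‖
        ≤ ‖A‖ + 2 * (√(m ⬝ᵥ m) * √(d ⬝ᵥ d)) + d ⬝ᵥ d := by
      refine (norm_sub_le _ _).trans (add_le_add ((norm_sub_le _ _).trans ?_) ?_)
      · rw [frobenius_norm_vecMulVec d m]
        have := norm_sub_le A (vecMulVec m d)
        rw [frobenius_norm_vecMulVec] at this
        linarith
      · rw [frobenius_norm_vecMulVec, Real.mul_self_sqrt (dotProduct_self_nonneg_real d)]
    gcongr

lemma quadForm_sampleCov {q n : ℕ} (hn : 2 ≤ n) (Z : Matrix (Fin q) (Fin n) ℝ) (x : Fin q → ℝ) :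
    x ⬝ᵥ (sampleCov Z *ᵥ x) = ((n : ℝ) / (n - 1))
      * ((n : ℝ)⁻¹ * ((Zᵀ *ᵥ x) ⬝ᵥ (Zᵀ *ᵥ x)) - ((n : ℝ)⁻¹ * (1 ⬝ᵥ (Zᵀ *ᵥ x))) ^ 2) := by
  have e1 : x ⬝ᵥ ((Z * Zᵀ) *ᵥ x) = (Zᵀ *ᵥ x) ⬝ᵥ (Zᵀ *ᵥ x) := by
    rw [← mulVec_mulVec, dotProduct_mulVec, ← mulVec_transpose]
  have e2 : x ⬝ᵥ sampleMean Z = (n : ℝ)⁻¹ * (1 ⬝ᵥ (Zᵀ *ᵥ x)) := by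
    rw [sampleMean, dotProduct_smul, dotProduct_mulVec, ← mulVec_transpose, dotProduct_comm,
      smul_eq_mul]
  rw [sampleCov_eq hn, smul_mulVec, sub_mulVec, smul_mulVec, vecMulVec_mulVec, dotProduct_smul,
    dotProduct_sub, dotProduct_smul, e1, ← e2]
  rw [dotProduct_comm (sampleMean Z) x, op_smul_eq_smul, dotProduct_smul]
  simp only [smul_eq_mul]
  ring

/-- Cauchy–Schwarz against the vector of ones: an empirical variance is nonnegative. -/
lemma quadForm_sampleCov_nonneg {q n : ℕ} (hn : 2 ≤ n) (Z : Matrix (Fin q) (Fin n) ℝ)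
    (x : Fin q → ℝ) : 0 ≤ x ⬝ᵥ (sampleCov Z *ᵥ x) := by
  have hn2 : (2 : ℝ) ≤ n := by exact_mod_cast hn
  have h1 : 0 < (n : ℝ) - 1 := by linarith
  rw [quadForm_sampleCov hn]
  refine mul_nonneg (by positivity) ?_
  have h := dotProduct_sq_le (1 : Fin n → ℝ) (Zᵀ *ᵥ x)
  have h11 : (1 : Fin n → ℝ) ⬝ᵥ 1 = n := by simp [dotProduct]
  rw [h11] at h
  rw [mul_pow, sub_nonneg]
  calc _ ≤ ((n : ℝ)⁻¹) ^ 2 * (n * ((Zᵀ *ᵥ x) ⬝ᵥ (Zᵀ *ᵥ x))) := by gcongr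
    _ = _ := by field_simp

lemma quadForm_sampleCov_le {q n : ℕ} (hn : 2 ≤ n) (Z : Matrix (Fin q) (Fin n) ℝ)
    (x : Fin q → ℝ) :
    x ⬝ᵥ (sampleCov Z *ᵥ x) ≤ 2 / n * ((Zᵀ *ᵥ x) ⬝ᵥ (Zᵀ *ᵥ x)) := by
  have hn2 : (2 : ℝ) ≤ n := by exact_mod_cast hn
  have h1 : 0 < (n : ℝ) - 1 := by linarith
  have hc2 : (n : ℝ) / (n - 1) ≤ 2 := by rw [div_le_iff₀ h1]; linarith
  have h3 := dotProduct_self_nonneg_real (Zᵀ *ᵥ x)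
  rw [quadForm_sampleCov hn]
  calc _ ≤ (n : ℝ) / (n - 1) * ((n : ℝ)⁻¹ * ((Zᵀ *ᵥ x) ⬝ᵥ (Zᵀ *ᵥ x))) := by
        gcongr; linarith [sq_nonneg ((n : ℝ)⁻¹ * (1 ⬝ᵥ (Zᵀ *ᵥ x)))]
    _ ≤ 2 * ((n : ℝ)⁻¹ * ((Zᵀ *ᵥ x) ⬝ᵥ (Zᵀ *ᵥ x))) := by gcongr
    _ = _ := by ring

lemma mulVec_dotProduct_self_le {ι κ : Type*} [Fintype ι] [Fintype κ] (A : Matrix ι κ ℝ)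
    (x : κ → ℝ) : (A *ᵥ x) ⬝ᵥ (A *ᵥ x) ≤ ‖A‖ ^ 2 * (x ⬝ᵥ x) := by
  rw [frobenius_norm_sq, Finset.sum_mul, dotProduct]
  refine Finset.sum_le_sum fun i _ => ?_
  have := dotProduct_sq_le (fun j => A i j) x
  simpa [mulVec, dotProduct, sq] using this

/-! #### The projection on the row space -/

/-- The projection `X' (X X')⁻¹ X` on the row space of `X`. -/
def rowProj {K n : ℕ} (X : Matrix (Fin K) (Fin n) ℝ) : Matrix (Fin n) (Fin n) ℝ :=
  Xᵀ * (X * Xᵀ)⁻¹ * X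

lemma rowProj_isSymm {K n : ℕ} (X : Matrix (Fin K) (Fin n) ℝ) : (rowProj X).IsSymm := by
  have : ((X * Xᵀ)⁻¹)ᵀ = (X * Xᵀ)⁻¹ := by rw [transpose_nonsing_inv]; simp
  rw [IsSymm, rowProj, transpose_mul, transpose_mul, this, transpose_transpose, Matrix.mul_assoc]

/-- When XX' is singular its inverse reads as 0, so the matrix is 0 and still idempotent. The
contraction bounds below therefore need no rank condition. -/
lemma rowProj_mul_self {K n : ℕ} (X : Matrix (Fin K) (Fin n) ℝ) :
    rowProj X * rowProj X = rowProj X := by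
  by_cases h : IsUnit (X * Xᵀ).det
  · calc rowProj X * rowProj X = Xᵀ * ((X * Xᵀ)⁻¹ * (X * Xᵀ)) * (X * Xᵀ)⁻¹ * X := by
          simp only [rowProj, Matrix.mul_assoc]
      _ = _ := by rw [nonsing_inv_mul _ h, Matrix.mul_one, rowProj]
  · simp [rowProj, nonsing_inv_apply_not_isUnit _ h]

lemma mul_rowProj {K n : ℕ} {X : Matrix (Fin K) (Fin n) ℝ} (h : IsUnit (X * Xᵀ).det) :
    X * rowProj X = X := by
  rw [rowProj, ← Matrix.mul_assoc, ← Matrix.mul_assoc, mul_nonsing_inv _ h, Matrix.one_mul]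

lemma rowProj_mulVec_dotProduct_self {K n : ℕ} (X : Matrix (Fin K) (Fin n) ℝ) (g : Fin n → ℝ) :
    (rowProj X *ᵥ g) ⬝ᵥ (rowProj X *ᵥ g) = g ⬝ᵥ (rowProj X *ᵥ g) := by
  rw [dotProduct_mulVec_symm (rowProj_isSymm X), mulVec_mulVec, rowProj_mul_self]

lemma rowProj_mulVec_le {K n : ℕ} (X : Matrix (Fin K) (Fin n) ℝ) (g : Fin n → ℝ) :
    (rowProj X *ᵥ g) ⬝ᵥ (rowProj X *ᵥ g) ≤ g ⬝ᵥ g := by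
  have h := dotProduct_self_nonneg_real (g - rowProj X *ᵥ g)
  have e := rowProj_mulVec_dotProduct_self X g
  simp only [sub_dotProduct, dotProduct_sub] at h
  rw [dotProduct_comm (rowProj X *ᵥ g) g] at h
  linarith

lemma sub_rowProj_mulVec_le {K n : ℕ} (X : Matrix (Fin K) (Fin n) ℝ) (g : Fin n → ℝ) :
    (g - rowProj X *ᵥ g) ⬝ᵥ (g - rowProj X *ᵥ g) ≤ g ⬝ᵥ g := by
  have h := dotProduct_self_nonneg_real (rowProj X *ᵥ g)
  have e := rowProj_mulVec_dotProduct_self X g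
  simp only [sub_dotProduct, dotProduct_sub]
  rw [dotProduct_comm (rowProj X *ᵥ g) g]
  linarith

lemma loadingsEst_mul {K p n : ℕ} (X : Matrix (Fin K) (Fin n) ℝ) (Y : Matrix (Fin p) (Fin n) ℝ) :
    loadingsEst X Y * X = Y * rowProj X := by
  simp only [loadingsEst, rowProj, Matrix.mul_assoc]

/-- The loadings estimate itself can be huge when XX' is nearly singular, but through X it acts as a
projection of the data. -/
lemma transpose_mulVec_loadingsEst {K p n : ℕ} (X : Matrix (Fin K) (Fin n) ℝ)
    (Y : Matrix (Fin p) (Fin n) ℝ) (x : Fin p → ℝ) :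
    Xᵀ *ᵥ ((loadingsEst X Y)ᵀ *ᵥ x) = rowProj X *ᵥ (Yᵀ *ᵥ x) := by
  rw [mulVec_mulVec, ← transpose_mul, loadingsEst_mul, transpose_mul, (rowProj_isSymm X).eq,
    mulVec_mulVec]

lemma factorMeanEst_eq {K p n : ℕ} (X : Matrix (Fin K) (Fin n) ℝ)
    (Y : Matrix (Fin p) (Fin n) ℝ) :
    factorMeanEst X Y = (n : ℝ)⁻¹ • (Y *ᵥ (rowProj X *ᵥ 1)) := by
  rw [factorMeanEst, sampleMean, mulVec_smul, mulVec_mulVec, loadingsEst_mul, mulVec_mulVec]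

lemma factorMeanEst_of_not_isUnit {K p n : ℕ} {X : Matrix (Fin K) (Fin n) ℝ}
    (Y : Matrix (Fin p) (Fin n) ℝ) (h : ¬ IsUnit (X * Xᵀ).det) : factorMeanEst X Y = 0 := by
  simp [factorMeanEst, loadingsEst, nonsing_inv_apply_not_isUnit _ h]

/-- The projection reproduces the rows of X, so the signal BX contributes exactly B times the sample
mean of the factors, and the noise enters only through Π1, where Π is `rowProj X`. -/
lemma factorMeanEst_sub {K p n : ℕ} {X : Matrix (Fin K) (Fin n) ℝ}
    (B : Matrix (Fin p) (Fin K) ℝ) (E : Matrix (Fin p) (Fin n) ℝ) (m : Fin K → ℝ)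
    (h : IsUnit (X * Xᵀ).det) :
    factorMeanEst X (B * X + E) - B *ᵥ m
      = B *ᵥ (sampleMean X - m) + (n : ℝ)⁻¹ • (E *ᵥ (rowProj X *ᵥ 1)) := by
  rw [factorMeanEst_eq, add_mulVec, mulVec_mulVec 1 (B * X), Matrix.mul_assoc, mul_rowProj h,
    mulVec_sub, smul_add, sampleMean, mulVec_smul, mulVec_mulVec, mulVec_mulVec]
  abel

/-! #### The factor estimator of the covariance matrix -/

lemma diagonal_quadForm {ι : Type*} [Fintype ι] [DecidableEq ι] (d x : ι → ℝ) :
    x ⬝ᵥ (diagonal d *ᵥ x) = ∑ i, d i * x i ^ 2 := by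
  simp only [dotProduct, mulVec_diagonal]
  exact Finset.sum_congr rfl fun i _ => by ring

lemma quadForm_conj {ι κ : Type*} [Fintype ι] [Fintype κ] (B : Matrix ι κ ℝ) (A : Matrix κ κ ℝ)
    (x : ι → ℝ) : x ⬝ᵥ ((B * A * Bᵀ) *ᵥ x) = (Bᵀ *ᵥ x) ⬝ᵥ (A *ᵥ (Bᵀ *ᵥ x)) := by
  rw [← mulVec_mulVec, ← mulVec_mulVec, dotProduct_mulVec, ← mulVec_transpose]

lemma quadForm_factorCovEst {K p n : ℕ} (X : Matrix (Fin K) (Fin n) ℝ)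
    (Y : Matrix (Fin p) (Fin n) ℝ) (x : Fin p → ℝ) :
    x ⬝ᵥ (factorCovEst X Y *ᵥ x)
      = ((loadingsEst X Y)ᵀ *ᵥ x) ⬝ᵥ (sampleCov X *ᵥ ((loadingsEst X Y)ᵀ *ᵥ x))
        + ∑ k, (n : ℝ)⁻¹ * (residuals X Y k ⬝ᵥ residuals X Y k) * x k ^ 2 := by
  rw [factorCovEst, add_mulVec, dotProduct_add, quadForm_conj, noiseCovEst, diagonal_quadForm]
  rfl

lemma quadForm_factorCovEst_nonneg {K p n : ℕ} (hn : 2 ≤ n) (X : Matrix (Fin K) (Fin n) ℝ)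
    (Y : Matrix (Fin p) (Fin n) ℝ) (x : Fin p → ℝ) : 0 ≤ x ⬝ᵥ (factorCovEst X Y *ᵥ x) := by
  rw [quadForm_factorCovEst]
  refine add_nonneg (quadForm_sampleCov_nonneg hn X _) (Finset.sum_nonneg fun k _ => ?_)
  have := dotProduct_self_nonneg_real (residuals X Y k)
  positivity

/-- A crude bound valid without invertibility of XX': fitted values and residuals are complementary
projections of the rows of Y. The fitted part contributes 2/n and the residual part 1/n. -/
lemma quadForm_factorCovEst_le {K p n : ℕ} (hn : 2 ≤ n) (X : Matrix (Fin K) (Fin n) ℝ)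
    (Y : Matrix (Fin p) (Fin n) ℝ) (x : Fin p → ℝ) :
    x ⬝ᵥ (factorCovEst X Y *ᵥ x) ≤ 3 / n * ‖Y‖ ^ 2 * (x ⬝ᵥ x) := by
  have hn0 : (0 : ℝ) < n := by positivity
  rw [quadForm_factorCovEst]
  have h1 := quadForm_sampleCov_le hn X ((loadingsEst X Y)ᵀ *ᵥ x)
  rw [transpose_mulVec_loadingsEst] at h1
  have h2 : (rowProj X *ᵥ (Yᵀ *ᵥ x)) ⬝ᵥ (rowProj X *ᵥ (Yᵀ *ᵥ x)) ≤ ‖Y‖ ^ 2 * (x ⬝ᵥ x) := by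
    refine (rowProj_mulVec_le X _).trans ?_
    rw [← frobenius_norm_transpose Y]
    exact mulVec_dotProduct_self_le _ x
  have h3 : ∀ k, residuals X Y k ⬝ᵥ residuals X Y k ≤ ‖Y‖ ^ 2 := fun k => by
    have e : residuals X Y k = Y k - rowProj X *ᵥ (Y k) := by
      rw [residuals, loadingsEst_mul]
      ext i
      rw [Matrix.sub_apply, Pi.sub_apply, mul_apply, mulVec, dotProduct]
      congr 1
      refine Finset.sum_congr rfl fun j _ => ?_
      rw [mul_comm, (rowProj_isSymm X).apply]
    rw [e]
    refine (sub_rowProj_mulVec_le X _).trans ?_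
    rw [frobenius_norm_sq]
    refine le_trans (le_of_eq ?_) (Finset.single_le_sum (f := fun k => ∑ j, Y k j ^ 2)
      (fun i _ => by positivity) (Finset.mem_univ k))
    simp [dotProduct, sq]
  have h4 : ∑ k, (n : ℝ)⁻¹ * (residuals X Y k ⬝ᵥ residuals X Y k) * x k ^ 2
      ≤ (n : ℝ)⁻¹ * ‖Y‖ ^ 2 * (x ⬝ᵥ x) := by
    rw [dotProduct, Finset.mul_sum]
    refine Finset.sum_le_sum fun k _ => ?_
    rw [← sq]
    have := h3 k
    gcongr
  have h5 : 2 / (n : ℝ) * ((rowProj X *ᵥ (Yᵀ *ᵥ x)) ⬝ᵥ (rowProj X *ᵥ (Yᵀ *ᵥ x)))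
      ≤ 2 / n * (‖Y‖ ^ 2 * (x ⬝ᵥ x)) := by gcongr
  have e : 3 / (n : ℝ) * ‖Y‖ ^ 2 * (x ⬝ᵥ x) = 2 / n * (‖Y‖ ^ 2 * (x ⬝ᵥ x))
      + (n : ℝ)⁻¹ * ‖Y‖ ^ 2 * (x ⬝ᵥ x) := by ring
  linarith

/-- Each of the K columns of the inverse has Euclidean norm at most 1/σ. -/
lemma norm_inv_le {K : ℕ} {H : Matrix (Fin K) (Fin K) ℝ} {σ : ℝ} (hσ : 0 < σ)
    (hH : ∀ x, σ * (x ⬝ᵥ x) ≤ x ⬝ᵥ (H *ᵥ x)) : ‖H⁻¹‖ ≤ √K / σ := by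
  have hu : IsUnit H.det := (isUnit_iff_isUnit_det H).1 (isUnit_of_lower_bound hσ hH)
  have h1 : ∀ x, (H⁻¹ *ᵥ x) ⬝ᵥ (H⁻¹ *ᵥ x) ≤ (x ⬝ᵥ x) / σ ^ 2 := fun x => by
    have h := hH (H⁻¹ *ᵥ x)
    rw [mulVec_mulVec, mul_nonsing_inv _ hu, one_mulVec] at h
    have h2 := dotProduct_sq_le (H⁻¹ *ᵥ x) x
    have h3 := dotProduct_self_nonneg_real (H⁻¹ *ᵥ x)
    have h4 := dotProduct_self_nonneg_real x
    rw [le_div_iff₀ (by positivity)]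
    rcases h3.eq_or_lt with h0 | h0
    · rw [← h0]; simpa using h4
    · have h5 : (σ * ((H⁻¹ *ᵥ x) ⬝ᵥ (H⁻¹ *ᵥ x))) ^ 2
          ≤ ((H⁻¹ *ᵥ x) ⬝ᵥ (H⁻¹ *ᵥ x)) * (x ⬝ᵥ x) := (by gcongr : _ ≤ _).trans h2
      have h6 : ((H⁻¹ *ᵥ x) ⬝ᵥ (H⁻¹ *ᵥ x)) * (((H⁻¹ *ᵥ x) ⬝ᵥ (H⁻¹ *ᵥ x)) * σ ^ 2)
          ≤ ((H⁻¹ *ᵥ x) ⬝ᵥ (H⁻¹ *ᵥ x)) * (x ⬝ᵥ x) := by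
        calc _ = (σ * ((H⁻¹ *ᵥ x) ⬝ᵥ (H⁻¹ *ᵥ x))) ^ 2 := by ring
          _ ≤ _ := h5
      exact le_of_mul_le_mul_left h6 h0
  refine le_of_sq_le_sq ?_ (by positivity)
  rw [frobenius_norm_sq, Finset.sum_comm, div_pow, Real.sq_sqrt (by positivity)]
  calc ∑ j, ∑ i, H⁻¹ i j ^ 2 ≤ ∑ j : Fin K, 1 / σ ^ 2 := by
        refine Finset.sum_le_sum fun j _ => ?_
        have := h1 (Pi.single j 1)
        simpa [dotProduct, sq, Pi.single_apply] using this
    _ = _ := by simp [div_eq_mul_inv]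

/-- Deviation of the factor estimator of the covariance matrix when the empirical second moment
matrix of the factors is well conditioned. -/
lemma norm_factorCovEst_sub_le {K p n : ℕ} (hn : 2 ≤ n) (X : Matrix (Fin K) (Fin n) ℝ)
    (B : Matrix (Fin p) (Fin K) ℝ) (E : Matrix (Fin p) (Fin n) ℝ)
    (C : Matrix (Fin K) (Fin K) ℝ) (S₀ : Matrix (Fin p) (Fin p) ℝ) {σ : ℝ} (hσ : 0 < σ)
    (hH : ∀ x, σ * (x ⬝ᵥ x) ≤ x ⬝ᵥ (((n : ℝ)⁻¹ • (X * Xᵀ)) *ᵥ x)) {w : ℝ}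
    (hw : ‖(n : ℝ)⁻¹ • (E * Xᵀ)‖ * (√K / σ) ≤ w) :
    ‖factorCovEst X (B * X + E) - (B * C * Bᵀ + S₀)‖ ≤
      ‖B‖ ^ 2 * ‖sampleCov X - C‖ + (2 * (w * ‖B‖) + w ^ 2) * ‖sampleCov X‖
        + ‖diagonal (diag ((n : ℝ)⁻¹ • (E * Eᵀ))) - S₀‖ + w * ‖(n : ℝ)⁻¹ • (E * Xᵀ)‖ := by
  have hn0 : (n : ℝ) ≠ 0 := by positivity
  set H := (n : ℝ)⁻¹ • (X * Xᵀ) with hHdef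
  set R := (n : ℝ)⁻¹ • (E * Xᵀ) with hR
  have hu : IsUnit H.det := (isUnit_iff_isUnit_det H).1 (isUnit_of_lower_bound hσ hH)
  -- W is the estimation error of the loadings.
  set W := R * H⁻¹ with hWdef
  have hXX : X * Xᵀ = (n : ℝ) • H := by rw [hHdef, smul_smul, mul_inv_cancel₀ hn0, one_smul]
  have hEX : E * Xᵀ = (n : ℝ) • R := by rw [hR, smul_smul, mul_inv_cancel₀ hn0, one_smul]
  have hXXi : (X * Xᵀ)⁻¹ = (n : ℝ)⁻¹ • H⁻¹ := by
    rw [hXX]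
    apply inv_eq_left_inv
    rw [smul_mul_smul_comm, nonsing_inv_mul _ hu, inv_mul_cancel₀ hn0, one_smul]
  have hL : loadingsEst X (B * X + E) = B + W := by
    rw [loadingsEst, hXXi, Matrix.add_mul, Matrix.mul_assoc B, hEX, hXX]
    clear_value H R
    simp only [Matrix.add_mul, Matrix.smul_mul, Matrix.mul_smul, smul_add, smul_smul,
      inv_mul_cancel₀ hn0, one_smul, Matrix.mul_assoc, mul_nonsing_inv _ hu, Matrix.mul_one, hWdef]
  have hres : residuals X (B * X + E) = E - W * X := by
    rw [residuals, hL, Matrix.add_mul]; abel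
  have hHs : Hᵀ = H := by rw [hHdef]; simp
  have hHi : (H⁻¹)ᵀ = H⁻¹ := by rw [transpose_nonsing_inv, hHs]
  have hXE : X * Eᵀ = (n : ℝ) • Rᵀ := by
    rw [← transpose_smul, ← hEX, transpose_mul, transpose_transpose]
  have hWH : W * H = R := by rw [hWdef, Matrix.mul_assoc, nonsing_inv_mul _ hu, Matrix.mul_one]
  -- Expanding gives n⁻¹EE' - RW' - WR' + WHW'. Since WH = R, the last term cancels the second and
  -- only -WR' survives.
  have hnoise : (n : ℝ)⁻¹ • (residuals X (B * X + E) * (residuals X (B * X + E))ᵀ)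
      = (n : ℝ)⁻¹ • (E * Eᵀ) - W * Rᵀ := by
    have h1 : (E - W * X) * (E - W * X)ᵀ
        = E * Eᵀ - (E * Xᵀ) * Wᵀ - W * (X * Eᵀ) + W * (X * Xᵀ) * Wᵀ := by
      rw [transpose_sub, transpose_mul, Matrix.sub_mul, Matrix.mul_sub, Matrix.mul_sub]
      simp only [Matrix.mul_assoc]
      abel
    rw [hres, h1, hEX, hXE, hXX]
    clear_value W H R
    simp only [Matrix.smul_mul, Matrix.mul_smul, hWH, smul_sub, smul_add, smul_smul,
      inv_mul_cancel₀ hn0, one_smul]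
    abel
  have hW : ‖W‖ ≤ w := by
    refine (frobenius_norm_mul _ _).trans (le_trans ?_ hw)
    gcongr
    exact norm_inv_le hσ hH
  have hw0 : 0 ≤ w := (norm_nonneg _).trans hW
  have key : factorCovEst X (B * X + E) - (B * C * Bᵀ + S₀)
      = B * (sampleCov X - C) * Bᵀ + (W * sampleCov X * Bᵀ + B * sampleCov X * Wᵀ
        + W * sampleCov X * Wᵀ) + (diagonal (diag ((n : ℝ)⁻¹ • (E * Eᵀ))) - S₀)
        - diagonal (diag (W * Rᵀ)) := by
    have hdd : diagonal (diag ((n : ℝ)⁻¹ • (E * Eᵀ) - W * Rᵀ))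
        = diagonal (diag ((n : ℝ)⁻¹ • (E * Eᵀ))) - diagonal (diag (W * Rᵀ)) := by
      rw [diag_sub, diagonal_sub]; rfl
    rw [factorCovEst, noiseCovEst, hnoise, hL, hdd, transpose_add]
    simp only [Matrix.add_mul, Matrix.mul_add, Matrix.sub_mul, Matrix.mul_sub]
    abel
  have n3 : ∀ (A₁ : Matrix (Fin p) (Fin K) ℝ) (D : Matrix (Fin K) (Fin K) ℝ)
      (A₂ : Matrix (Fin p) (Fin K) ℝ), ‖A₁ * D * A₂ᵀ‖ ≤ ‖A₁‖ * ‖D‖ * ‖A₂‖ := fun A₁ D A₂ => by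
    refine (frobenius_norm_mul _ _).trans ?_
    rw [frobenius_norm_transpose]
    gcongr
    exact frobenius_norm_mul _ _
  have b1 : ‖B * (sampleCov X - C) * Bᵀ‖ ≤ ‖B‖ ^ 2 * ‖sampleCov X - C‖ :=
    (n3 _ _ _).trans (le_of_eq (by ring))
  have b2 : ‖W * sampleCov X * Bᵀ‖ ≤ w * ‖sampleCov X‖ * ‖B‖ := (n3 _ _ _).trans (by gcongr)
  have b3 : ‖B * sampleCov X * Wᵀ‖ ≤ ‖B‖ * ‖sampleCov X‖ * w := (n3 _ _ _).trans (by gcongr)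
  have b4 : ‖W * sampleCov X * Wᵀ‖ ≤ w * ‖sampleCov X‖ * w := (n3 _ _ _).trans (by gcongr)
  have b5 : ‖diagonal (diag (W * Rᵀ))‖ ≤ w * ‖R‖ := by
    refine (frobenius_norm_diagonal_diag_le _).trans ((frobenius_norm_mul _ _).trans ?_)
    rw [frobenius_norm_transpose]
    gcongr
  rw [key]
  calc _ ≤ ‖B * (sampleCov X - C) * Bᵀ‖ + (‖W * sampleCov X * Bᵀ‖ + ‖B * sampleCov X * Wᵀ‖
        + ‖W * sampleCov X * Wᵀ‖) + ‖diagonal (diag ((n : ℝ)⁻¹ • (E * Eᵀ))) - S₀‖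
        + ‖diagonal (diag (W * Rᵀ))‖ := by
        refine (norm_sub_le _ _).trans (add_le_add_left ((norm_add_le _ _).trans
          (add_le_add_left ((norm_add_le _ _).trans (add_le_add_right
            (norm_add₃_le) _)) _)) _)
    _ ≤ _ := by linarith

end Algebra

/-! ### Moments of averages of independent copies -/

/-- Markov's inequality in the form used below. -/
lemma measure_lt_le_of_integral_le {Ω : Type*} [MeasurableSpace Ω] {P : Measure Ω} {F : Ω → ℝ} (hF0 : ∀ ω, 0 ≤ F ω)
    (hF : Integrable F P) {a t : ℝ} (ha : ∫ ω, F ω ∂P ≤ a) (ht : 0 < t) :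
    P {ω | t < F ω} ≤ ENNReal.ofReal (a / t) := by
  have h := mul_meas_ge_le_lintegral₀ (μ := P) hF.aestronglyMeasurable.aemeasurable.ennreal_ofReal
    (ENNReal.ofReal t)
  rw [← ofReal_integral_eq_lintegral_ofReal hF (ae_of_all _ hF0)] at h
  have h1 : P {ω | t < F ω} ≤ P {ω | ENNReal.ofReal t ≤ ENNReal.ofReal (F ω)} :=
    measure_mono fun ω hω => ENNReal.ofReal_le_ofReal (le_of_lt hω)
  rw [ENNReal.ofReal_div_of_pos ht, ENNReal.le_div_iff_mul_le (by simp [ht]) (by simp), mul_comm]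
  calc _ ≤ _ := by gcongr
    _ ≤ _ := h
    _ ≤ _ := ENNReal.ofReal_le_ofReal ha

section IIDAverages

variable {Ω : Type*} [MeasurableSpace Ω] {P : Measure Ω} [IsProbabilityMeasure P]
  {𝒵 : Type*} [MeasurableSpace 𝒵] {n : ℕ}

lemma integral_sq_average_sub {Z : Fin n → Ω → 𝒵} {Z₀ : Ω → 𝒵} (hn : 0 < n)
    (hind : iIndepFun Z P) (hid : ∀ i, IdentDistrib (Z i) Z₀ P P) {g : 𝒵 → ℝ}
    (hg : Measurable g) (hL : MemLp (fun ω => g (Z₀ ω)) 2 P) :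
    Integrable (fun ω => ((n : ℝ)⁻¹ * ∑ i, g (Z i ω) - ∫ ω', g (Z₀ ω') ∂P) ^ 2) P ∧
    ∫ ω, ((n : ℝ)⁻¹ * ∑ i, g (Z i ω) - ∫ ω', g (Z₀ ω') ∂P) ^ 2 ∂P
      = (n : ℝ)⁻¹ * variance (fun ω => g (Z₀ ω)) P := by
  have hn0 : (n : ℝ) ≠ 0 := by positivity
  have hidg : ∀ i, IdentDistrib (fun ω => g (Z i ω)) (fun ω => g (Z₀ ω)) P P :=
    fun i => (hid i).comp hg
  have hLi : ∀ i, MemLp (fun ω => g (Z i ω)) 2 P := fun i => (hidg i).memLp_iff.2 hL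
  have hindg : iIndepFun (fun i ω => g (Z i ω)) P := hind.comp (fun _ => g) (fun _ => hg)
  set S : Ω → ℝ := ∑ i, fun ω => g (Z i ω) with hS
  have hSL : MemLp S 2 P := memLp_finsetSum' _ fun i _ => hLi i
  have hSint : ∫ ω, S ω ∂P = n * ∫ ω, g (Z₀ ω) ∂P := by
    simp only [hS, Finset.sum_apply]
    rw [integral_finsetSum _ fun i _ => (hLi i).integrable one_le_two]
    simp [fun i => (hidg i).integral_eq]
  have hSvar : variance S P = n * variance (fun ω => g (Z₀ ω)) P := by
    rw [hS, IndepFun.variance_sum (fun i _ => hLi i)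
      (fun i _ j _ hij => hindg.indepFun hij)]
    simp [fun i => (hidg i).variance_eq]
  have hpt : ∀ ω, ((n : ℝ)⁻¹ * ∑ i, g (Z i ω) - ∫ ω', g (Z₀ ω') ∂P) ^ 2
      = ((n : ℝ)⁻¹) ^ 2 * (S ω - ∫ ω, S ω ∂P) ^ 2 := fun ω => by
    rw [hSint, hS, Finset.sum_apply, ← mul_pow]
    congr 1
    field_simp
  have hI : Integrable (fun ω => (S ω - ∫ ω, S ω ∂P) ^ 2) P :=
    (hSL.sub (memLp_const _)).integrable_sq
  simp only [hpt]
  refine ⟨hI.const_mul _, ?_⟩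
  rw [integral_const_mul, ← variance_eq_integral hSL.aestronglyMeasurable.aemeasurable, hSvar]
  field_simp

/-- Each average has variance 1/n times that of one observation, which is at most its second moment;
no dependence structure between the coordinates k is needed. -/
lemma integral_sum_sq_average_sub_le {ι : Type*} [Fintype ι] {Z : Fin n → Ω → 𝒵} {Z₀ : Ω → 𝒵}
    (hn : 0 < n) (hind : iIndepFun Z P) (hid : ∀ i, IdentDistrib (Z i) Z₀ P P)
    {g : ι → 𝒵 → ℝ} (hg : ∀ k, Measurable (g k))
    (hL : ∀ k, MemLp (fun ω => g k (Z₀ ω)) 2 P) :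
    Integrable (fun ω => ∑ k, ((n : ℝ)⁻¹ * ∑ i, g k (Z i ω) - ∫ ω', g k (Z₀ ω') ∂P) ^ 2) P ∧
    ∫ ω, ∑ k, ((n : ℝ)⁻¹ * ∑ i, g k (Z i ω) - ∫ ω', g k (Z₀ ω') ∂P) ^ 2 ∂P
      ≤ (n : ℝ)⁻¹ * ∑ k, ∫ ω, g k (Z₀ ω) ^ 2 ∂P := by
  have h := fun k => integral_sq_average_sub hn hind hid (hg k) (hL k)
  refine ⟨integrable_finsetSum _ fun k _ => (h k).1, ?_⟩
  rw [integral_finsetSum _ fun k _ => (h k).1, Finset.mul_sum]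
  refine Finset.sum_le_sum fun k _ => ?_
  rw [(h k).2]
  gcongr
  exact variance_le_expectation_sq (hL k).aestronglyMeasurable

end IIDAverages

/-! ### Weighted sums of conditionally centred variables -/

section WeightedSums

variable {Ω : Type*} [MeasurableSpace Ω] {P : Measure Ω} [IsProbabilityMeasure P]
  {𝒳 ℰ : Type*} [MeasurableSpace 𝒳] [MeasurableSpace ℰ] {n : ℕ}

/-- Under the product law, Fubini allows integrating over Z first with R frozen. -/
lemma integral_mul_eq_zero_of_indepFun {𝒵 ℛ : Type*} [MeasurableSpace 𝒵] [MeasurableSpace ℛ]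
    {Z : Ω → 𝒵} {R : Ω → ℛ} (hZ : AEMeasurable Z P) (hR : AEMeasurable R P)
    (h : IndepFun Z R P) {F : 𝒵 × ℛ → ℝ} (hF : Measurable F)
    (hint : Integrable (fun ω => F (Z ω, R ω)) P) (h0 : ∀ r, ∫ ω, F (Z ω, r) ∂P = 0) :
    ∫ ω, F (Z ω, R ω) ∂P = 0 := by
  have hmap := (indepFun_iff_map_prod_eq_prod_map_map hZ hR).1 h
  have hZR : AEMeasurable (fun ω => (Z ω, R ω)) P := hZ.prodMk hR
  have e1 : ∫ ω, F (Z ω, R ω) ∂P = ∫ q, F q ∂(P.map fun ω => (Z ω, R ω)) :=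
    (integral_map hZR hF.aestronglyMeasurable).symm
  have hint' : Integrable F ((P.map Z).prod (P.map R)) := by
    rw [← hmap]
    exact (integrable_map_measure hF.aestronglyMeasurable hZR).2 hint
  have := Measure.isProbabilityMeasure_map hZ
  have := Measure.isProbabilityMeasure_map hR
  rw [e1, hmap, integral_prod_symm _ hint']
  refine integral_eq_zero_of_ae (ae_of_all _ fun r => ?_)
  have := integral_map (φ := Z) hZ (f := fun z => F (z, r))
    (hF.comp measurable_prodMk_right).aestronglyMeasurable
  simp only [Pi.zero_apply]
  rw [this, h0]

/-- A conditionally centred function of one observation is orthogonal to functions of its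
conditioning variable and of the other observations. -/
lemma integral_mul_eq_zero_of_iIndepFun {Z : Fin n → Ω → 𝒳 × ℰ} {Z₀ : Ω → 𝒳 × ℰ}
    (hind : iIndepFun Z P) (hid : ∀ i, IdentDistrib (Z i) Z₀ P P) {h : 𝒳 × ℰ → ℝ}
    (hh : Measurable h)
    (h0 : ∀ g : 𝒳 → ℝ, Measurable g → (∃ c, ∀ x, |g x| ≤ c) →
      ∫ ω, h (Z₀ ω) * g (Z₀ ω).1 ∂P = 0)
    (i : Fin n) {G : 𝒳 × ({j // j ≠ i} → 𝒳 × ℰ) → ℝ} (hG : Measurable G)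
    (hGb : ∀ r, ∃ c, ∀ x, |G (x, r)| ≤ c)
    (hint : Integrable (fun ω => h (Z i ω) * G ((Z i ω).1, fun j => Z j ω)) P) :
    ∫ ω, h (Z i ω) * G ((Z i ω).1, fun j => Z j ω) ∂P = 0 := by
  have hm : ∀ j, AEMeasurable (Z j) P := fun j => (hid j).aemeasurable_fst
  have hi : IndepFun (Z i) (fun ω (j : {j // j ≠ i}) => Z j ω) P := by
    have h1 := hind.indepFun_finset₀ {i} (Finset.univ.erase i) (by simp) hm
    have hφ : Measurable fun a : ({i} : Finset (Fin n)) → 𝒳 × ℰ =>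
        a ⟨i, Finset.mem_singleton_self i⟩ := measurable_pi_apply _
    have hψ : Measurable fun (a : ↥(Finset.univ.erase i) → 𝒳 × ℰ)
        (j : {j // j ≠ i}) => a ⟨j, Finset.mem_erase.2 ⟨j.2, Finset.mem_univ _⟩⟩ :=
      measurable_pi_lambda _ fun j => measurable_pi_apply _
    have h2 := h1.comp hφ hψ
    exact h2
  refine integral_mul_eq_zero_of_indepFun (hm i) (aemeasurable_pi_lambda (fun ω (j : {j // j ≠ i}) => Z j ω)
    fun j => hm j) hi
    (F := fun q => h q.1 * G (q.1.1, q.2)) (by fun_prop) hint fun r => ?_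
  have hmeas : Measurable fun z : 𝒳 × ℰ => h z * G (z.1, r) := by fun_prop
  have := ((hid i).comp hmeas).integral_eq
  simp only [Function.comp_def] at this
  rw [this]
  exact h0 (fun x => G (x, r)) (by fun_prop) (hGb r)

/-- Second moment of a sum of conditionally centred variables with constant conditional variance,
weighted by functions of the conditioning variables. -/
lemma integral_sq_weighted_sum {Z : Fin n → Ω → 𝒳 × ℰ} {Z₀ : Ω → 𝒳 × ℰ}
    (hind : iIndepFun Z P) (hid : ∀ i, IdentDistrib (Z i) Z₀ P P) {u : 𝒳 × ℰ → ℝ}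
    (hu : Measurable u) (hL : MemLp (fun ω => u (Z₀ ω)) 2 P) {s : ℝ}
    (h1 : ∀ g : 𝒳 → ℝ, Measurable g → (∃ c, ∀ x, |g x| ≤ c) →
      ∫ ω, u (Z₀ ω) * g (Z₀ ω).1 ∂P = 0)
    (h2 : ∀ g : 𝒳 → ℝ, Measurable g → (∃ c, ∀ x, |g x| ≤ c) →
      ∫ ω, (u (Z₀ ω) ^ 2 - s) * g (Z₀ ω).1 ∂P = 0)
    {v : Fin n → (Fin n → 𝒳) → ℝ} (hv : ∀ i, Measurable (v i)) {c : ℝ}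
    (hvc : ∀ i x, |v i x| ≤ c) :
    Integrable (fun ω => (∑ i, v i (fun j => (Z j ω).1) * u (Z i ω)) ^ 2) P ∧
    ∫ ω, (∑ i, v i (fun j => (Z j ω).1) * u (Z i ω)) ^ 2 ∂P
      = s * ∫ ω, ∑ i, v i (fun j => (Z j ω).1) ^ 2 ∂P := by
  classical
  have hm : ∀ j, AEMeasurable (Z j) P := fun j => (hid j).aemeasurable_fst
  have hX : AEMeasurable (fun ω j => (Z j ω).1) P :=
    aemeasurable_pi_lambda _ fun j => measurable_fst.comp_aemeasurable (hm j)
  have hvX : ∀ i, AEStronglyMeasurable (fun ω => v i (fun j => (Z j ω).1)) P := fun i =>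
    ((hv i).comp_aemeasurable hX).aestronglyMeasurable
  have hLi : ∀ i, MemLp (fun ω => u (Z i ω)) 2 P := fun i => ((hid i).comp hu).memLp_iff.2 hL
  have hterm : ∀ i, MemLp (fun ω => v i (fun j => (Z j ω).1) * u (Z i ω)) 2 P := fun i =>
    ((hLi i).const_mul c).mono ((hvX i).mul (hLi i).aestronglyMeasurable) (ae_of_all _ fun ω => by
      rw [norm_mul, norm_mul]
      gcongr
      exact (hvc i _).trans (le_abs_self c))
  have hprod : ∀ i j, Integrable (fun ω => (v i (fun l => (Z l ω).1) * u (Z i ω))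
      * (v j (fun l => (Z l ω).1) * u (Z j ω))) P := fun i j => (hterm i).integrable_mul (hterm j)
  have hv2 : ∀ i, Integrable (fun ω => v i (fun j => (Z j ω).1) ^ 2) P := fun i =>
    (MemLp.of_bound (p := 2) (hvX i) c (ae_of_all _ fun ω => hvc i _)).integrable_sq
  have hsq : ∀ ω, (∑ i, v i (fun j => (Z j ω).1) * u (Z i ω)) ^ 2
      = ∑ i, ∑ j, (v i (fun l => (Z l ω).1) * u (Z i ω))
      * (v j (fun l => (Z l ω).1) * u (Z j ω)) := fun ω => by
    rw [sq, Finset.sum_mul_sum]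
  -- rebuild the conditioning variables from one of them and the other observations
  let rec' : ∀ i : Fin n, 𝒳 × ({j // j ≠ i} → 𝒳 × ℰ) → Fin n → 𝒳 := fun i q l =>
    if hl : l = i then q.1 else (q.2 ⟨l, hl⟩).1
  have hrec : ∀ i, Measurable (rec' i) := fun i => measurable_pi_lambda _ fun l => by
    by_cases hl : l = i
    · simp only [rec', hl, dite_true]; exact measurable_fst
    · simp only [rec', hl, dite_false]; fun_prop
  have hrecZ : ∀ i ω, rec' i ((Z i ω).1, fun j => Z j ω) = fun l => (Z l ω).1 := fun i ω => by
    ext l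
    by_cases hl : l = i
    · subst hl; simp [rec']
    · simp [rec', hl]
  -- In a cross term everything except u(Z_i) is a function of the conditioning part of Z_i and of
  -- the other observations, so the centring of u applies.
  have hoff : ∀ i j, j ≠ i → ∫ ω, (v i (fun l => (Z l ω).1) * u (Z i ω))
      * (v j (fun l => (Z l ω).1) * u (Z j ω)) ∂P = 0 := fun i j hij => by
    have hpt : ∀ ω, (v i (fun l => (Z l ω).1) * u (Z i ω))
        * (v j (fun l => (Z l ω).1) * u (Z j ω)) = u (Z i ω) *
        (fun q : 𝒳 × ({j // j ≠ i} → 𝒳 × ℰ) => v i (rec' i q) * v j (rec' i q) * u (q.2 ⟨j, hij⟩))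
          ((Z i ω).1, fun j => Z j ω) := fun ω => by
      simp only [hrecZ]; ring
    have hI := hprod i j
    simp only [hpt] at hI ⊢
    refine integral_mul_eq_zero_of_iIndepFun hind hid hu h1 i (G := fun q => v i (rec' i q) *
      v j (rec' i q) * u (q.2 ⟨j, hij⟩)) ?_ ?_ hI
    · have a1 := (hv i).comp (hrec i)
      have a2 := (hv j).comp (hrec i)
      have a3 : Measurable fun q : 𝒳 × ({j // j ≠ i} → 𝒳 × ℰ) => u (q.2 ⟨j, hij⟩) := by fun_prop
      exact (a1.mul a2).mul a3
    · intro r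
      -- The bound may depend on r: once the other observations are frozen, u(Z_j) is a constant,
      -- although u is unbounded.
      refine ⟨c * c * |u (r ⟨j, hij⟩)|, fun x => ?_⟩
      rw [abs_mul, abs_mul]
      have := hvc i (rec' i (x, r))
      have := hvc j (rec' i (x, r))
      have : 0 ≤ c := (abs_nonneg _).trans this
      gcongr
  -- The same orthogonality, now for the conditionally centred function u² - s.
  have hdiag : ∀ i, ∫ ω, (v i (fun l => (Z l ω).1) * u (Z i ω))
      * (v i (fun l => (Z l ω).1) * u (Z i ω)) ∂P
      = s * ∫ ω, v i (fun l => (Z l ω).1) ^ 2 ∂P := fun i => by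
    rw [← integral_const_mul, ← sub_eq_zero, ← integral_sub (hprod i i) ((hv2 i).const_mul s)]
    have hpt : ∀ ω, (v i (fun l => (Z l ω).1) * u (Z i ω))
        * (v i (fun l => (Z l ω).1) * u (Z i ω)) - s * v i (fun l => (Z l ω).1) ^ 2
        = (u (Z i ω) ^ 2 - s) *
        (fun q : 𝒳 × ({j // j ≠ i} → 𝒳 × ℰ) => v i (rec' i q) ^ 2)
          ((Z i ω).1, fun j => Z j ω) := fun ω => by
      simp only [hrecZ]; ring
    have hI := (hprod i i).sub ((hv2 i).const_mul s)
    simp only [Pi.sub_def, hpt] at hI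
    simp only [hpt]
    refine integral_mul_eq_zero_of_iIndepFun hind hid (h := fun z => u z ^ 2 - s)
      (by fun_prop) h2 i (G := fun q => v i (rec' i q) ^ 2) ?_ ?_ hI
    · exact ((hv i).comp (hrec i)).pow_const 2
    · intro r
      refine ⟨c ^ 2, fun x => ?_⟩
      rw [abs_pow]
      have := hvc i (rec' i (x, r))
      gcongr
  simp only [hsq]
  refine ⟨integrable_finsetSum _ fun i _ => integrable_finsetSum _ fun j _ => hprod i j, ?_⟩
  rw [integral_finsetSum _ fun i _ => integrable_finsetSum _ fun j _ => hprod i j,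
    integral_finsetSum _ fun i _ => hv2 i, Finset.mul_sum]
  refine Finset.sum_congr rfl fun i _ => ?_
  rw [integral_finsetSum _ fun j _ => hprod i j, Finset.sum_eq_single i
    (fun j _ hij => hoff i j hij) (by simp), hdiag]

end WeightedSums

/-! ### Moments of random vectors -/

section RandomVectors

open scoped Matrix.Norms.Frobenius

variable {Ω : Type*} [MeasurableSpace Ω] {P : Measure Ω} [IsProbabilityMeasure P]

lemma integral_sq_add {U V : Ω → ℝ} (hU : MemLp U 2 P) (hV : MemLp V 2 P) :
    ∫ ω, (U ω + V ω) ^ 2 ∂P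
      = ∫ ω, U ω ^ 2 ∂P + 2 * ∫ ω, U ω * V ω ∂P + ∫ ω, V ω ^ 2 ∂P := by
  have e : ∀ ω, (U ω + V ω) ^ 2 = U ω ^ 2 + 2 * (U ω * V ω) + V ω ^ 2 := fun ω => by ring
  have i1 : Integrable (fun ω => 2 * (U ω * V ω)) P := (hU.integrable_mul hV).const_mul _
  have i2 : Integrable (fun ω => U ω ^ 2 + 2 * (U ω * V ω)) P := hU.integrable_sq.add i1
  simp only [e]
  rw [integral_add i2 hV.integrable_sq, integral_add hU.integrable_sq i1, integral_const_mul]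

/-- The quadratic t ↦ E(U + tV)² is nonnegative, so its discriminant is at most 0. -/
lemma sq_integral_mul_le {U V : Ω → ℝ} (hU : MemLp U 2 P) (hV : MemLp V 2 P) :
    (∫ ω, U ω * V ω ∂P) ^ 2 ≤ (∫ ω, U ω ^ 2 ∂P) * ∫ ω, V ω ^ 2 ∂P := by
  have h : ∀ t : ℝ, 0 ≤ (∫ ω, V ω ^ 2 ∂P) * (t * t) + (2 * ∫ ω, U ω * V ω ∂P) * t
      + ∫ ω, U ω ^ 2 ∂P := fun t => by
    have h0 : 0 ≤ ∫ ω, (U ω + t * V ω) ^ 2 ∂P := integral_nonneg fun ω => sq_nonneg _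
    rw [integral_sq_add hU (hV.const_mul t)] at h0
    have e1 : ∫ ω, U ω * (t * V ω) ∂P = t * ∫ ω, U ω * V ω ∂P := by
      rw [← integral_const_mul]; congr 1; ext ω; ring
    have e2 : ∫ ω, (t * V ω) ^ 2 ∂P = t ^ 2 * ∫ ω, V ω ^ 2 ∂P := by
      rw [← integral_const_mul]; congr 1; ext ω; ring
    rw [e1, e2] at h0
    linarith
  have := discrim_le_zero h
  rw [discrim] at this
  linarith

/-- The matrix of second moments of a random vector. -/
def secondMoment (P : Measure Ω) {q : ℕ} (Z : Ω → Fin q → ℝ) : Matrix (Fin q) (Fin q) ℝ :=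
  Matrix.of fun i j => ∫ ω, Z ω i * Z ω j ∂P

variable {q : ℕ} {Z : Ω → Fin q → ℝ}

lemma covMatrix_eq (hZ : ∀ k, MemLp (fun ω => Z ω k) 2 P) :
    covMatrix P Z = secondMoment P Z - vecMulVec (meanVector P Z) (meanVector P Z) := by
  ext i j
  rw [covMatrix, of_apply, covariance_eq_sub (hZ i) (hZ j)]
  rfl

lemma covMatrix_isSymm : (covMatrix P Z).IsSymm := by
  ext i j
  exact covariance_comm _ _

lemma integral_sum_sq (hZ : ∀ k, MemLp (fun ω => Z ω k) 2 P) :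
    ∫ ω, ∑ k, Z ω k ^ 2 ∂P = ∑ k, ∫ ω, Z ω k ^ 2 ∂P :=
  integral_finsetSum _ fun k _ => (hZ k).integrable_sq

lemma meanVector_dotProduct_le (hZ : ∀ k, MemLp (fun ω => Z ω k) 2 P) :
    meanVector P Z ⬝ᵥ meanVector P Z ≤ ∫ ω, ∑ k, Z ω k ^ 2 ∂P := by
  rw [integral_sum_sq hZ, dotProduct]
  refine Finset.sum_le_sum fun k _ => ?_
  have h := variance_eq_sub (hZ k)
  have h0 := variance_nonneg (fun ω => Z ω k) P
  simp only [Pi.pow_apply] at h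
  rw [meanVector, ← sq]
  linarith

lemma variance_le_integral_sq {U : Ω → ℝ} (hU : MemLp U 2 P) : variance U P ≤ ∫ ω, U ω ^ 2 ∂P :=
  variance_le_expectation_sq hU.aestronglyMeasurable

/-- Cauchy–Schwarz for each covariance bounds the Frobenius norm by the trace, and the trace is at
most E‖Z‖². -/
lemma norm_covMatrix_le (hZ : ∀ k, MemLp (fun ω => Z ω k) 2 P) :
    ‖covMatrix P Z‖ ≤ ∫ ω, ∑ k, Z ω k ^ 2 ∂P := by
  refine le_of_sq_le_sq ?_ (integral_nonneg fun ω => Finset.sum_nonneg fun k _ => sq_nonneg _)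
  rw [frobenius_norm_sq, integral_sum_sq hZ, sq, Finset.sum_mul_sum]
  refine Finset.sum_le_sum fun i _ => Finset.sum_le_sum fun j _ => ?_
  have hc : ∀ k, MemLp (fun ω => Z ω k - ∫ ω', Z ω' k ∂P) 2 P := fun k =>
    (hZ k).sub (memLp_const _)
  have h := sq_integral_mul_le (hc i) (hc j)
  rw [← variance_eq_integral (hZ i).aestronglyMeasurable.aemeasurable,
    ← variance_eq_integral (hZ j).aestronglyMeasurable.aemeasurable] at h
  refine h.trans (mul_le_mul (variance_le_integral_sq (hZ i)) (variance_le_integral_sq (hZ j))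
    (variance_nonneg _ _) (integral_nonneg fun ω => sq_nonneg _))

lemma quadForm_covMatrix (hZ : ∀ k, MemLp (fun ω => Z ω k) 2 P) (x : Fin q → ℝ) :
    x ⬝ᵥ (covMatrix P Z *ᵥ x) = variance (fun ω => x ⬝ᵥ Z ω) P := by
  have hx : ∀ k, MemLp (fun ω => x k * Z ω k) 2 P := fun k => (hZ k).const_mul _
  have hs : MemLp (fun ω => x ⬝ᵥ Z ω) 2 P := memLp_finsetSum _ fun k _ => hx k
  rw [← covariance_self hs.aestronglyMeasurable.aemeasurable]
  simp only [dotProduct, mulVec]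
  rw [covariance_fun_sum_fun_sum hx hx]
  refine Finset.sum_congr rfl fun i _ => ?_
  rw [Finset.mul_sum]
  refine Finset.sum_congr rfl fun j _ => ?_
  rw [covariance_const_mul_left, covariance_const_mul_right, covMatrix, of_apply]
  ring

lemma memLp_two_mul {U V : Ω → ℝ} (hU : MemLp U 4 P) (hV : MemLp V 4 P) :
    MemLp (fun ω => U ω * V ω) 2 P := by
  have : ENNReal.HolderTriple 4 4 2 := ⟨by
    rw [show (4 : ENNReal) = 2 * 2 by norm_num, ENNReal.mul_inv (by simp) (by simp), ← mul_add,
      ENNReal.inv_two_add_inv_two, mul_one]⟩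
  exact MemLp.mul' (p := 4) (q := 4) hV hU

lemma integral_sq_mul_le {U V : Ω → ℝ} (hU : MemLp U 4 P) (hV : MemLp V 4 P) :
    ∫ ω, (U ω * V ω) ^ 2 ∂P ≤ (∫ ω, U ω ^ 4 ∂P + ∫ ω, V ω ^ 4 ∂P) / 2 := by
  have i4 : ∀ {W : Ω → ℝ}, MemLp W 4 P → Integrable (fun ω => W ω ^ 4) P := fun {W} hW => by
    have := (memLp_two_mul hW hW).integrable_sq
    refine this.congr (ae_of_all _ fun ω => by ring)
  rw [← integral_add (i4 hU) (i4 hV), ← integral_div]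
  refine integral_mono (memLp_two_mul hU hV).integrable_sq (((i4 hU).add (i4 hV)).div_const _)
    fun ω => ?_
  simp only
  nlinarith [sq_nonneg (U ω ^ 2 - V ω ^ 2)]

lemma integrable_pow_four {U : Ω → ℝ} (hU : MemLp U 4 P) : Integrable (fun ω => U ω ^ 4) P :=
  (memLp_two_mul hU hU).integrable_sq.congr (ae_of_all _ fun ω => by ring)

lemma memLp_two_of_four {U : Ω → ℝ} (hU : MemLp U 4 P) : MemLp U 2 P :=
  hU.mono_exponent (by norm_num)

lemma integral_sq_le_one_add {U : Ω → ℝ} (hU : MemLp U 4 P) :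
    ∫ ω, U ω ^ 2 ∂P ≤ 1 + ∫ ω, U ω ^ 4 ∂P := by
  have : ∫ ω, (1 + U ω ^ 4) ∂P = 1 + ∫ ω, U ω ^ 4 ∂P := by
    rw [integral_add (integrable_const _) (integrable_pow_four hU)]; simp
  rw [← this]
  refine integral_mono (memLp_two_of_four hU).integrable_sq
    ((integrable_const _).add (integrable_pow_four hU)) fun ω => ?_
  simp only
  nlinarith [sq_nonneg (U ω ^ 2 - 1), sq_nonneg (U ω)]

/-! #### Deviation probabilities of empirical means -/

variable {𝒵 : Type*} [MeasurableSpace 𝒵] {n : ℕ} {Zs : Fin n → Ω → 𝒵} {Z₀ : Ω → 𝒵}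

/-- Chebyshev in Frobenius norm: E‖D‖² is a sum of variances of averages, at most a/n. The functions
g select which empirical moment is studied. -/
lemma measure_lt_norm_le (hn : 0 < n) (hind : iIndepFun Zs P)
    (hid : ∀ i, IdentDistrib (Zs i) Z₀ P P) {ι κ : Type*} [Fintype ι] [Fintype κ]
    {g : ι → κ → 𝒵 → ℝ} (hg : ∀ k l, Measurable (g k l))
    (hL : ∀ k l, MemLp (fun ω => g k l (Z₀ ω)) 2 P) {a : ℝ}
    (ha : ∑ k, ∑ l, ∫ ω, g k l (Z₀ ω) ^ 2 ∂P ≤ a) {D : Ω → Matrix ι κ ℝ}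
    (hD : ∀ ω k l, D ω k l = (n : ℝ)⁻¹ * ∑ i, g k l (Zs i ω) - ∫ ω', g k l (Z₀ ω') ∂P)
    {t : ℝ} (ht : 0 < t) : P {ω | t < ‖D ω‖} ≤ ENNReal.ofReal (a / (n * t ^ 2)) := by
  have h := integral_sum_sq_average_sub_le hn hind hid (g := fun kl : ι × κ => g kl.1 kl.2)
    (fun kl => hg _ _) (fun kl => hL _ _)
  have h2 := measure_lt_le_of_integral_le (fun ω => Finset.sum_nonneg fun k _ => sq_nonneg _)
    h.1 h.2 (t := t ^ 2) (by positivity)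
  have e : {ω | t < ‖D ω‖} ⊆ {ω | t ^ 2 < ∑ kl : ι × κ, ((n : ℝ)⁻¹ * ∑ i, g kl.1 kl.2 (Zs i ω)
      - ∫ ω', g kl.1 kl.2 (Z₀ ω') ∂P) ^ 2} := fun ω hω => by
    have h3 : t ^ 2 < ‖D ω‖ ^ 2 := pow_lt_pow_left₀ hω ht.le (by norm_num)
    rw [frobenius_norm_sq] at h3
    simpa only [Set.mem_ofPred_eq, Fintype.sum_prod_type, hD] using h3
  refine (measure_mono e).trans (h2.trans (ENNReal.ofReal_le_ofReal ?_))
  rw [Fintype.sum_prod_type, div_le_div_iff₀ (by positivity) (by positivity)]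
  have hn0 : (n : ℝ) ≠ 0 := by positivity
  calc _ ≤ (n : ℝ)⁻¹ * a * (n * t ^ 2) := by gcongr
    _ = _ := by field_simp

lemma measure_lt_sqrt_dotProduct_le (hn : 0 < n) (hind : iIndepFun Zs P)
    (hid : ∀ i, IdentDistrib (Zs i) Z₀ P P) {ι : Type*} [Fintype ι]
    {g : ι → 𝒵 → ℝ} (hg : ∀ k, Measurable (g k))
    (hL : ∀ k, MemLp (fun ω => g k (Z₀ ω)) 2 P) {a : ℝ}
    (ha : ∑ k, ∫ ω, g k (Z₀ ω) ^ 2 ∂P ≤ a) {d : Ω → ι → ℝ}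
    (hd : ∀ ω k, d ω k = (n : ℝ)⁻¹ * ∑ i, g k (Zs i ω) - ∫ ω', g k (Z₀ ω') ∂P)
    {t : ℝ} (ht : 0 < t) : P {ω | t < √(d ω ⬝ᵥ d ω)} ≤ ENNReal.ofReal (a / (n * t ^ 2)) := by
  have h := measure_lt_norm_le hn hind hid (ι := ι) (κ := Unit) (g := fun k _ => g k)
    (fun k _ => hg k) (fun k _ => hL k) (a := a) (by simpa using ha)
    (D := fun ω => replicateCol Unit (d ω)) (fun ω k _ => hd ω k) ht
  have e : ∀ ω, √(d ω ⬝ᵥ d ω) = ‖replicateCol Unit (d ω)‖ := fun ω => by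
    rw [Real.sqrt_eq_iff_eq_sq (dotProduct_self_nonneg_real _) (norm_nonneg _), frobenius_norm_sq]
    simp [dotProduct, sq]
  simpa only [e] using h

end RandomVectors

/-! ### Moments in the factor model -/

namespace FactorSample

open scoped Matrix.Norms.Frobenius

variable {Ω : Type*} [MeasurableSpace Ω] {P : Measure Ω} [IsProbabilityMeasure P] {K p n : ℕ}

/-- The sampled idiosyncratic noise. -/
def es (M : FactorSample Ω K p n) (i : Fin n) (ω : Ω) : Fin p → ℝ :=
  M.ys i ω - M.B *ᵥ M.fs i ω

/-- The noise matrix `(ε₁, …, ε_n)`. -/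
def E (M : FactorSample Ω K p n) (ω : Ω) : Matrix (Fin p) (Fin n) ℝ :=
  Matrix.of fun k i => M.es i ω k

lemma Y_eq (M : FactorSample Ω K p n) (ω : Ω) : M.Y ω = M.B * M.X ω + M.E ω := by
  ext k i
  simp [Y, X, E, es, Matrix.mul_apply, mulVec, dotProduct]

/-- Quantitative form of the assumptions on a single factor model. -/
structure Bounded (M : FactorSample Ω K p n) (P : Measure Ω) (C σ : ℝ) : Prop where
  condA : M.ConditionA P
  memLp_f : ∀ a, MemLp (fun ω => M.f ω a) 4 P
  memLp_noise : ∀ k, MemLp (fun ω => M.noise ω k) 4 P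
  f_le : ∀ a, ∫ ω, M.f ω a ^ 4 ∂P ≤ C
  noise_le : ∀ k, ∫ ω, M.noise ω k ^ 4 ∂P ≤ C
  b_le : M.b P ≤ C * p
  one_le : 1 ≤ C
  σ_pos : 0 < σ
  cov_lower : ∀ x, σ * (x ⬝ᵥ x) ≤ x ⬝ᵥ (covMatrix P M.f *ᵥ x)
  noise_lower : ∀ x, σ * (x ⬝ᵥ x) ≤ x ⬝ᵥ (M.noiseCov *ᵥ x)

namespace Bounded

variable {M : FactorSample Ω K p n} {C σ : ℝ}

/-- The sampled noise is a measurable function of the sampled factor–return pair, so independence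
and law transfer to factor–noise pairs. -/
lemma iIndepFun_pairs (h : M.Bounded P C σ) :
    iIndepFun (fun i ω => (M.fs i ω, M.es i ω)) P :=
  h.condA.indep.comp (fun _ (z : (Fin K → ℝ) × (Fin p → ℝ)) => (z.1, z.2 - M.B *ᵥ z.1))
    fun _ => by
      have : Continuous fun z : (Fin K → ℝ) × (Fin p → ℝ) => (z.1, z.2 - M.B *ᵥ z.1) := by
        fun_prop
      exact this.measurable

lemma identDistrib_pairs (h : M.Bounded P C σ) (i : Fin n) :
    IdentDistrib (fun ω => (M.fs i ω, M.es i ω)) (fun ω => (M.f ω, M.noise ω)) P P := by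
  have hc : Continuous fun z : (Fin K → ℝ) × (Fin p → ℝ) => (z.1, z.2 - M.B *ᵥ z.1) := by
    fun_prop
  have h1 := (h.condA.identDistrib i).comp hc.measurable
  have e : (fun ω => (M.f ω, M.noise ω))
      = (fun z : (Fin K → ℝ) × (Fin p → ℝ) => (z.1, z.2 - M.B *ᵥ z.1))
        ∘ fun ω => (M.f ω, M.y ω) := by
    ext1 ω; simp [y]
  rw [e]
  exact h1

lemma memLp_two_f (h : M.Bounded P C σ) (a : Fin K) : MemLp (fun ω => M.f ω a) 2 P :=
  memLp_two_of_four (h.memLp_f a)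

lemma memLp_two_noise (h : M.Bounded P C σ) (k : Fin p) : MemLp (fun ω => M.noise ω k) 2 P :=
  memLp_two_of_four (h.memLp_noise k)

lemma factorSigma_le (h : M.Bounded P C σ) : M.factorSigma ≤ ‹MeasurableSpace Ω› :=
  h.condA.measurable_f.comap_le

/-- Condition on the factors, pull out g(f), and use E(ε | f) = 0. -/
lemma integral_noise_mul (h : M.Bounded P C σ) (k : Fin p) {g : (Fin K → ℝ) → ℝ}
    (hg : Measurable g) (hI : Integrable (fun ω => M.noise ω k * g (M.f ω)) P) :
    ∫ ω, M.noise ω k * g (M.f ω) ∂P = 0 := by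
  have hgm : StronglyMeasurable[M.factorSigma] fun ω => g (M.f ω) :=
    (hg.comp (comap_measurable M.f)).stronglyMeasurable
  have h1 := condExp_mul_of_stronglyMeasurable_right (f := fun ω => M.noise ω k) hgm hI
    ((h.memLp_two_noise k).integrable one_le_two)
  rw [← integral_condExp h.factorSigma_le]
  refine integral_eq_zero_of_ae (h1.trans ?_)
  filter_upwards [h.condA.condMean k] with ω hω
  simp [hω]

lemma integral_noise_mul_noise_mul (h : M.Bounded P C σ) (k l : Fin p) {g : (Fin K → ℝ) → ℝ}
    (hg : Measurable g) {c : ℝ} (hc : ∀ x, |g x| ≤ c) :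
    Integrable (fun ω => M.noise ω k * M.noise ω l * g (M.f ω)) P ∧
    ∫ ω, M.noise ω k * M.noise ω l * g (M.f ω) ∂P = M.noiseCov k l * ∫ ω, g (M.f ω) ∂P := by
  have hgm : StronglyMeasurable[M.factorSigma] fun ω => g (M.f ω) :=
    (hg.comp (comap_measurable M.f)).stronglyMeasurable
  have hI0 : Integrable (fun ω => M.noise ω k * M.noise ω l) P :=
    (h.memLp_two_noise k).integrable_mul (h.memLp_two_noise l)
  have hI : Integrable (fun ω => M.noise ω k * M.noise ω l * g (M.f ω)) P :=
    hI0.mul_bdd (hg.comp h.condA.measurable_f).aestronglyMeasurable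
      (ae_of_all _ fun ω => hc _)
  refine ⟨hI, ?_⟩
  have h1 := condExp_mul_of_stronglyMeasurable_right (f := fun ω => M.noise ω k * M.noise ω l)
    hgm hI hI0
  -- The conditional means vanish, so the conditional covariance is the conditional mean of the
  -- product.
  have h2 : P[fun ω => M.noise ω k * M.noise ω l | M.factorSigma]
      =ᵐ[P] fun _ => M.noiseCov k l := by
    refine (condExp_congr_ae ?_).trans (h.condA.condCov k l)
    filter_upwards [h.condA.condMean k, h.condA.condMean l] with ω hk hl
    simp [hk, hl]
  rw [← integral_condExp h.factorSigma_le, ← integral_const_mul]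
  refine integral_congr_ae (h1.trans ?_)
  filter_upwards [h2] with ω hω
  simp [hω]

lemma integral_noise_mul_noise (h : M.Bounded P C σ) (k l : Fin p) :
    ∫ ω, M.noise ω k * M.noise ω l ∂P = M.noiseCov k l := by
  have := (h.integral_noise_mul_noise_mul k l (g := fun _ => 1) measurable_const (c := 1)
    (by simp)).2
  simpa using this

lemma integral_noise (h : M.Bounded P C σ) (k : Fin p) : ∫ ω, M.noise ω k ∂P = 0 := by
  have := h.integral_noise_mul k (g := fun _ => 1) measurable_const
    (by simpa using (h.memLp_two_noise k).integrable one_le_two)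
  simpa using this

lemma integral_noise_mul_f (h : M.Bounded P C σ) (k : Fin p) (a : Fin K) :
    ∫ ω, M.noise ω k * M.f ω a ∂P = 0 :=
  h.integral_noise_mul k (g := fun x => x a) (measurable_pi_apply a)
    ((h.memLp_two_noise k).integrable_mul (h.memLp_two_f a))

lemma covMatrix_noise (h : M.Bounded P C σ) : covMatrix P M.noise = M.noiseCov := by
  ext k l
  rw [covMatrix, of_apply, covariance_eq_sub (h.memLp_two_noise k) (h.memLp_two_noise l),
    h.integral_noise, zero_mul, sub_zero]
  exact h.integral_noise_mul_noise k l

/-- A weighted sum of the noise with weights that depend on the factors. -/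
lemma integral_sq_weighted_noise (h : M.Bounded P C σ) (x : Fin p → ℝ)
    {v : Fin n → (Fin n → Fin K → ℝ) → ℝ} (hv : ∀ i, Measurable (v i)) {c : ℝ}
    (hvc : ∀ i y, |v i y| ≤ c) :
    Integrable (fun ω => (∑ i, v i (fun j => M.fs j ω) * (x ⬝ᵥ M.es i ω)) ^ 2) P ∧
    ∫ ω, (∑ i, v i (fun j => M.fs j ω) * (x ⬝ᵥ M.es i ω)) ^ 2 ∂P
      = (x ⬝ᵥ (M.noiseCov *ᵥ x)) * ∫ ω, ∑ i, v i (fun j => M.fs j ω) ^ 2 ∂P := by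
  have hcont : Continuous fun z : (Fin K → ℝ) × (Fin p → ℝ) => x ⬝ᵥ z.2 := by fun_prop
  have hL : MemLp (fun ω => x ⬝ᵥ M.noise ω) 2 P :=
    memLp_finsetSum _ fun k _ => (h.memLp_two_noise k).const_mul (x k)
  refine integral_sq_weighted_sum h.iIndepFun_pairs h.identDistrib_pairs
    (u := fun z => x ⬝ᵥ z.2) hcont.measurable hL ?_ ?_ hv hvc
  · rintro g hg ⟨c', hc'⟩
    have hI : ∀ k, Integrable (fun ω => M.noise ω k * g (M.f ω)) P := fun k =>
      ((h.memLp_two_noise k).integrable one_le_two).mul_bdd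
        (hg.comp h.condA.measurable_f).aestronglyMeasurable (ae_of_all _ fun ω => hc' _)
    have e : ∀ ω, (x ⬝ᵥ M.noise ω) * g (M.f ω) = ∑ k, x k * (M.noise ω k * g (M.f ω)) := fun ω => by
      rw [dotProduct, Finset.sum_mul]
      exact Finset.sum_congr rfl fun k _ => by ring
    simp only [e]
    rw [integral_finsetSum _ fun k _ => (hI k).const_mul _]
    refine Finset.sum_eq_zero fun k _ => ?_
    rw [integral_const_mul, h.integral_noise_mul k hg (hI k), mul_zero]
  · rintro g hg ⟨c', hc'⟩
    have hI := fun k l => h.integral_noise_mul_noise_mul k l hg hc'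
    have hIg : Integrable (fun ω => g (M.f ω)) P :=
      Integrable.of_bound (hg.comp h.condA.measurable_f).aestronglyMeasurable c'
        (ae_of_all _ fun ω => hc' _)
    have e : ∀ ω, ((x ⬝ᵥ M.noise ω) ^ 2 - x ⬝ᵥ (M.noiseCov *ᵥ x)) * g (M.f ω)
        = ∑ k, ∑ l, x k * x l * (M.noise ω k * M.noise ω l * g (M.f ω)
          - M.noiseCov k l * g (M.f ω)) := fun ω => by
      rw [sq, dotProduct, Finset.sum_mul_sum]
      simp only [dotProduct, mulVec, Finset.mul_sum, Finset.sum_mul, ← Finset.sum_sub_distrib]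
      exact Finset.sum_congr rfl fun k _ => Finset.sum_congr rfl fun l _ => by ring
    simp only [e]
    have hI' : ∀ k l, Integrable (fun ω => x k * x l * (M.noise ω k * M.noise ω l * g (M.f ω)
          - M.noiseCov k l * g (M.f ω))) P := fun k l =>
      ((hI k l).1.sub (hIg.const_mul _)).const_mul _
    rw [integral_finsetSum _ fun k _ => integrable_finsetSum _ fun l _ => hI' k l]
    refine Finset.sum_eq_zero fun k _ => ?_
    rw [integral_finsetSum _ fun l _ => hI' k l]
    refine Finset.sum_eq_zero fun l _ => ?_
    rw [integral_const_mul, integral_sub (hI k l).1 (hIg.const_mul _), (hI k l).2,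
      integral_const_mul, sub_self, mul_zero]

/-! #### Returns -/

lemma memLp_y (h : M.Bounded P C σ) (k : Fin p) : MemLp (fun ω => M.y ω k) 4 P := by
  have : MemLp (fun ω => ∑ a, M.B k a * M.f ω a) 4 P :=
    memLp_finsetSum _ fun a _ => (h.memLp_f a).const_mul _
  exact this.add (h.memLp_noise k)

lemma memLp_two_y (h : M.Bounded P C σ) (k : Fin p) : MemLp (fun ω => M.y ω k) 2 P :=
  memLp_two_of_four (h.memLp_y k)

/-- Factors and noise are uncorrelated because the noise is conditionally centred. -/
lemma Sig_eq (h : M.Bounded P C σ) :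
    M.Sig P = M.B * covMatrix P M.f * M.Bᵀ + M.noiseCov := by
  have hBf : ∀ k, MemLp (fun ω => ∑ a, M.B k a * M.f ω a) 2 P := fun k =>
    memLp_finsetSum _ fun a _ => (h.memLp_two_f a).const_mul _
  have hcross : ∀ k l, covariance (fun ω => ∑ a, M.B k a * M.f ω a) (fun ω => M.noise ω l) P = 0 :=
    fun k l => by
      rw [covariance_fun_sum_left (fun a => (h.memLp_two_f a).const_mul _) (h.memLp_two_noise l)]
      refine Finset.sum_eq_zero fun a _ => ?_
      rw [covariance_const_mul_left, covariance_comm,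
        covariance_eq_sub (h.memLp_two_noise l) (h.memLp_two_f a), h.integral_noise, zero_mul,
        sub_zero]
      exact mul_eq_zero_of_right _ (h.integral_noise_mul_f l a)
  ext k l
  have e : ∀ k, (fun ω => M.y ω k) = (fun ω => ∑ a, M.B k a * M.f ω a) + fun ω => M.noise ω k :=
    fun k => rfl
  have hsum := hBf
  rw [Sig, covMatrix, of_apply, e, e, covariance_add_left (hBf k) (h.memLp_two_noise k)
    ((hBf l).add (h.memLp_two_noise l)), covariance_add_right (hBf k) (hBf l) (h.memLp_two_noise l),
    covariance_add_right (h.memLp_two_noise k) (hBf l) (h.memLp_two_noise l), hcross,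
    covariance_comm (fun ω => M.noise ω k), hcross, add_zero, zero_add, Matrix.add_apply,
    ← h.covMatrix_noise, covMatrix, covMatrix, of_apply]
  congr 1
  rw [covariance_fun_sum_fun_sum (fun a => (h.memLp_two_f a).const_mul _)
    (fun a => (h.memLp_two_f a).const_mul _), Matrix.mul_apply, Finset.sum_comm]
  refine Finset.sum_congr rfl fun a _ => ?_
  rw [Matrix.mul_apply, Finset.sum_mul]
  refine Finset.sum_congr rfl fun a' _ => ?_
  rw [covariance_const_mul_left, covariance_const_mul_right, of_apply, transpose_apply]
  ring

lemma mu_eq (h : M.Bounded P C σ) : M.mu P = M.B *ᵥ meanVector P M.f := by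
  ext k
  have e : ∀ ω, M.y ω k = ∑ a, M.B k a * M.f ω a + M.noise ω k := fun ω => rfl
  have hi : ∀ a, Integrable (fun ω => M.B k a * M.f ω a) P := fun a =>
    ((h.memLp_two_f a).integrable one_le_two).const_mul _
  rw [mu, meanVector]
  simp only [e]
  rw [integral_add (integrable_finsetSum _ fun a _ => hi a)
    ((h.memLp_two_noise k).integrable one_le_two), h.integral_noise, add_zero,
    integral_finsetSum _ fun a _ => hi a]
  simp only [integral_const_mul]
  rfl

lemma quadForm_Sig (h : M.Bounded P C σ) (x : Fin p → ℝ) :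
    x ⬝ᵥ (M.Sig P *ᵥ x) = (M.Bᵀ *ᵥ x) ⬝ᵥ (covMatrix P M.f *ᵥ (M.Bᵀ *ᵥ x))
      + x ⬝ᵥ (M.noiseCov *ᵥ x) := by
  rw [h.Sig_eq, add_mulVec, dotProduct_add, quadForm_conj]

lemma Sig_isSymm (_ : M.Bounded P C σ) : (M.Sig P).IsSymm := covMatrix_isSymm

lemma noise_quad_le_Sig (h : M.Bounded P C σ) (x : Fin p → ℝ) :
    x ⬝ᵥ (M.noiseCov *ᵥ x) ≤ x ⬝ᵥ (M.Sig P *ᵥ x) := by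
  have h1 := h.cov_lower (M.Bᵀ *ᵥ x)
  have h2 := mul_nonneg h.σ_pos.le (dotProduct_self_nonneg_real (M.Bᵀ *ᵥ x))
  rw [h.quadForm_Sig]; linarith

lemma noise_quad_nonneg (h : M.Bounded P C σ) (x : Fin p → ℝ) :
    0 ≤ x ⬝ᵥ (M.noiseCov *ᵥ x) :=
  (mul_nonneg h.σ_pos.le (dotProduct_self_nonneg_real x)).trans (h.noise_lower x)

lemma Sig_lower (h : M.Bounded P C σ) (x : Fin p → ℝ) :
    σ * (x ⬝ᵥ x) ≤ x ⬝ᵥ (M.Sig P *ᵥ x) :=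
  (h.noise_lower x).trans (h.noise_quad_le_Sig x)

lemma norm_Sig_le (h : M.Bounded P C σ) : ‖M.Sig P‖ ≤ C * p :=
  (norm_covMatrix_le h.memLp_two_y).trans h.b_le

lemma mu_dotProduct_le (h : M.Bounded P C σ) : M.mu P ⬝ᵥ M.mu P ≤ C * p :=
  (meanVector_dotProduct_le h.memLp_two_y).trans h.b_le

lemma sum_Sig_diag_le (h : M.Bounded P C σ) : ∑ k, M.Sig P k k ≤ C * p := by
  refine le_trans ?_ h.b_le
  rw [b, integral_sum_sq h.memLp_two_y]
  refine Finset.sum_le_sum fun k _ => ?_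
  rw [Sig, covMatrix, of_apply, covariance_self (h.memLp_y k).aestronglyMeasurable.aemeasurable]
  exact variance_le_integral_sq (h.memLp_two_y k)

/-- The loadings are controlled through the returns: the k-th diagonal entry of Σ is at least σ
times the squared norm of row k of B, and the trace of Σ is at most E‖y‖² ≤ Cp. -/
lemma norm_B_sq_le (h : M.Bounded P C σ) : ‖M.B‖ ^ 2 ≤ C * p / σ := by
  rw [le_div_iff₀ h.σ_pos, frobenius_norm_sq, Finset.sum_mul]
  refine le_trans (Finset.sum_le_sum fun k _ => ?_) h.sum_Sig_diag_le
  have h1 := h.quadForm_Sig (Pi.single k 1)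
  have h2 := h.noise_quad_nonneg (Pi.single k 1)
  have h3 := h.cov_lower (M.Bᵀ *ᵥ Pi.single k 1)
  have e1 : Pi.single k 1 ⬝ᵥ (M.Sig P *ᵥ Pi.single k 1) = M.Sig P k k := by simp
  have e2 : (M.Bᵀ *ᵥ Pi.single k 1) ⬝ᵥ (M.Bᵀ *ᵥ Pi.single k 1) = ∑ a, M.B k a ^ 2 := by
    simp [dotProduct, sq]
  rw [e1] at h1
  rw [e2] at h3
  linarith

lemma integral_f_sq_le (h : M.Bounded P C σ) :
    ∫ ω, ∑ a, M.f ω a ^ 2 ∂P ≤ 2 * C * K := by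
  rw [integral_sum_sq h.memLp_two_f]
  calc _ ≤ ∑ _a : Fin K, 2 * C := Finset.sum_le_sum fun a _ =>
        (integral_sq_le_one_add (h.memLp_f a)).trans (by linarith [h.f_le a, h.one_le])
    _ = _ := by simp; ring

lemma norm_covMatrix_f_le (h : M.Bounded P C σ) : ‖covMatrix P M.f‖ ≤ 2 * C * K :=
  (norm_covMatrix_le h.memLp_two_f).trans h.integral_f_sq_le

lemma sum_sq_le_card_mul {q : ℕ} (x : Fin q → ℝ) : (∑ k, x k ^ 2) ^ 2 ≤ q * ∑ k, x k ^ 4 := by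
  have := sq_sum_le_card_mul_sum_sq (s := Finset.univ) (f := fun k => x k ^ 2)
  simpa [← pow_mul] using this

/-- Apply (u + v)² ≤ 2u² + 2v² to y = Bf + ε, then again after squaring, which gives the 8;
Cauchy–Schwarz then passes from squared norms to fourth powers. -/
lemma sum_y_sq_le (M : FactorSample Ω K p n) (ω : Ω) :
    (∑ k, M.y ω k ^ 2) ^ 2 ≤ 8 * ‖M.B‖ ^ 4 * (K * ∑ a, M.f ω a ^ 4)
      + 8 * (p * ∑ k, M.noise ω k ^ 4) := by
  have h1 : ∑ k, M.y ω k ^ 2 ≤ 2 * (‖M.B‖ ^ 2 * ∑ a, M.f ω a ^ 2) + 2 * ∑ k, M.noise ω k ^ 2 := by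
    have := mulVec_dotProduct_self_le M.B (M.f ω)
    simp only [dotProduct, ← sq] at this
    calc _ ≤ ∑ k, (2 * (M.B *ᵥ M.f ω) k ^ 2 + 2 * M.noise ω k ^ 2) := by
          refine Finset.sum_le_sum fun k _ => ?_
          rw [y, Pi.add_apply]
          nlinarith [sq_nonneg ((M.B *ᵥ M.f ω) k - M.noise ω k)]
      _ = 2 * ∑ k, (M.B *ᵥ M.f ω) k ^ 2 + 2 * ∑ k, M.noise ω k ^ 2 := by
          rw [Finset.sum_add_distrib, Finset.mul_sum, Finset.mul_sum]
      _ ≤ _ := by gcongr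
  have h0 : 0 ≤ ∑ k, M.y ω k ^ 2 := Finset.sum_nonneg fun k _ => sq_nonneg _
  have hf := sum_sq_le_card_mul (M.f ω)
  have hn := sum_sq_le_card_mul (M.noise ω)
  set F := ∑ a, M.f ω a ^ 2
  set N := ∑ k, M.noise ω k ^ 2
  calc _ ≤ (2 * (‖M.B‖ ^ 2 * F) + 2 * N) ^ 2 := by gcongr
    _ ≤ 8 * (‖M.B‖ ^ 2 * F) ^ 2 + 8 * N ^ 2 := by nlinarith [sq_nonneg (‖M.B‖ ^ 2 * F - N)]
    _ = 8 * ‖M.B‖ ^ 4 * F ^ 2 + 8 * N ^ 2 := by ring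
    _ ≤ _ := by gcongr

/-- The double sum is E‖y‖⁴. The factor part is of order ‖B‖⁴K² = O(p²K²), the noise part O(p²),
absorbed because K ≥ 1. -/
lemma sum_integral_y_mul_y_sq_le (h : M.Bounded P C σ) (hKp : 1 ≤ K) :
    ∑ k, ∑ l, ∫ ω, (M.y ω k * M.y ω l) ^ 2 ∂P ≤ 8 * C * (C ^ 2 / σ ^ 2 + 1) * (p ^ 2 * K ^ 2) := by
  have hI : ∀ k l, Integrable (fun ω => (M.y ω k * M.y ω l) ^ 2) P := fun k l =>
    (memLp_two_mul (h.memLp_y k) (h.memLp_y l)).integrable_sq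
  have e : ∑ k, ∑ l, ∫ ω, (M.y ω k * M.y ω l) ^ 2 ∂P = ∫ ω, (∑ k, M.y ω k ^ 2) ^ 2 ∂P := by
    have : ∀ ω, (∑ k, M.y ω k ^ 2) ^ 2 = ∑ k, ∑ l, (M.y ω k * M.y ω l) ^ 2 := fun ω => by
      rw [sq, Finset.sum_mul_sum]
      simp only [mul_pow]
    simp only [this]
    rw [integral_finsetSum _ fun k _ => integrable_finsetSum _ fun l _ => hI k l]
    exact Finset.sum_congr rfl fun k _ => (integral_finsetSum _ fun l _ => hI k l).symm
  have hIy : Integrable (fun ω => (∑ k, M.y ω k ^ 2) ^ 2) P := by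
    have : ∀ ω, (∑ k, M.y ω k ^ 2) ^ 2 = ∑ k, ∑ l, (M.y ω k * M.y ω l) ^ 2 := fun ω => by
      rw [sq, Finset.sum_mul_sum]
      simp only [mul_pow]
    simp only [this]
    exact integrable_finsetSum _ fun k _ => integrable_finsetSum _ fun l _ => hI k l
  have If : Integrable (fun ω => ∑ a, M.f ω a ^ 4) P :=
    integrable_finsetSum _ fun a _ => integrable_pow_four (h.memLp_f a)
  have In : Integrable (fun ω => ∑ a, M.noise ω a ^ 4) P :=
    integrable_finsetSum _ fun a _ => integrable_pow_four (h.memLp_noise a)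
  have bf : ∫ ω, ∑ a, M.f ω a ^ 4 ∂P ≤ K * C := by
    rw [integral_finsetSum _ fun a _ => integrable_pow_four (h.memLp_f a)]
    exact (Finset.sum_le_sum fun a _ => h.f_le a).trans (by simp)
  have bn : ∫ ω, ∑ a, M.noise ω a ^ 4 ∂P ≤ p * C := by
    rw [integral_finsetSum _ fun a _ => integrable_pow_four (h.memLp_noise a)]
    exact (Finset.sum_le_sum fun a _ => h.noise_le a).trans (by simp)
  have hC := h.one_le
  have hB : ‖M.B‖ ^ 4 ≤ (C * p / σ) ^ 2 := by
    have := h.norm_B_sq_le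
    calc ‖M.B‖ ^ 4 = (‖M.B‖ ^ 2) ^ 2 := by ring
      _ ≤ _ := by gcongr
  have hK : (1 : ℝ) ≤ K ^ 2 := one_le_pow₀ (by exact_mod_cast hKp)
  rw [e]
  calc _ ≤ ∫ ω, (8 * ‖M.B‖ ^ 4 * (K * ∑ a, M.f ω a ^ 4) + 8 * (p * ∑ k, M.noise ω k ^ 4)) ∂P :=
        integral_mono hIy (((If.const_mul _).const_mul _).add ((In.const_mul _).const_mul _))
          (sum_y_sq_le M)
    _ = 8 * ‖M.B‖ ^ 4 * (K * ∫ ω, ∑ a, M.f ω a ^ 4 ∂P)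
        + 8 * (p * ∫ ω, ∑ k, M.noise ω k ^ 4 ∂P) := by
        rw [integral_add ((If.const_mul _).const_mul _) ((In.const_mul _).const_mul _),
          integral_const_mul, integral_const_mul, integral_const_mul, integral_const_mul]
    _ ≤ 8 * (C * p / σ) ^ 2 * (K * (K * C)) + 8 * (p * (p * C)) := by gcongr
    _ ≤ 8 * (C * p / σ) ^ 2 * (K * (K * C)) + 8 * (p * (p * C)) * K ^ 2 := by
        have : 0 ≤ 8 * (p * (p * C)) := by positivity
        nlinarith
    _ = _ := by field_simp

end Bounded

end FactorSample

/-! ### Deviation probabilities in the factor model -/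

namespace FactorSample.Bounded

open scoped Matrix.Norms.Frobenius

variable {Ω : Type*} [MeasurableSpace Ω] {P : Measure Ω} [IsProbabilityMeasure P] {K p n : ℕ}
  {M : FactorSample Ω K p n} {C σ : ℝ}

lemma measure_norm_XX_le (h : M.Bounded P C σ) (hn : 0 < n) {t : ℝ} (ht : 0 < t) :
    P {ω | t < ‖(n : ℝ)⁻¹ • (M.X ω * (M.X ω)ᵀ) - secondMoment P M.f‖}
      ≤ ENNReal.ofReal (C * K ^ 2 / (n * t ^ 2)) := by
  refine measure_lt_norm_le hn h.iIndepFun_pairs h.identDistrib_pairs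
    (g := fun a b z => z.1 a * z.1 b) (fun a b => by fun_prop)
    (fun a b => memLp_two_mul (h.memLp_f a) (h.memLp_f b)) ?_ (fun ω a b => ?_) ht
  · calc _ ≤ ∑ _a : Fin K, ∑ _b : Fin K, C := by
          refine Finset.sum_le_sum fun a _ => Finset.sum_le_sum fun b _ => ?_
          have := integral_sq_mul_le (h.memLp_f a) (h.memLp_f b)
          linarith [h.f_le a, h.f_le b]
      _ = _ := by simp; ring
  · simp [Matrix.mul_apply, X, secondMoment]

lemma measure_mean_f_le (h : M.Bounded P C σ) (hn : 0 < n) {t : ℝ} (ht : 0 < t) :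
    P {ω | t < √((sampleMean (M.X ω) - meanVector P M.f) ⬝ᵥ
      (sampleMean (M.X ω) - meanVector P M.f))}
      ≤ ENNReal.ofReal (2 * C * K / (n * t ^ 2)) := by
  refine measure_lt_sqrt_dotProduct_le hn h.iIndepFun_pairs h.identDistrib_pairs
    (g := fun a z => z.1 a) (fun a => by fun_prop) (fun a => h.memLp_two_f a) ?_
    (fun ω a => ?_) ht
  · have := h.integral_f_sq_le
    rwa [integral_sum_sq h.memLp_two_f] at this
  · simp [sampleMean, X, mulVec, dotProduct, meanVector]

lemma measure_norm_EX_le (h : M.Bounded P C σ) (hn : 0 < n) {t : ℝ} (ht : 0 < t) :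
    P {ω | t < ‖(n : ℝ)⁻¹ • (M.E ω * (M.X ω)ᵀ)‖}
      ≤ ENNReal.ofReal (C * p * K / (n * t ^ 2)) := by
  refine measure_lt_norm_le hn h.iIndepFun_pairs h.identDistrib_pairs
    (g := fun k a z => z.2 k * z.1 a) (fun k a => by fun_prop)
    (fun k a => memLp_two_mul (h.memLp_noise k) (h.memLp_f a)) ?_ (fun ω k a => ?_) ht
  · calc _ ≤ ∑ _k : Fin p, ∑ _a : Fin K, C := by
          refine Finset.sum_le_sum fun k _ => Finset.sum_le_sum fun a _ => ?_
          have := integral_sq_mul_le (h.memLp_noise k) (h.memLp_f a)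
          linarith [h.f_le a, h.noise_le k]
      _ = _ := by simp; ring
  · simp [Matrix.mul_apply, X, E, h.integral_noise_mul_f]

/-- The indicator in g keeps only the p diagonal entries, whence p rather than p²; off the diagonal
the noise covariance vanishes as well. -/
lemma measure_norm_EE_le (h : M.Bounded P C σ) (hn : 0 < n) {t : ℝ} (ht : 0 < t) :
    P {ω | t < ‖diagonal (diag ((n : ℝ)⁻¹ • (M.E ω * (M.E ω)ᵀ))) - M.noiseCov‖}
      ≤ ENNReal.ofReal (C * p / (n * t ^ 2)) := by
  have hL : ∀ k l, MemLp (fun ω => if k = l then M.noise ω k * M.noise ω l else 0) 2 P :=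
    fun k l => by
      by_cases hkl : k = l
      · simpa [hkl] using memLp_two_mul (h.memLp_noise l) (h.memLp_noise l)
      · simp [hkl]
  refine measure_lt_norm_le hn h.iIndepFun_pairs h.identDistrib_pairs
    (g := fun k l z => if k = l then z.2 k * z.2 l else 0)
    (fun k l => by by_cases hkl : k = l <;> simp only [hkl, if_true, if_false] <;> fun_prop)
    hL ?_ (fun ω k l => ?_) ht
  · calc _ ≤ ∑ k : Fin p, ∑ l : Fin p, if k = l then C else 0 := by
          refine Finset.sum_le_sum fun k _ => Finset.sum_le_sum fun l _ => ?_
          by_cases hkl : k = l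
          · subst hkl
            simp only [if_true]
            have := integral_sq_mul_le (h.memLp_noise k) (h.memLp_noise k)
            linarith [h.noise_le k]
          · simp [hkl]
      _ = _ := by simp; ring
  · by_cases hkl : k = l
    · subst hkl
      simp [Matrix.mul_apply, E, h.integral_noise_mul_noise]
    · simp [hkl, h.condA.isDiag hkl]

lemma measure_norm_YY_le (h : M.Bounded P C σ) (hn : 0 < n) (hK : 1 ≤ K) {t : ℝ} (ht : 0 < t) :
    P {ω | t < ‖(n : ℝ)⁻¹ • (M.Y ω * (M.Y ω)ᵀ) - secondMoment P M.y‖}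
      ≤ ENNReal.ofReal (8 * C * (C ^ 2 / σ ^ 2 + 1) * (p ^ 2 * K ^ 2) / (n * t ^ 2)) := by
  refine measure_lt_norm_le hn h.condA.indep h.condA.identDistrib
    (g := fun k l z => z.2 k * z.2 l) (fun k l => by fun_prop)
    (fun k l => memLp_two_mul (h.memLp_y k) (h.memLp_y l)) (h.sum_integral_y_mul_y_sq_le hK)
    (fun ω k l => ?_) ht
  simp [Matrix.mul_apply, Y, secondMoment]

lemma measure_mean_y_le (h : M.Bounded P C σ) (hn : 0 < n) {t : ℝ} (ht : 0 < t) :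
    P {ω | t < √((sampleMean (M.Y ω) - M.mu P) ⬝ᵥ (sampleMean (M.Y ω) - M.mu P))}
      ≤ ENNReal.ofReal (C * p / (n * t ^ 2)) := by
  refine measure_lt_sqrt_dotProduct_le hn h.condA.indep h.condA.identDistrib
    (g := fun k z => z.2 k) (fun k => by fun_prop) (fun k => h.memLp_two_y k) ?_
    (fun ω k => ?_) ht
  · rw [← integral_sum_sq h.memLp_two_y]
    exact h.b_le
  · simp [sampleMean, Y, mulVec, dotProduct, mu, meanVector]

lemma setOf_lt_abs_subset {t : ℝ} (ht : 0 < t) (U : Ω → ℝ) :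
    {ω | t < |U ω|} ⊆ {ω | t ^ 2 < U ω ^ 2} := fun ω hω => by
  have h : t < |U ω| := hω
  have := pow_lt_pow_left₀ h ht.le (two_ne_zero)
  rwa [sq_abs] at this

/-- For a fixed direction the variance is x'Σx/n. Applied to ξ and θ, where x'Σx is bounded, this
deviation bound does not see the dimension. -/
lemma measure_dotProduct_mean_y_le (h : M.Bounded P C σ) (hn : 0 < n) (x : Fin p → ℝ) {t : ℝ}
    (ht : 0 < t) : P {ω | t < |x ⬝ᵥ (sampleMean (M.Y ω) - M.mu P)|}
      ≤ ENNReal.ofReal (x ⬝ᵥ (M.Sig P *ᵥ x) / (n * t ^ 2)) := by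
  have hL : MemLp (fun ω => x ⬝ᵥ M.y ω) 2 P :=
    memLp_finsetSum _ fun k _ => (h.memLp_two_y k).const_mul (x k)
  have h1 := integral_sq_average_sub hn h.condA.indep h.condA.identDistrib
    (g := fun z => x ⬝ᵥ z.2) (by
      have : Continuous fun z : (Fin K → ℝ) × (Fin p → ℝ) => x ⬝ᵥ z.2 := by fun_prop
      exact this.measurable) hL
  have e0 : ∫ ω, x ⬝ᵥ M.y ω ∂P = x ⬝ᵥ M.mu P := by
    simp only [dotProduct, mu, meanVector]
    rw [integral_finsetSum _ fun k _ => ((h.memLp_two_y k).integrable one_le_two).const_mul _]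
    simp only [integral_const_mul]
  have e : ∀ ω, x ⬝ᵥ (sampleMean (M.Y ω) - M.mu P)
      = (n : ℝ)⁻¹ * ∑ i, x ⬝ᵥ M.ys i ω - ∫ ω, x ⬝ᵥ M.y ω ∂P := fun ω => by
    rw [e0, dotProduct_sub, sampleMean, dotProduct_smul, smul_eq_mul]
    congr 2
    simp only [dotProduct, mulVec, Y, of_apply, Pi.one_apply, mul_one, Finset.mul_sum]
    exact Finset.sum_comm
  refine (measure_mono (setOf_lt_abs_subset ht _)).trans ?_
  simp only [e]
  refine (measure_lt_le_of_integral_le (fun ω => sq_nonneg _) h1.1 h1.2.le (by positivity)).trans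
    (ENNReal.ofReal_le_ofReal (le_of_eq ?_))
  rw [← quadForm_covMatrix h.memLp_two_y]
  have hn0 : (n : ℝ) ≠ 0 := by positivity
  change (n : ℝ)⁻¹ * (x ⬝ᵥ (M.Sig P *ᵥ x)) / t ^ 2 = _
  field_simp

/-- The deviation of the factor estimator of the mean, when the loadings are estimable. -/
def _root_.FactorSample.meanDev (M : FactorSample Ω K p n) (P : Measure Ω) (ω : Ω) : Fin p → ℝ :=
  M.B *ᵥ (sampleMean (M.X ω) - meanVector P M.f) + (n : ℝ)⁻¹ • (M.E ω *ᵥ (rowProj (M.X ω) *ᵥ 1))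

lemma factorMeanEst_sub_mu (h : M.Bounded P C σ) {ω : Ω} (hu : IsUnit (M.X ω * (M.X ω)ᵀ).det) :
    factorMeanEst (M.X ω) (M.Y ω) - M.mu P = M.meanDev P ω := by
  rw [h.mu_eq, M.Y_eq, factorMeanEst_sub _ _ _ hu, meanDev]

/-! ### Measurability and size of the projected vector of ones -/

/-- By Cramer's rule the inverse is det⁻¹ times the adjugate; with 0⁻¹ = 0 this also covers singular
matrices. -/
lemma measurable_inv_matrix {q : ℕ} :
    Measurable fun A : Fin q → Fin q → ℝ => fun i j => (Matrix.of A)⁻¹ i j := by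
  have hdet : Continuous fun A : Fin q → Fin q → ℝ => (Matrix.of A).det := by
    exact Continuous.matrix_det (continuous_id (X := Matrix (Fin q) (Fin q) ℝ))
  have hadj : Continuous fun A : Fin q → Fin q → ℝ => (Matrix.of A).adjugate :=
    Continuous.matrix_adjugate (continuous_id (X := Matrix (Fin q) (Fin q) ℝ))
  refine measurable_pi_lambda _ fun i => measurable_pi_lambda _ fun j => ?_
  have e : ∀ A : Fin q → Fin q → ℝ, (Matrix.of A)⁻¹ i j
      = ((Matrix.of A).det)⁻¹ * (Matrix.of A).adjugate i j := fun A => by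
    rw [Matrix.inv_def, Ring.inverse_eq_inv', Matrix.smul_apply, smul_eq_mul]
  simp only [e]
  refine hdet.measurable.inv.mul ?_
  have : Continuous fun A : Fin q → Fin q → ℝ => (Matrix.of A).adjugate i j :=
    hadj.matrix_elem i j
  exact this.measurable

/-- The vector `Π 1`, as a function of the factors. -/
def projOne {K n : ℕ} (i : Fin n) (y : Fin n → Fin K → ℝ) : ℝ :=
  (rowProj (Matrix.of fun a j => y j a) *ᵥ 1) i

lemma measurable_projOne (i : Fin n) : Measurable (projOne (K := K) i) := by
  have hXX : Measurable fun (y : Fin n → Fin K → ℝ) (a b : Fin K) => ∑ j, y j a * y j b := by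
    fun_prop
  have hinv := measurable_inv_matrix.comp hXX
  have hentry : ∀ a b, Measurable fun y : Fin n → Fin K → ℝ =>
      (Matrix.of fun a b : Fin K => ∑ j, y j a * y j b)⁻¹ a b := fun a b =>
    (measurable_pi_apply b).comp ((measurable_pi_apply a).comp hinv)
  have e : ∀ y : Fin n → Fin K → ℝ, projOne i y = ∑ l, ∑ b, (∑ a, y i a *
      (Matrix.of fun a b : Fin K => ∑ j, y j a * y j b)⁻¹ a b) * y l b := fun y => by
    have : (Matrix.of fun a j => y j a : Matrix (Fin K) (Fin n) ℝ)
        * (Matrix.of fun a j => y j a : Matrix (Fin K) (Fin n) ℝ)ᵀ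
        = Matrix.of fun a b : Fin K => ∑ j, y j a * y j b := by
      ext a b; simp [Matrix.mul_apply]
    rw [projOne, rowProj, this]
    simp [mulVec, dotProduct, Matrix.mul_apply]
  have : projOne (K := K) i = fun y => ∑ l, ∑ b, (∑ a, y i a *
      (Matrix.of fun a b : Fin K => ∑ j, y j a * y j b)⁻¹ a b) * y l b := funext e
  rw [this]
  refine Finset.measurable_fun_sum _ fun l _ => Finset.measurable_fun_sum _ fun b _ => ?_
  refine Measurable.mul (Finset.measurable_fun_sum _ fun a _ => ?_) (by fun_prop)
  exact Measurable.mul (by fun_prop) (hentry a b)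

lemma sum_projOne_sq_le (y : Fin n → Fin K → ℝ) : ∑ i, projOne i y ^ 2 ≤ n := by
  have := rowProj_mulVec_le (Matrix.of fun a j => y j a) (1 : Fin n → ℝ)
  have h1 : (1 : Fin n → ℝ) ⬝ᵥ 1 = n := by simp [dotProduct]
  rw [h1] at this
  simpa [dotProduct, projOne, sq] using this

lemma abs_projOne_le (i : Fin n) (y : Fin n → Fin K → ℝ) : |projOne i y| ≤ √n := by
  apply Real.abs_le_sqrt
  exact (Finset.single_le_sum (f := fun i => projOne i y ^ 2) (fun j _ => sq_nonneg _)
    (Finset.mem_univ i)).trans (sum_projOne_sq_le y)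

/-- The factor-mean part has variance (B'x)'cov(f)(B'x)/n. The noise part is a weighted sum with
weights Π1, whose squares sum to at most n, so its second moment is at most x'Σ₀x/n, where Σ₀ is the
noise covariance. The two add up to x'Σx/n; the factor 2 comes from (u + v)² ≤ 2u² + 2v². -/
lemma integral_sq_dotProduct_meanDev_le (h : M.Bounded P C σ) (hn : 0 < n) (x : Fin p → ℝ) :
    Integrable (fun ω => (x ⬝ᵥ M.meanDev P ω) ^ 2) P ∧
    ∫ ω, (x ⬝ᵥ M.meanDev P ω) ^ 2 ∂P ≤ (n : ℝ)⁻¹ * (2 * (x ⬝ᵥ (M.Sig P *ᵥ x))) := by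
  have hn0 : (n : ℝ) ≠ 0 := by positivity
  set z := M.Bᵀ *ᵥ x
  have hL : MemLp (fun ω => z ⬝ᵥ M.f ω) 2 P :=
    memLp_finsetSum _ fun k _ => (h.memLp_two_f k).const_mul (z k)
  have h1 := integral_sq_average_sub hn h.iIndepFun_pairs h.identDistrib_pairs
    (g := fun q => z ⬝ᵥ q.1) (by
      have : Continuous fun q : (Fin K → ℝ) × (Fin p → ℝ) => z ⬝ᵥ q.1 := by fun_prop
      exact this.measurable) hL
  have h2 := h.integral_sq_weighted_noise x measurable_projOne abs_projOne_le
  set U : Ω → ℝ := fun ω => (n : ℝ)⁻¹ * ∑ i, z ⬝ᵥ M.fs i ω - ∫ ω', z ⬝ᵥ M.f ω' ∂P with hU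
  set W : Ω → ℝ := fun ω => ∑ i, projOne i (fun j => M.fs j ω) * (x ⬝ᵥ M.es i ω) with hW
  have e0 : ∫ ω, z ⬝ᵥ M.f ω ∂P = z ⬝ᵥ meanVector P M.f := by
    simp only [dotProduct, meanVector]
    rw [integral_finsetSum _ fun k _ => ((h.memLp_two_f k).integrable one_le_two).const_mul _]
    simp only [integral_const_mul]
  have e : ∀ ω, x ⬝ᵥ M.meanDev P ω = U ω + (n : ℝ)⁻¹ * W ω := fun ω => by
    rw [meanDev, dotProduct_add, dotProduct_smul, smul_eq_mul]
    congr 1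
    · rw [dotProduct_mulVec, ← mulVec_transpose, dotProduct_sub, hU]
      simp only [e0, sampleMean, dotProduct_smul, smul_eq_mul]
      congr 2
      simp only [dotProduct, mulVec, X, of_apply, Pi.one_apply, mul_one, Finset.mul_sum]
      exact Finset.sum_comm
    · congr 1
      rw [dotProduct_mulVec, dotProduct_comm, dotProduct, hW]
      refine Finset.sum_congr rfl fun i _ => ?_
      congr 1
  have hle : ∀ ω, (x ⬝ᵥ M.meanDev P ω) ^ 2 ≤ 2 * U ω ^ 2 + 2 * ((n : ℝ)⁻¹ ^ 2 * W ω ^ 2) :=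
    fun ω => by
      rw [e]; nlinarith [sq_nonneg (U ω - (n : ℝ)⁻¹ * W ω)]
  have hI1 : Integrable (fun ω => 2 * U ω ^ 2) P := h1.1.const_mul 2
  have hI2 : Integrable (fun ω => 2 * ((n : ℝ)⁻¹ ^ 2 * W ω ^ 2)) P := (h2.1.const_mul _).const_mul 2
  have hm : ∀ j, AEMeasurable (fun ω => (M.fs j ω, M.es j ω)) P := fun j =>
    (h.identDistrib_pairs j).aemeasurable_fst
  have hfs : ∀ j, AEMeasurable (M.fs j) P := fun j => measurable_fst.comp_aemeasurable (hm j)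
  have hes : ∀ j, AEMeasurable (M.es j) P := fun j => measurable_snd.comp_aemeasurable (hm j)
  have hUm : AEMeasurable U P := by
    have hc : Continuous fun v : Fin K → ℝ => z ⬝ᵥ v := by fun_prop
    exact ((Finset.aemeasurable_fun_sum _ fun i _ =>
      hc.measurable.comp_aemeasurable (hfs i)).const_mul _).sub_const _
  have hWm : AEMeasurable W P := by
    have hc : Continuous fun v : Fin p → ℝ => x ⬝ᵥ v := by fun_prop
    exact Finset.aemeasurable_fun_sum _ fun i _ =>
      ((measurable_projOne i).comp_aemeasurable (aemeasurable_pi_lambda _ hfs)).mul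
        (hc.measurable.comp_aemeasurable (hes i))
  have hI : Integrable (fun ω => (x ⬝ᵥ M.meanDev P ω) ^ 2) P := by
    refine (hI1.add hI2).mono' ?_ (ae_of_all _ fun ω => ?_)
    · simp only [e]
      exact ((hUm.add (hWm.const_mul _)).pow_const 2).aestronglyMeasurable
    · rw [Real.norm_of_nonneg (sq_nonneg _)]; exact hle ω
  refine ⟨hI, ?_⟩
  have hv : ∫ ω, ∑ i, projOne i (fun j => M.fs j ω) ^ 2 ∂P ≤ n := by
    refine (integral_mono_of_nonneg (ae_of_all _ fun ω => Finset.sum_nonneg fun i _ => sq_nonneg _)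
      (integrable_const (n : ℝ)) (ae_of_all _ fun ω => sum_projOne_sq_le _)).trans (by simp)
  have hq := h.noise_quad_nonneg x
  calc _ ≤ ∫ ω, (2 * U ω ^ 2 + 2 * ((n : ℝ)⁻¹ ^ 2 * W ω ^ 2)) ∂P :=
        integral_mono hI (hI1.add hI2) hle
    _ = 2 * ∫ ω, U ω ^ 2 ∂P + 2 * ((n : ℝ)⁻¹ ^ 2 * ∫ ω, W ω ^ 2 ∂P) := by
        rw [integral_add hI1 hI2, integral_const_mul, integral_const_mul, integral_const_mul]
    _ ≤ 2 * ((n : ℝ)⁻¹ * (z ⬝ᵥ (covMatrix P M.f *ᵥ z)))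
        + 2 * ((n : ℝ)⁻¹ ^ 2 * ((x ⬝ᵥ (M.noiseCov *ᵥ x)) * n)) := by
        rw [h1.2, h2.2, quadForm_covMatrix h.memLp_two_f]
        gcongr
    _ = _ := by
        rw [h.quadForm_Sig]; field_simp; rfl

lemma measure_dotProduct_meanDev_le (h : M.Bounded P C σ) (hn : 0 < n) (x : Fin p → ℝ) {t : ℝ}
    (ht : 0 < t) : P {ω | t < |x ⬝ᵥ M.meanDev P ω|}
      ≤ ENNReal.ofReal (2 * (x ⬝ᵥ (M.Sig P *ᵥ x)) / (n * t ^ 2)) := by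
  have h1 := h.integral_sq_dotProduct_meanDev_le hn x
  refine (measure_mono (setOf_lt_abs_subset ht _)).trans ?_
  refine (measure_lt_le_of_integral_le (fun ω => sq_nonneg _) h1.1 h1.2 (by positivity)).trans
    (ENNReal.ofReal_le_ofReal (le_of_eq ?_))
  have hn0 : (n : ℝ) ≠ 0 := by positivity
  field_simp

/-- Sum the directional bound over the coordinate vectors: the trace of Σ appears, at most Cp. -/
lemma measure_norm_meanDev_le (h : M.Bounded P C σ) (hn : 0 < n) {t : ℝ}
    (ht : 0 < t) : P {ω | t < √(M.meanDev P ω ⬝ᵥ M.meanDev P ω)}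
      ≤ ENNReal.ofReal (2 * C * p / (n * t ^ 2)) := by
  have hn0 : (n : ℝ) ≠ 0 := by positivity
  have h1 := fun k => h.integral_sq_dotProduct_meanDev_le hn (Pi.single k 1)
  simp only [single_one_dotProduct, mulVec_single_one, col_apply] at h1
  have hI : Integrable (fun ω => M.meanDev P ω ⬝ᵥ M.meanDev P ω) P := by
    simp only [dotProduct, ← sq]
    exact integrable_finsetSum _ fun k _ => (h1 k).1
  have hle : ∫ ω, M.meanDev P ω ⬝ᵥ M.meanDev P ω ∂P ≤ (n : ℝ)⁻¹ * (2 * (C * p)) := by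
    simp only [dotProduct, ← sq]
    rw [integral_finsetSum _ fun k _ => (h1 k).1]
    calc _ ≤ ∑ k, (n : ℝ)⁻¹ * (2 * M.Sig P k k) := Finset.sum_le_sum fun k _ => (h1 k).2
      _ = (n : ℝ)⁻¹ * (2 * ∑ k, M.Sig P k k) := by rw [Finset.mul_sum, Finset.mul_sum]
      _ ≤ _ := by gcongr; exact h.sum_Sig_diag_le
  have hsub : {ω | t < √(M.meanDev P ω ⬝ᵥ M.meanDev P ω)}
      ⊆ {ω | t ^ 2 < M.meanDev P ω ⬝ᵥ M.meanDev P ω} := fun ω hω => (Real.lt_sqrt ht.le).1 hω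
  refine (measure_mono hsub).trans ((measure_lt_le_of_integral_le
    (fun ω => dotProduct_self_nonneg_real _) hI hle (by positivity)).trans
    (ENNReal.ofReal_le_ofReal (le_of_eq ?_)))
  field_simp

lemma measure_norm_Y_sq_le (h : M.Bounded P C σ) (hn : 0 < n) {t : ℝ} (ht : 0 < t) :
    P {ω | t < 3 / n * ‖M.Y ω‖ ^ 2} ≤ ENNReal.ofReal (3 * C * p / t) := by
  have hn0 : (n : ℝ) ≠ 0 := by positivity
  have hid : ∀ i k, IdentDistrib (fun ω => M.ys i ω k ^ 2) (fun ω => M.y ω k ^ 2) P P :=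
    fun i k => (h.condA.identDistrib i).comp
      (u := fun z : (Fin K → ℝ) × (Fin p → ℝ) => z.2 k ^ 2) (by fun_prop)
  have hI : ∀ i k, Integrable (fun ω => M.ys i ω k ^ 2) P := fun i k =>
    (hid i k).integrable_iff.2 (h.memLp_two_y k).integrable_sq
  have e : ∀ ω, 3 / (n : ℝ) * ‖M.Y ω‖ ^ 2 = 3 / n * ∑ k, ∑ i, M.ys i ω k ^ 2 := fun ω => by
    rw [frobenius_norm_sq]; rfl
  have hI' : Integrable (fun ω => 3 / (n : ℝ) * ‖M.Y ω‖ ^ 2) P := by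
    simp only [e]
    exact (integrable_finsetSum _ fun k _ => integrable_finsetSum _ fun i _ => hI i k).const_mul _
  have hle : ∫ ω, 3 / (n : ℝ) * ‖M.Y ω‖ ^ 2 ∂P ≤ 3 * C * p := by
    simp only [e]
    rw [integral_const_mul, integral_finsetSum _ fun k _ => integrable_finsetSum _ fun i _ => hI i k]
    have : ∀ k, ∫ ω, ∑ i, M.ys i ω k ^ 2 ∂P = n * ∫ ω, M.y ω k ^ 2 ∂P := fun k => by
      rw [integral_finsetSum _ fun i _ => hI i k]
      simp [fun i => (hid i k).integral_eq]
    simp only [this]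
    rw [← Finset.mul_sum, ← integral_sum_sq h.memLp_two_y]
    have hb := h.b_le
    rw [b] at hb
    calc _ = 3 * ∫ ω, ∑ k, M.y ω k ^ 2 ∂P := by field_simp
      _ ≤ _ := by linarith
  exact measure_lt_le_of_integral_le (fun ω => by positivity) hI' hle ht

end FactorSample.Bounded

/-! ### Estimation errors of the covariance matrices on the good events -/

section CovarianceErrors

open scoped Matrix.Norms.Frobenius

/-- Used for the returns with a = p and for the factors with a = K. The constant 12 is 2 from the
factor 2/n, 8 from the cross terms with m, and 2 from the squared mean deviation. -/
lemma norm_sampleCov_sub_le_of_deviation {q n : ℕ} (hn : 2 ≤ n) (Z : Matrix (Fin q) (Fin n) ℝ)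
    {G : Matrix (Fin q) (Fin q) ℝ} {m : Fin q → ℝ} {C a s η τ : ℝ} (hC : 1 ≤ C) (ha : 0 ≤ a)
    (hs : 0 ≤ s) (hs1 : s ≤ 1) (hη : 0 ≤ η) (hη1 : η ≤ 1) (hns : 2 / n ≤ η * s)
    (hG : ‖G - vecMulVec m m‖ ≤ 2 * C * a) (hm : m ⬝ᵥ m ≤ 2 * C * a)
    (hτ : ‖(n : ℝ)⁻¹ • (Z * Zᵀ) - G‖ ≤ τ)
    (hd : √((sampleMean Z - m) ⬝ᵥ (sampleMean Z - m)) ≤ η * √a * s) :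
    ‖sampleCov Z - (G - vecMulVec m m)‖ ≤ 2 * τ + 12 * C * (η * a * s) := by
  refine (norm_sampleCov_sub_le hn Z G m).trans ?_
  set d := (sampleMean Z - m) ⬝ᵥ (sampleMean Z - m)
  have hd0 : 0 ≤ d := dotProduct_self_nonneg_real _
  have hsa := Real.sq_sqrt ha
  have h1 : 2 / n * ‖G - vecMulVec m m‖ ≤ η * s * (2 * C * a) := by gcongr
  have h2 : √(m ⬝ᵥ m) ≤ 2 * C * √a := by
    refine (Real.sqrt_le_left (by positivity)).2 (hm.trans ?_)
    rw [mul_pow, hsa]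
    have : 2 * C ≤ (2 * C) ^ 2 := by nlinarith
    gcongr
  have h3 : √(m ⬝ᵥ m) * √d ≤ 2 * C * √a * (η * √a * s) := by gcongr
  have h4 : 2 * C * √a * (η * √a * s) = 2 * C * (η * a * s) := by
    linear_combination (2 * C * η * s) * hsa
  have h5 : d ≤ η * a * s := by
    calc d = √d ^ 2 := (Real.sq_sqrt hd0).symm
      _ ≤ (η * √a * s) ^ 2 := by gcongr
      _ = (η * s) * (η * a * s) := by linear_combination (η ^ 2 * s ^ 2) * hsa
      _ ≤ 1 * (η * a * s) := by
          have : η * s ≤ 1 := mul_le_one₀ hη1 hs hs1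
          gcongr
      _ = _ := one_mul _
  have h6 : 0 ≤ η * a * s := by positivity
  have h7 : η * a * s ≤ C * (η * a * s) := le_mul_of_one_le_left h6 hC
  linarith

/-- The factor in the error bounds for the covariance estimators. -/
def covConst (C σ : ℝ) : ℝ :=
  14 * C * (C / σ + 1) + (4 * (C / σ + 1) + 2) / σ * (16 * C) + 1 + 2 / σ

lemma le_covConst {C σ : ℝ} (hC : 1 ≤ C) (hσ : 0 < σ) : 14 * C ≤ covConst C σ := by
  unfold covConst
  have h1 : 14 * C ≤ 14 * C * (C / σ + 1) :=
    le_mul_of_one_le_right (by positivity) (by linarith [show 0 < C / σ by positivity])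
  have h2 : 0 ≤ (4 * (C / σ + 1) + 2) / σ * (16 * C) := by positivity
  have h3 : 0 < 2 / σ := by positivity
  linarith

lemma abs_quadForm_sub_le {ι : Type*} [Fintype ι] {T S : Matrix ι ι ℝ} {e : ℝ}
    (h : ‖T - S‖ ≤ e) (x : ι → ℝ) :
    |x ⬝ᵥ (T *ᵥ x) - x ⬝ᵥ (S *ᵥ x)| ≤ e * (x ⬝ᵥ x) := by
  have h1 := abs_quadForm_le (T - S) x
  rw [sub_mulVec, dotProduct_sub] at h1
  exact h1.trans (mul_le_mul_of_nonneg_right h (dotProduct_self_nonneg_real x))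

namespace FactorSample.Bounded

variable {Ω : Type*} [MeasurableSpace Ω] {P : Measure Ω} [IsProbabilityMeasure P] {K p n : ℕ}
  {M : FactorSample Ω K p n} {C σ s η : ℝ}

/-- The deviations are of order pKs and ps; both are relaxed to p²K²s so that the two covariance
estimators share one rate. -/
lemma norm_sampleCov_Y_sub_le (h : M.Bounded P C σ) (hn : 2 ≤ n) (hK : 1 ≤ K)
    (hs : 0 ≤ s) (hs1 : s ≤ 1) (hη : 0 ≤ η) (hη1 : η ≤ 1) (hns : 2 / n ≤ η * s) {ω : Ω}
    (hA : ‖(n : ℝ)⁻¹ • (M.Y ω * (M.Y ω)ᵀ) - secondMoment P M.y‖ ≤ η * (p * K) * s)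
    (hd : √((sampleMean (M.Y ω) - M.mu P) ⬝ᵥ (sampleMean (M.Y ω) - M.mu P)) ≤ η * √p * s) :
    ‖sampleCov (M.Y ω) - M.Sig P‖ ≤ covConst C σ * (η * (p ^ 2 * K ^ 2 * s)) := by
  have hC := h.one_le
  have hp0 : (0 : ℝ) ≤ p := Nat.cast_nonneg _
  have hS : M.Sig P = secondMoment P M.y - vecMulVec (M.mu P) (M.mu P) :=
    covMatrix_eq h.memLp_two_y
  have h2 : C * p ≤ 2 * C * p := by nlinarith
  have h1 := norm_sampleCov_sub_le_of_deviation hn (M.Y ω) hC hp0 hs hs1 hη hη1 hns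
    (by rw [← hS]; exact h.norm_Sig_le.trans h2) (h.mu_dotProduct_le.trans h2) hA hd
  rw [← hS] at h1
  have hK1 : (1 : ℝ) ≤ K := by exact_mod_cast hK
  have hKp : (K : ℝ) ≤ p := by exact_mod_cast h.condA.le
  have h3 : (p : ℝ) * K ≤ p ^ 2 * K ^ 2 := by
    have : (1 : ℝ) ≤ p * K := by nlinarith
    nlinarith
  have h4 : η * p * s ≤ η * (p ^ 2 * K ^ 2 * s) := by
    have : (p : ℝ) ≤ p ^ 2 * K ^ 2 := by nlinarith
    nlinarith [mul_nonneg hη hs]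
  have h5 : η * (p * K) * s ≤ η * (p ^ 2 * K ^ 2 * s) := by
    nlinarith [mul_nonneg hη hs]
  have h6 : 0 ≤ η * (p ^ 2 * K ^ 2 * s) := by positivity
  calc _ ≤ _ := h1
    _ ≤ 2 * C * (η * (p ^ 2 * K ^ 2 * s)) + 12 * C * (η * (p ^ 2 * K ^ 2 * s)) := by
        have : 2 * (η * (p * K) * s) ≤ 2 * C * (η * (p ^ 2 * K ^ 2 * s)) := by nlinarith
        gcongr
    _ = 14 * C * (η * (p ^ 2 * K ^ 2 * s)) := by ring
    _ ≤ _ := by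
        have := le_covConst hC h.σ_pos
        gcongr

/-- The second-moment matrix dominates cov(f), since it adds the positive semidefinite mm' with m =
Ef; the deviation costs at most half of σ. -/
lemma gram_lower (h : M.Bounded P C σ) {ω : Ω}
    (hA : ‖(n : ℝ)⁻¹ • (M.X ω * (M.X ω)ᵀ) - secondMoment P M.f‖ ≤ σ / 2) (x : Fin K → ℝ) :
    σ / 2 * (x ⬝ᵥ x) ≤ x ⬝ᵥ (((n : ℝ)⁻¹ • (M.X ω * (M.X ω)ᵀ)) *ᵥ x) := by
  have h1 := (abs_le.1 (abs_quadForm_sub_le hA x)).1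
  have h2 := h.cov_lower x
  rw [covMatrix_eq h.memLp_two_f, sub_mulVec, dotProduct_sub] at h2
  have h3 : x ⬝ᵥ (vecMulVec (meanVector P M.f) (meanVector P M.f) *ᵥ x)
      = (x ⬝ᵥ meanVector P M.f) ^ 2 := by
    rw [vecMulVec_mulVec]
    simp [dotProduct_smul, dotProduct_comm, sq]
  nlinarith [sq_nonneg (x ⬝ᵥ meanVector P M.f)]

lemma isUnit_gram (h : M.Bounded P C σ) {ω : Ω}
    (hA : ‖(n : ℝ)⁻¹ • (M.X ω * (M.X ω)ᵀ) - secondMoment P M.f‖ ≤ σ / 2) :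
    IsUnit (M.X ω * (M.X ω)ᵀ).det := by
  have h1 := (isUnit_iff_isUnit_det _).1
    (isUnit_of_lower_bound (half_pos h.σ_pos) (h.gram_lower hA))
  rw [det_smul] at h1
  exact isUnit_of_mul_isUnit_right h1

-- With ‖B‖² = O(p) and sample factor covariance O(K), put Q = ηpKs. The error of cov(f) contributes
-- O(Q), and the loadings error, multiplied by the O(K) covariance, contributes O(KQ), which
-- dominates. So the order is pK²s ≤ p²K²s.
set_option maxHeartbeats 800000 in
lemma norm_factorCovEst_sub_Sig_le (h : M.Bounded P C σ) (hn : 2 ≤ n) (hK : 1 ≤ K)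
    (hs : 0 ≤ s) (hs1 : s ≤ 1) (hη : 0 ≤ η) (hη1 : η ≤ 1) (hns : 2 / n ≤ η * s)
    (hKs : K * s ≤ σ / 2) {ω : Ω}
    (hA : ‖(n : ℝ)⁻¹ • (M.X ω * (M.X ω)ᵀ) - secondMoment P M.f‖ ≤ η * K * s)
    (hd : √((sampleMean (M.X ω) - meanVector P M.f) ⬝ᵥ
      (sampleMean (M.X ω) - meanVector P M.f)) ≤ η * √K * s)
    (hR : ‖(n : ℝ)⁻¹ • (M.E ω * (M.X ω)ᵀ)‖ ≤ η * (√p * √K) * s)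
    (hE : ‖diagonal (diag ((n : ℝ)⁻¹ • (M.E ω * (M.E ω)ᵀ))) - M.noiseCov‖ ≤ η * √p * s) :
    ‖factorCovEst (M.X ω) (M.Y ω) - M.Sig P‖ ≤ covConst C σ * (η * (p ^ 2 * K ^ 2 * s)) := by
  have hC := h.one_le
  have hσ := h.σ_pos
  have hK1 : (1 : ℝ) ≤ K := by exact_mod_cast hK
  have hKp : (K : ℝ) ≤ p := by exact_mod_cast h.condA.le
  have hp1 : (1 : ℝ) ≤ p := hK1.trans hKp
  have hrp : √(p : ℝ) ^ 2 = p := Real.sq_sqrt (by positivity)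
  have hkK : √(K : ℝ) ^ 2 = K := Real.sq_sqrt (by positivity)
  have hr1 : 1 ≤ √(p : ℝ) := Real.one_le_sqrt.2 hp1
  have hk1 : 1 ≤ √(K : ℝ) := Real.one_le_sqrt.2 hK1
  set r := √(p : ℝ)
  set k := √(K : ℝ)
  have hηs : 0 ≤ η * s := mul_nonneg hη hs
  have hcov := covMatrix_eq h.memLp_two_f
  have hA' : ‖(n : ℝ)⁻¹ • (M.X ω * (M.X ω)ᵀ) - secondMoment P M.f‖ ≤ σ / 2 := by
    refine hA.trans (le_trans ?_ hKs)
    nlinarith [mul_nonneg (zero_le_one.trans hK1) hs]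
  have hX1 := norm_sampleCov_sub_le_of_deviation hn (M.X ω) hC (by positivity : (0 : ℝ) ≤ K)
    hs hs1 hη hη1 hns (by rw [← hcov]; exact h.norm_covMatrix_f_le)
    ((meanVector_dotProduct_le h.memLp_two_f).trans h.integral_f_sq_le) hA hd
  rw [← hcov] at hX1
  have hX2 : ‖sampleCov (M.X ω) - covMatrix P M.f‖ ≤ 14 * C * (η * K * s) := by
    have : η * K * s ≤ C * (η * K * s) := le_mul_of_one_le_left (by positivity) hC
    linarith
  have hX3 : ‖sampleCov (M.X ω)‖ ≤ 16 * C * K := by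
    have e : sampleCov (M.X ω) = (sampleCov (M.X ω) - covMatrix P M.f) + covMatrix P M.f := by abel
    rw [e]
    refine (norm_add_le _ _).trans ((add_le_add hX2 h.norm_covMatrix_f_le).trans ?_)
    have h1 : η * K * s ≤ K := by
      have : η * s ≤ 1 := mul_le_one₀ hη1 hs hs1
      nlinarith
    nlinarith
  -- The threshold η√p√K s for the noise–factor moments times the bound √K/(σ/2) for the inverse
  -- Gram matrix.
  set w := 2 / σ * (η * r * K * s) with hw
  have hw0 : 0 ≤ w := by positivity
  have hRw : ‖(n : ℝ)⁻¹ • (M.E ω * (M.X ω)ᵀ)‖ * (√K / (σ / 2)) ≤ w := by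
    calc _ ≤ η * (r * k) * s * (k / (σ / 2)) := by gcongr
      _ = w := by rw [hw]; field_simp; rw [hkK]; ring
  have hmain := norm_factorCovEst_sub_le hn (M.X ω) M.B (M.E ω) (covMatrix P M.f) M.noiseCov
    (half_pos hσ) (h.gram_lower hA') hRw
  rw [← M.Y_eq, ← h.Sig_eq] at hmain
  refine hmain.trans ?_
  have hβ1 : 1 ≤ C / σ + 1 := by linarith [show 0 < C / σ by positivity]
  set β := C / σ + 1 with hβ
  have hB2 : ‖M.B‖ ^ 2 ≤ β * p := by
    refine h.norm_B_sq_le.trans ?_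
    rw [hβ, mul_div_right_comm, add_mul, one_mul]
    exact le_add_of_nonneg_right (by positivity)
  have hB1 : ‖M.B‖ ≤ β * r := by
    refine le_of_sq_le_sq (hB2.trans ?_) (by positivity)
    rw [mul_pow, hrp]
    exact mul_le_mul_of_nonneg_right (le_self_pow₀ hβ1 two_ne_zero) (by positivity)
  set Q := η * (p * K * s) with hQ
  have hQ0 : 0 ≤ Q := by positivity
  have hQle : K * Q ≤ η * (p ^ 2 * K ^ 2 * s) := by
    calc K * Q = (η * s) * (p * K ^ 2) := by rw [hQ]; ring
      _ ≤ (η * s) * (p ^ 2 * K ^ 2) := by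
          have : (p : ℝ) ≤ p ^ 2 := le_self_pow₀ hp1 two_ne_zero
          gcongr
      _ = _ := by ring
  have hQle' : Q ≤ K * Q := le_mul_of_one_le_left hQ0 hK1
  have hwB : w * ‖M.B‖ ≤ 2 / σ * β * Q := by
    calc _ ≤ w * (β * r) := by gcongr
      _ = 2 / σ * β * Q := by rw [hw, hQ, ← hrp]; ring
  -- One of the two factors Ks is replaced by σ/2, which makes the quadratic error linear in s.
  have hww : w ^ 2 ≤ 2 / σ * Q := by
    calc w ^ 2 = 4 / σ ^ 2 * ((η * p * K * s) * (η * (K * s))) := by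
          rw [hw, ← hrp]; ring
      _ ≤ 4 / σ ^ 2 * ((η * p * K * s) * (1 * (σ / 2))) := by gcongr
      _ = _ := by rw [hQ]; field_simp; ring
  have hwR : w * ‖(n : ℝ)⁻¹ • (M.E ω * (M.X ω)ᵀ)‖ ≤ 2 / σ * (K * Q) := by
    calc _ ≤ w * (η * (r * k) * s) := by gcongr
      _ = 2 / σ * (Q * (η * s * k)) := by rw [hw, hQ, ← hrp]; ring
      _ ≤ 2 / σ * (Q * K) := by
          have h1 : η * s ≤ 1 := mul_le_one₀ hη1 hs hs1
          have h2 : k ≤ K := hkK ▸ le_self_pow₀ hk1 two_ne_zero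
          have : η * s * k ≤ K := (mul_le_of_le_one_left (by positivity) h1).trans h2
          gcongr
      _ = _ := by ring
  have hEQ : η * r * s ≤ K * Q := by
    have : r ≤ p := hrp ▸ le_self_pow₀ hr1 two_ne_zero
    calc η * r * s ≤ η * p * s := by gcongr
      _ = (η * p * s) * (1 * 1) := by ring
      _ ≤ (η * p * s) * (K * K) := by gcongr
      _ = _ := by rw [hQ]; ring
  have hcc : covConst C σ = 14 * C * β + (4 * β + 2) / σ * (16 * C) + 1 + 2 / σ := rfl
  have hcc0 : 0 ≤ covConst C σ := by rw [hcc]; positivity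
  calc _ ≤ β * p * (14 * C * (η * K * s))
        + (2 * (2 / σ * β * Q) + 2 / σ * Q) * (16 * C * K) + K * Q + 2 / σ * (K * Q) := by
        have := hE.trans hEQ
        gcongr
    _ = 14 * C * β * Q + (4 * β + 2) / σ * (16 * C) * (K * Q) + K * Q + 2 / σ * (K * Q) := by
        rw [hQ]; ring
    _ ≤ 14 * C * β * (K * Q) + (4 * β + 2) / σ * (16 * C) * (K * Q) + K * Q
        + 2 / σ * (K * Q) := by gcongr
    _ = covConst C σ * (K * Q) := by rw [hcc]; ring
    _ ≤ _ := by gcongr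

end FactorSample.Bounded

end CovarianceErrors

/-! ### Probabilities of the bad events -/

section BadEvents

open scoped Matrix.Norms.Frobenius

lemma measure_union_le_ofReal {Ω : Type*} [MeasurableSpace Ω] {P : Measure Ω} {s t : Set Ω}
    {a b : ℝ} (ha0 : 0 ≤ a) (hb0 : 0 ≤ b) (ha : P s ≤ ENNReal.ofReal a)
    (hb : P t ≤ ENNReal.ofReal b) : P (s ∪ t) ≤ ENNReal.ofReal (a + b) := by
  rw [ENNReal.ofReal_add ha0 hb0]
  exact (measure_union_le s t).trans (add_le_add ha hb)

/-- The size restrictions on the rate `s` and the tolerance `η` for a sample of size `n`. -/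
structure SmallRate (C σ s η : ℝ) (n : ℕ) : Prop where
  two_le : 2 ≤ n
  s_pos : 0 < s
  s_le : s ≤ 1
  η_pos : 0 < η
  η_le : η ≤ 1
  one_le : 1 ≤ n * s ^ 2
  two_mul_le : 2 * s ≤ η
  crude : 4 * C * s ≤ η * σ ^ 2

namespace SmallRate

variable {C σ s η : ℝ} {n : ℕ}

lemma n_pos (r : SmallRate C σ s η n) : 0 < n := by have := r.two_le; omega

lemma two_div_le (r : SmallRate C σ s η n) : 2 / n ≤ η * s := by
  have hn : (0 : ℝ) < n := by exact_mod_cast r.n_pos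
  rw [div_le_iff₀ hn]
  nlinarith [r.one_le, mul_le_mul_of_nonneg_right r.two_mul_le (mul_nonneg r.s_pos.le hn.le)]

end SmallRate

/-- The deviation `Δ` of the mean vector is negligible for the optimal portfolio. -/
def LagrangeData.GoodMean {p : ℕ} {S : Matrix (Fin p) (Fin p) ℝ} {m : Fin p → ℝ} {γ σ A : ℝ}
    (D : LagrangeData S m γ σ A) (e : ℝ) (Δ : Fin p → ℝ) : Prop :=
  √(Δ ⬝ᵥ Δ) ≤ e ∧ |D.ξ ⬝ᵥ Δ| ≤ e ∧ |D.ξ ⬝ᵥ Δ| ≤ 1 / 2 ∧ |D.θ ⬝ᵥ Δ| ≤ 1 / 2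

/-- The quadratic forms of `T` and `S` differ by at most `e` on unit vectors. -/
def QuadFormClose {p : ℕ} (T S : Matrix (Fin p) (Fin p) ℝ) (e : ℝ) : Prop :=
  ∀ x, |x ⬝ᵥ (T *ᵥ x) - x ⬝ᵥ (S *ᵥ x)| ≤ e * (x ⬝ᵥ x)

lemma LagrangeData.abs_sub_le_of_goodMean {p : ℕ} {S T : Matrix (Fin p) (Fin p) ℝ}
    {m m' : Fin p → ℝ} {γ σ A e : ℝ} (D : LagrangeData S m γ σ A)
    (hT0 : ∀ x, 0 ≤ x ⬝ᵥ (T *ᵥ x)) (he : 0 ≤ e) (hTS : QuadFormClose T S e)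
    (hm : D.GoodMean e (m' - m)) :
    |optimalVariance T m' γ - optimalVariance S m γ| ≤ pertConst σ A * e :=
  D.abs_sub_le hT0 he hTS ((Real.sqrt_le_left he).1 hm.1) hm.2.1 hm.2.2.1 hm.2.2.2

namespace FactorSample.Bounded

variable {Ω : Type*} [MeasurableSpace Ω] {P : Measure Ω} [IsProbabilityMeasure P] {K p n : ℕ}
  {M : FactorSample Ω K p n} {C σ s η : ℝ}

lemma measure_sampleCov_bad_le (h : M.Bounded P C σ) (r : SmallRate C σ s η n) (hK : 1 ≤ K) :
    P {ω | ¬ QuadFormClose (sampleCov (M.Y ω)) (M.Sig P) (covConst C σ * (η * (p ^ 2 * K ^ 2 * s)))}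
      ≤ ENNReal.ofReal ((8 * C * (C ^ 2 / σ ^ 2 + 1) + C) / (η ^ 2 * (n * s ^ 2))) := by
  have hC := h.one_le
  have hσ := h.σ_pos
  have hη := r.η_pos
  have hs := r.s_pos
  have hn := r.n_pos
  have hp : 1 ≤ p := hK.trans h.condA.le
  have hn' : (0 : ℝ) < n := by exact_mod_cast hn
  have hK' : (0 : ℝ) < K := by exact_mod_cast hK
  have hp' : (0 : ℝ) < p := by exact_mod_cast hp
  -- Each threshold scales like the root of its second-moment bound, so p and K cancel in Chebyshev
  -- and only const/(η² n s²) remains.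
  have h1 := h.measure_norm_YY_le hn hK (t := η * (p * K) * s) (by positivity)
  have h2 := h.measure_mean_y_le hn (t := η * √p * s) (by positivity)
  refine (measure_mono ?_).trans ((measure_union_le_ofReal (by positivity) (by positivity) h1
    h2).trans (ENNReal.ofReal_le_ofReal (le_of_eq ?_)))
  · intro ω hω
    by_contra hcon
    simp only [Set.mem_union, Set.mem_ofPred_eq, not_or, not_lt] at hcon
    exact hω (abs_quadForm_sub_le (h.norm_sampleCov_Y_sub_le r.two_le hK hs.le r.s_le hη.le r.η_le
      r.two_div_le hcon.1 hcon.2))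
  · simp only [mul_pow, Real.sq_sqrt hp'.le]
    field_simp

lemma measure_gram_bad_le (h : M.Bounded P C σ) (r : SmallRate C σ s η n) (hK : 1 ≤ K) :
    P {ω | K * s ≤ σ / 2 ∧ ¬ IsUnit (M.X ω * (M.X ω)ᵀ).det}
      ≤ ENNReal.ofReal (C / (η ^ 2 * (n * s ^ 2))) := by
  have hη := r.η_pos
  have hs := r.s_pos
  have hn := r.n_pos
  have hn' : (0 : ℝ) < n := by exact_mod_cast hn
  have hK' : (0 : ℝ) < K := by exact_mod_cast hK
  have h1 := h.measure_norm_XX_le hn (t := η * K * s) (by positivity)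
  refine (measure_mono ?_).trans (h1.trans (ENNReal.ofReal_le_ofReal (le_of_eq ?_)))
  · rintro ω ⟨hω, hu⟩
    refine lt_of_not_ge fun hle => hu (h.isUnit_gram (hle.trans (le_trans ?_ hω)))
    rw [mul_assoc]
    exact mul_le_of_le_one_left (by positivity) r.η_le
  · field_simp

lemma measure_factorCovEst_bad_of_le (h : M.Bounded P C σ) (r : SmallRate C σ s η n) (hK : 1 ≤ K)
    (hKs : K * s ≤ σ / 2) :
    P {ω | ¬ QuadFormClose (factorCovEst (M.X ω) (M.Y ω)) (M.Sig P)
        (covConst C σ * (η * (p ^ 2 * K ^ 2 * s)))}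
      ≤ ENNReal.ofReal (5 * C / (η ^ 2 * (n * s ^ 2))) := by
  have hC := h.one_le
  have hη := r.η_pos
  have hs := r.s_pos
  have hn := r.n_pos
  have hp : 1 ≤ p := hK.trans h.condA.le
  have hn' : (0 : ℝ) < n := by exact_mod_cast hn
  have hK' : (0 : ℝ) < K := by exact_mod_cast hK
  have hp' : (0 : ℝ) < p := by exact_mod_cast hp
  -- Again the dimensions cancel; the four events contribute C, 2C, C and C, which add up to 5C.
  have h1 := h.measure_norm_XX_le hn (t := η * K * s) (by positivity)
  have h2 := h.measure_mean_f_le hn (t := η * √K * s) (by positivity)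
  have h3 := h.measure_norm_EX_le hn (t := η * (√p * √K) * s) (by positivity)
  have h4 := h.measure_norm_EE_le hn (t := η * √p * s) (by positivity)
  have h12 := measure_union_le_ofReal (by positivity) (by positivity) h1 h2
  have h34 := measure_union_le_ofReal (by positivity) (by positivity) h3 h4
  refine (measure_mono ?_).trans ((measure_union_le_ofReal (by positivity) (by positivity) h12
    h34).trans (ENNReal.ofReal_le_ofReal (le_of_eq ?_)))
  · intro ω hω
    by_contra hcon
    simp only [Set.mem_union, Set.mem_ofPred_eq, not_or, not_lt] at hcon
    exact hω (abs_quadForm_sub_le (h.norm_factorCovEst_sub_Sig_le r.two_le hK hs.le r.s_le hη.le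
      r.η_le r.two_div_le hKs hcon.1.1 hcon.1.2 hcon.2.1 hcon.2.2))
  · simp only [mul_pow, Real.sq_sqrt hp'.le, Real.sq_sqrt hK'.le]
    field_simp
    ring

/-- Here the rate ρ = p²K²s is at least σ²p/(4s). Off an event bounded by Markov for (3/n)‖Y‖², the
estimated and the true form both lie between 0 and ηρ‖x‖², so they are close without any
consistency. Markov gives 3Cp/(ηρ) ≤ 12Cs/(ησ²). -/
lemma measure_factorCovEst_bad_of_lt (h : M.Bounded P C σ) (r : SmallRate C σ s η n) (hK : 1 ≤ K)
    (hKs : σ / 2 < K * s) :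
    P {ω | ¬ QuadFormClose (factorCovEst (M.X ω) (M.Y ω)) (M.Sig P)
        (covConst C σ * (η * (p ^ 2 * K ^ 2 * s)))}
      ≤ ENNReal.ofReal (12 * C * s / (η * σ ^ 2)) := by
  have hC := h.one_le
  have hσ := h.σ_pos
  have hη := r.η_pos
  have hs := r.s_pos
  have hn := r.n_pos
  have hp : 1 ≤ p := hK.trans h.condA.le
  have hn' : (0 : ℝ) < n := by exact_mod_cast hn
  have hK' : (0 : ℝ) < K := by exact_mod_cast hK
  have hp1 : (1 : ℝ) ≤ p := by exact_mod_cast hp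
  have hp' : (0 : ℝ) < p := by linarith
  have hlow : σ ^ 2 * p ≤ 4 * s * (p ^ 2 * K ^ 2 * s) := by
    have h1 : (σ / 2) ^ 2 ≤ (K * s) ^ 2 := by gcongr
    have h2 : (p : ℝ) ≤ p ^ 2 := le_self_pow₀ hp1 two_ne_zero
    calc σ ^ 2 * p = 4 * (σ / 2) ^ 2 * p := by ring
      _ ≤ 4 * (K * s) ^ 2 * p ^ 2 := by gcongr
      _ = _ := by ring
  set ρ := (p : ℝ) ^ 2 * K ^ 2 * s with hρ
  have hρ0 : 0 < ρ := by positivity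
  have hCp : C * p ≤ η * ρ := by
    have h1 := mul_le_mul_of_nonneg_left hlow (by linarith : 0 ≤ C)
    have h2 := mul_le_mul_of_nonneg_right r.crude hρ0.le
    have h3 : σ ^ 2 * (C * p) ≤ σ ^ 2 * (η * ρ) := by linarith
    exact le_of_mul_le_mul_left h3 (by positivity)
  have hcc : 1 ≤ covConst C σ := by linarith [le_covConst hC hσ]
  have h1 := h.measure_norm_Y_sq_le hn (t := η * ρ) (by positivity)
  refine (measure_mono ?_).trans (h1.trans (ENNReal.ofReal_le_ofReal ?_))
  · intro ω hω
    change η * ρ < 3 / n * ‖M.Y ω‖ ^ 2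
    refine lt_of_not_ge fun hle => hω fun x => ?_
    have hx := dotProduct_self_nonneg_real x
    have e1 := quadForm_factorCovEst_nonneg r.two_le (M.X ω) (M.Y ω) x
    have e2 := (quadForm_factorCovEst_le r.two_le (M.X ω) (M.Y ω) x).trans
      (mul_le_mul_of_nonneg_right hle hx)
    have e3 := (mul_nonneg hσ.le hx).trans (h.Sig_lower x)
    have e4 := (le_abs_self (x ⬝ᵥ (M.Sig P *ᵥ x))).trans ((abs_quadForm_le (M.Sig P) x).trans
      (mul_le_mul_of_nonneg_right (h.norm_Sig_le.trans hCp) hx))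
    have e5 : η * ρ * (x ⬝ᵥ x) ≤ covConst C σ * (η * ρ) * (x ⬝ᵥ x) :=
      mul_le_mul_of_nonneg_right (le_mul_of_one_le_left (by positivity) hcc) hx
    rw [abs_le]
    constructor <;> linarith
  · rw [div_le_div_iff₀ (by positivity) (by positivity)]
    have := mul_le_mul_of_nonneg_left hlow (by positivity : 0 ≤ 3 * C * η)
    linarith

lemma measure_factorCovEst_bad_le (h : M.Bounded P C σ) (r : SmallRate C σ s η n) (hK : 1 ≤ K) :
    P {ω | ¬ QuadFormClose (factorCovEst (M.X ω) (M.Y ω)) (M.Sig P)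
        (covConst C σ * (η * (p ^ 2 * K ^ 2 * s)))}
      ≤ ENNReal.ofReal (5 * C / (η ^ 2 * (n * s ^ 2)) + 12 * C * s / (η * σ ^ 2)) := by
  have hC := h.one_le
  have hσ := h.σ_pos
  have hη := r.η_pos
  have hs := r.s_pos
  rcases le_or_gt (K * s) (σ / 2) with hKs | hKs
  · refine (h.measure_factorCovEst_bad_of_le r hK hKs).trans (ENNReal.ofReal_le_ofReal ?_)
    exact le_add_of_nonneg_right (by positivity)
  · refine (h.measure_factorCovEst_bad_of_lt r hK hKs).trans (ENNReal.ofReal_le_ofReal ?_)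
    exact le_add_of_nonneg_left (by positivity)

/-- The threshold η p s already suffices for ‖Δ‖ and ξ'Δ. The two fixed thresholds 1/2 cost 8A/n
each, whatever p and K are, because ξ and θ have bounded variance. -/
lemma measure_not_goodMean_le (h : M.Bounded P C σ) (r : SmallRate C σ s η n) (hK : 1 ≤ K)
    {γ A : ℝ} (D : LagrangeData (M.Sig P) (M.mu P) γ σ A) {Δ : Ω → Fin p → ℝ}
    (hΔ : ∀ t : ℝ, 0 < t → P {ω | t < √(Δ ω ⬝ᵥ Δ ω)} ≤ ENNReal.ofReal (2 * C * p / (n * t ^ 2)))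
    (hΔx : ∀ (x : Fin p → ℝ) (t : ℝ), 0 < t → P {ω | t < |x ⬝ᵥ Δ ω|}
      ≤ ENNReal.ofReal (2 * (x ⬝ᵥ (M.Sig P *ᵥ x)) / (n * t ^ 2))) :
    P {ω | ¬ D.GoodMean (covConst C σ * (η * (p ^ 2 * K ^ 2 * s))) (Δ ω)}
      ≤ ENNReal.ofReal (2 * (C + A) / (η ^ 2 * (n * s ^ 2)) + 16 * A / n) := by
  have hC := h.one_le
  have hσ := h.σ_pos
  have hη := r.η_pos
  have hs := r.s_pos
  have hA := D.C_nonneg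
  have hK1 : (1 : ℝ) ≤ K := by exact_mod_cast hK
  have hp1 : (1 : ℝ) ≤ p := by exact_mod_cast hK.trans h.condA.le
  have hn' : (0 : ℝ) < n := by exact_mod_cast r.n_pos
  have hcc : 1 ≤ covConst C σ := by linarith [le_covConst hC hσ]
  have hps : p * s ≤ p ^ 2 * K ^ 2 * s := by
    have h1 : (p : ℝ) ≤ p ^ 2 := le_self_pow₀ hp1 two_ne_zero
    have h2 : (1 : ℝ) ≤ K ^ 2 := one_le_pow₀ hK1
    have h3 : (p : ℝ) * 1 ≤ p ^ 2 * K ^ 2 := by gcongr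
    rw [mul_one] at h3
    gcongr
  have hthr : η * (p * s) ≤ covConst C σ * (η * (p ^ 2 * K ^ 2 * s)) :=
    (mul_le_mul_of_nonneg_left hps hη.le).trans (le_mul_of_one_le_left (by positivity) hcc)
  have h1 := hΔ (η * (p * s)) (by positivity)
  have h2 := (hΔx D.ξ (η * (p * s)) (by positivity)).trans
    (ENNReal.ofReal_le_ofReal (show _ ≤ 2 * A / (n * (η * (p * s)) ^ 2) by
      gcongr; exact D.V_le))
  have h3 := (hΔx D.ξ (1 / 2) (by positivity)).trans
    (ENNReal.ofReal_le_ofReal (show _ ≤ 2 * A / (n * (1 / 2) ^ 2) by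
      gcongr; exact D.V_le))
  have h4 := (hΔx D.θ (1 / 2) (by positivity)).trans
    (ENNReal.ofReal_le_ofReal (show _ ≤ 2 * A / (n * (1 / 2) ^ 2) by
      gcongr; exact D.θ_le))
  have h12 := measure_union_le_ofReal (by positivity) (by positivity) h1 h2
  have h34 := measure_union_le_ofReal (by positivity) (by positivity) h3 h4
  refine (measure_mono ?_).trans ((measure_union_le_ofReal (by positivity) (by positivity) h12
    h34).trans (ENNReal.ofReal_le_ofReal ?_))
  · intro ω hω
    by_contra hcon
    simp only [Set.mem_union, Set.mem_ofPred_eq, not_or, not_lt] at hcon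
    exact hω ⟨hcon.1.1.trans hthr, hcon.1.2.trans hthr, hcon.2.1, hcon.2.2⟩
  · have e1 : 2 * C * p / (n * (η * (p * s)) ^ 2) ≤ 2 * C / (η ^ 2 * (n * s ^ 2)) := by
      rw [div_le_div_iff₀ (by positivity) (by positivity)]
      have : (p : ℝ) ≤ p ^ 2 := le_self_pow₀ hp1 two_ne_zero
      calc 2 * C * p * (η ^ 2 * (n * s ^ 2)) ≤ 2 * C * p ^ 2 * (η ^ 2 * (n * s ^ 2)) := by gcongr
        _ = _ := by ring
    have e2 : 2 * A / (n * (η * (p * s)) ^ 2) ≤ 2 * A / (η ^ 2 * (n * s ^ 2)) := by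
      have : (1 : ℝ) ≤ p ^ 2 := one_le_pow₀ hp1
      apply div_le_div_of_nonneg_left (by positivity) (by positivity)
      calc η ^ 2 * (n * s ^ 2) ≤ η ^ 2 * (n * s ^ 2) * p ^ 2 :=
            le_mul_of_one_le_right (by positivity) this
        _ = _ := by ring
    have e3 : 2 * A / (n * (1 / 2 : ℝ) ^ 2) + 2 * A / (n * (1 / 2 : ℝ) ^ 2) = 16 * A / n := by
      field_simp; ring
    rw [e3, mul_add 2 C A, add_div]
    linarith

lemma measure_optimalVariance_sampleMean_le (h : M.Bounded P C σ) (r : SmallRate C σ s η n)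
    (hK : 1 ≤ K) {γ A ε a : ℝ} (D : LagrangeData (M.Sig P) (M.mu P) γ σ A)
    (hε : LagrangeData.pertConst σ A * (covConst C σ * η) ≤ ε) (ha0 : 0 ≤ a)
    {T : Ω → Matrix (Fin p) (Fin p) ℝ} (hT0 : ∀ ω x, 0 ≤ x ⬝ᵥ (T ω *ᵥ x))
    (hT : P {ω | ¬ QuadFormClose (T ω) (M.Sig P) (covConst C σ * (η * (p ^ 2 * K ^ 2 * s)))}
      ≤ ENNReal.ofReal a) :
    P {ω | ε * (p ^ 2 * K ^ 2 * s) < |optimalVariance (T ω) (sampleMean (M.Y ω)) γ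
        - optimalVariance (M.Sig P) (M.mu P) γ|}
      ≤ ENNReal.ofReal (a + (2 * (C + A) / (η ^ 2 * (n * s ^ 2)) + 16 * A / n)) := by
  have hC := h.one_le
  have hσ := h.σ_pos
  have hη := r.η_pos
  have hs := r.s_pos
  have hA := D.C_nonneg
  have hcc : 1 ≤ covConst C σ := by linarith [le_covConst hC hσ]
  have hm := h.measure_not_goodMean_le r hK D (Δ := fun ω => sampleMean (M.Y ω) - M.mu P)
    (fun t ht => (h.measure_mean_y_le r.n_pos ht).trans (ENNReal.ofReal_le_ofReal (by
      gcongr; linarith)))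
    (fun x t ht => (h.measure_dotProduct_mean_y_le r.n_pos x ht).trans
      (ENNReal.ofReal_le_ofReal (by
        have := (mul_nonneg hσ.le (dotProduct_self_nonneg_real x)).trans (h.Sig_lower x)
        gcongr; linarith)))
  refine (measure_mono ?_).trans (measure_union_le_ofReal ha0 (by positivity) hT hm)
  intro ω hω
  by_contra hcon
  simp only [Set.mem_union, Set.mem_ofPred_eq, not_or, not_not] at hcon
  have h1 := D.abs_sub_le_of_goodMean (hT0 ω) (by positivity) hcon.1 hcon.2
  have h2 := mul_le_mul_of_nonneg_right hε (by positivity : 0 ≤ (p : ℝ) ^ 2 * K ^ 2 * s)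
  simp only [Set.mem_ofPred_eq] at hω
  linarith

lemma measure_optimalVariance_factorMeanEst_le (h : M.Bounded P C σ) (r : SmallRate C σ s η n)
    (hK : 1 ≤ K) {γ A ε a : ℝ} (D : LagrangeData (M.Sig P) (M.mu P) γ σ A)
    (hε : LagrangeData.pertConst σ A * (covConst C σ * η) ≤ ε) (hε' : 2 * (covConst C σ * η) ≤ ε)
    (hs' : 8 * (C + A) * s ≤ ε * σ ^ 2) (ha0 : 0 ≤ a)
    {T : Ω → Matrix (Fin p) (Fin p) ℝ} (hT0 : ∀ ω x, 0 ≤ x ⬝ᵥ (T ω *ᵥ x))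
    (hT : P {ω | ¬ QuadFormClose (T ω) (M.Sig P) (covConst C σ * (η * (p ^ 2 * K ^ 2 * s)))}
      ≤ ENNReal.ofReal a) :
    P {ω | ε * (p ^ 2 * K ^ 2 * s) < |optimalVariance (T ω) (factorMeanEst (M.X ω) (M.Y ω)) γ
        - optimalVariance (M.Sig P) (M.mu P) γ|}
      ≤ ENNReal.ofReal (a + ((2 * (C + A) / (η ^ 2 * (n * s ^ 2)) + 16 * A / n)
        + C / (η ^ 2 * (n * s ^ 2)))) := by
  have hC := h.one_le
  have hσ := h.σ_pos
  have hη := r.η_pos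
  have hs := r.s_pos
  have hA := D.C_nonneg
  have hcc : 1 ≤ covConst C σ := by linarith [le_covConst hC hσ]
  have hm := h.measure_not_goodMean_le r hK D (Δ := fun ω => M.meanDev P ω)
    (fun t ht => h.measure_norm_meanDev_le r.n_pos ht)
    (fun x t ht => h.measure_dotProduct_meanDev_le r.n_pos x ht)
  have hg := measure_union_le_ofReal (by positivity) (by positivity) hm (h.measure_gram_bad_le r hK)
  refine (measure_mono ?_).trans (measure_union_le_ofReal ha0 (by positivity) hT hg)
  intro ω hω
  by_contra hcon
  simp only [Set.mem_union, Set.mem_ofPred_eq, not_or, not_not, not_and] at hcon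
  obtain ⟨hc1, hc2, hc3⟩ := hcon
  simp only [Set.mem_ofPred_eq] at hω
  have hρ0 : 0 ≤ (p : ℝ) ^ 2 * K ^ 2 * s := by positivity
  by_cases hu : IsUnit (M.X ω * (M.X ω)ᵀ).det
  · rw [← h.factorMeanEst_sub_mu hu] at hc2
    have h1 := D.abs_sub_le_of_goodMean (hT0 ω) (by positivity) hc1 hc2
    have h2 := mul_le_mul_of_nonneg_right hε hρ0
    linarith
  · have hKs : σ / 2 < K * s := lt_of_not_ge fun hle => hu (hc3 hle)
    rw [factorMeanEst_of_not_isUnit _ hu] at hω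
    have hb : (1 : Fin p → ℝ) ⬝ᵥ (M.Sig P *ᵥ 1) ≤ C * p ^ 2 := by
      refine (le_abs_self _).trans ((abs_quadForm_le _ _).trans ?_)
      calc _ ≤ C * p * ((1 : Fin p → ℝ) ⬝ᵥ 1) :=
            mul_le_mul_of_nonneg_right h.norm_Sig_le (dotProduct_self_nonneg_real _)
        _ = _ := by simp; ring
    have h1 := D.abs_sub_le_of_mean_zero (hT0 ω) (by linarith) (by positivity) hb hc1
    have h2 := mul_le_mul_of_nonneg_right hε' hρ0
    have hp1 : (1 : ℝ) ≤ p := by exact_mod_cast hK.trans h.condA.le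
    have hlow : σ ^ 2 ≤ 4 * s * (p ^ 2 * K ^ 2 * s) := by
      have e1 : (σ / 2) ^ 2 ≤ (K * s) ^ 2 := by gcongr
      have e2 : (1 : ℝ) ≤ p ^ 2 := one_le_pow₀ hp1
      calc σ ^ 2 = 4 * ((σ / 2) ^ 2 * 1) := by ring
        _ ≤ 4 * ((K * s) ^ 2 * p ^ 2) := by gcongr
        _ = _ := by ring
    have h3 : 2 * (C + A) ≤ ε * (p ^ 2 * K ^ 2 * s) := by
      have e1 := mul_le_mul_of_nonneg_right hs' hρ0
      have e2 := mul_le_mul_of_nonneg_left hlow (by positivity : 0 ≤ 2 * (C + A))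
      have e3 : σ ^ 2 * (2 * (C + A)) ≤ σ ^ 2 * (ε * (p ^ 2 * K ^ 2 * s)) := by linarith
      exact le_of_mul_le_mul_left e3 (by positivity)
    linarith

end FactorSample.Bounded

end BadEvents

/-! ### Asymptotics -/

section Asymptotics

/-! ### From the asymptotic hypotheses to uniform quantitative bounds -/

lemma mul_dotProduct_self_le_of_spectrum {q : ℕ} {A : Matrix (Fin q) (Fin q) ℝ} (hA : A.IsSymm)
    {σ : ℝ} (hσ : ∀ t ∈ spectrum ℝ A, σ ≤ t) (x : Fin q → ℝ) :
    σ * (x ⬝ᵥ x) ≤ x ⬝ᵥ (A *ᵥ x) := by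
  have hh : (A - algebraMap ℝ _ σ).IsHermitian := by
    rw [IsHermitian, conjTranspose_eq_transpose_of_trivial, transpose_sub, hA.eq,
      algebraMap_eq_diagonal, diagonal_transpose]
  have hpsd : (A - algebraMap ℝ _ σ).PosSemidef := by
    rw [hh.posSemidef_iff_eigenvalues_nonneg]
    intro i
    have h1 := hh.eigenvalues_mem_spectrum_real i
    rw [← spectrum.sub_singleton_eq, Set.mem_sub] at h1
    obtain ⟨a, ha, b, hb, hab⟩ := h1
    rw [Set.mem_singleton_iff] at hb
    have := hσ a ha
    simp only [Pi.zero_apply]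
    linarith
  have h2 := hpsd.dotProduct_mulVec_nonneg x
  simp only [star_trivial, sub_mulVec, dotProduct_sub, Algebra.algebraMap_eq_smul_one,
    smul_mulVec, one_mulVec, dotProduct_smul, smul_eq_mul] at h2
  linarith

lemma FactorSample.bounded_of_conditions {Ω : Type*} [MeasurableSpace Ω] {P : Measure Ω}
    [IsProbabilityMeasure P] {K p n : ℕ} {M : FactorSample Ω K p n} {C σ : ℝ}
    (hA : M.ConditionA P) (hf : ∀ a, MemLp (fun ω => M.f ω a) 4 P)
    (hnoise : ∀ k, MemLp (fun ω => M.noise ω k) 4 P) (hc : M.c P ≤ C) (hd : M.d P ≤ C)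
    (hb : M.b P ≤ C * p) (hC : 1 ≤ C) (hσ : 0 < σ)
    (hσf : ∀ t ∈ spectrum ℝ (covMatrix P M.f), σ ≤ t)
    (hσn : ∀ t ∈ spectrum ℝ M.noiseCov, σ ≤ t) : M.Bounded P C σ where
  condA := hA
  memLp_f := hf
  memLp_noise := hnoise
  f_le a := (le_ciSup (f := fun a => ∫ ω, M.f ω a ^ 4 ∂P) (Set.finite_range _).bddAbove a).trans hc
  noise_le k :=
    (le_ciSup (f := fun k => ∫ ω, M.noise ω k ^ 4 ∂P) (Set.finite_range _).bddAbove k).trans hd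
  b_le := hb
  one_le := hC
  σ_pos := hσ
  cov_lower := mul_dotProduct_self_le_of_spectrum covMatrix_isSymm hσf
  noise_lower := mul_dotProduct_self_le_of_spectrum hA.isDiag.isSymm hσn

/-- Without factors the mean of the returns is zero, so ψ = ϕ = 0 and the denominator vanishes. -/
lemma FactorSample.Bounded.one_le_K {Ω : Type*} [MeasurableSpace Ω] {P : Measure Ω}
    [IsProbabilityMeasure P] {K p n : ℕ} {M : FactorSample Ω K p n} {C σ : ℝ}
    (h : M.Bounded P C σ) (hd : M.denom P ≠ 0) : 1 ≤ K := by
  rcases Nat.eq_zero_or_pos K with hK | hK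
  · subst hK
    refine absurd ?_ hd
    have : M.mu P = 0 := by
      rw [h.mu_eq, Subsingleton.elim (meanVector P M.f) 0, mulVec_zero]
    simp [FactorSample.denom, FactorSample.phi, FactorSample.psi, this]
  · exact hK

lemma FactorSample.Bounded.exists_lagrangeData {Ω : Type*} [MeasurableSpace Ω] {P : Measure Ω}
    [IsProbabilityMeasure P] {K p n : ℕ} {M : FactorSample Ω K p n} {C σ A G γ : ℝ}
    (h : M.Bounded P C σ) (hd : M.denom P ≠ 0) (h1 : |M.varphi P / M.denom P| ≤ A)
    (h2 : |M.psi P / M.denom P| ≤ A) (h3 : |M.phi P / M.denom P| ≤ A) (hγ : |γ| ≤ G) :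
    Nonempty (LagrangeData (M.Sig P) (M.mu P) γ σ (A * (1 + G) ^ 2)) :=
  _root_.exists_lagrangeData h.Sig_isSymm h.σ_pos h.Sig_lower (M.mu P) γ (a := M.varphi P)
    (b := M.psi P) (c := M.phi P) rfl rfl rfl hd h1 h2 h3 hγ

/-- The rate `(log n / n)^{1/2}`. -/
def logRate (n : ℕ) : ℝ := √(Real.log n / n)

lemma tendsto_logRate : Tendsto logRate atTop (𝓝 0) := by
  have h1 : Tendsto (fun n : ℕ => Real.log n / n) atTop (𝓝 0) :=
    (Real.isLittleO_log_id_atTop.tendsto_div_nhds_zero).comp tendsto_natCast_atTop_atTop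
  have h2 := (Real.continuous_sqrt.tendsto 0).comp h1
  rwa [Real.sqrt_zero] at h2

/-- This is where the logarithm enters: n s² tends to infinity, so the Chebyshev bounds const/(η² n
s²) vanish for every fixed η. -/
lemma mul_logRate_sq {n : ℕ} (hn : 1 ≤ n) : n * logRate n ^ 2 = Real.log n := by
  have hn' : (1 : ℝ) ≤ n := by exact_mod_cast hn
  rw [logRate, Real.sq_sqrt (div_nonneg (Real.log_nonneg hn') (by positivity))]
  field_simp

lemma tendsto_log_natCast : Tendsto (fun n : ℕ => Real.log n) atTop atTop :=
  Real.tendsto_log_atTop.comp tendsto_natCast_atTop_atTop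

lemma eventually_mul_logRate_le (c : ℝ) {d : ℝ} (hd : 0 < d) :
    ∀ᶠ n in atTop, c * logRate n ≤ d := by
  have h := tendsto_logRate.const_mul c
  rw [mul_zero] at h
  exact h.eventually_le_const hd

lemma eventually_smallRate {C σ η : ℝ} (hσ : 0 < σ) (hη : 0 < η) (hη1 : η ≤ 1) :
    ∀ᶠ n in atTop, SmallRate C σ (logRate n) η n := by
  filter_upwards [eventually_ge_atTop 2, tendsto_log_natCast.eventually_ge_atTop 1,
    eventually_mul_logRate_le 1 one_pos, eventually_mul_logRate_le 2 hη,
    eventually_mul_logRate_le (4 * C) (show 0 < η * σ ^ 2 by positivity)] with n h1 h2 h3 h4 h5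
  have hn : (0 : ℝ) < n := by positivity
  exact ⟨h1, Real.sqrt_pos.2 (div_pos (by linarith) hn), by linarith, hη, hη1,
    by rw [mul_logRate_sq (by omega)]; exact h2, h4, h5⟩

lemma tendsto_div_mul_logRate_sq (c η : ℝ) :
    Tendsto (fun n : ℕ => c / (η ^ 2 * (n * logRate n ^ 2))) atTop (𝓝 0) := by
  have h1 : Tendsto (fun n : ℕ => c / η ^ 2 * (Real.log n)⁻¹) atTop (𝓝 0) := by
    have := tendsto_log_natCast.inv_tendsto_atTop.const_mul (c / η ^ 2)
    rwa [mul_zero] at this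
  refine h1.congr' ?_
  filter_upwards [eventually_ge_atTop 1] with n hn
  rw [mul_logRate_sq hn, ← div_eq_mul_inv, div_div]

lemma exists_tolerance (a : ℝ) {c ε : ℝ} (hc : 0 < c) (hε : 0 < ε) :
    ∃ η : ℝ, 0 < η ∧ η ≤ 1 ∧ a * (c * η) ≤ ε ∧ 2 * (c * η) ≤ ε := by
  have ha := abs_nonneg a
  have hcη : c * min 1 (ε / ((|a| + 2) * c)) ≤ ε / (|a| + 2) := by
    calc _ ≤ c * (ε / ((|a| + 2) * c)) := by gcongr; exact min_le_right _ _
      _ = _ := by field_simp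
  have hη : 0 < min 1 (ε / ((|a| + 2) * c)) := lt_min one_pos (by positivity)
  rw [le_div_iff₀ (by positivity)] at hcη
  have h0 := mul_pos hc hη
  refine ⟨_, hη, min_le_left _ _, ?_, ?_⟩
  · nlinarith [le_abs_self a]
  · nlinarith

lemma IsLittleOInProb.mono {Ω : ℕ → Type*} [∀ n, MeasurableSpace (Ω n)] {P : ∀ n, Measure (Ω n)}
    {Z : ∀ n, Ω n → ℝ} {a a' : ℕ → ℝ} (h : IsLittleOInProb P Z a) (haa' : ∀ᶠ n in atTop, a n ≤ a' n) :
    IsLittleOInProb P Z a' := fun ε hε => by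
  refine tendsto_of_tendsto_of_tendsto_of_le_of_le' tendsto_const_nhds (h ε hε)
    (Eventually.of_forall fun _ => zero_le) ?_
  filter_upwards [haa'] with n hn
  exact measure_mono fun ω hω => (mul_le_mul_of_nonneg_left hn hε.le).trans_lt hω

lemma tendsto_measure_zero_of_le_ofReal {Ω : ℕ → Type*} [∀ n, MeasurableSpace (Ω n)]
    {P : ∀ n, Measure (Ω n)} {S : ∀ n, Set (Ω n)} {F : ℕ → ℝ} (hF : Tendsto F atTop (𝓝 0))
    (h : ∀ᶠ n in atTop, P n (S n) ≤ ENNReal.ofReal (F n)) :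
    Tendsto (fun n => P n (S n)) atTop (𝓝 0) := by
  have hF' := ENNReal.tendsto_ofReal hF
  rw [ENNReal.ofReal_zero] at hF'
  exact tendsto_of_tendsto_of_tendsto_of_le_of_le' tendsto_const_nhds hF'
    (Eventually.of_forall fun _ => zero_le) h

section UniformBounds

variable {Ω : ℕ → Type*} [∀ n, MeasurableSpace (Ω n)] {P : ∀ n, Measure (Ω n)}
  [∀ n, IsProbabilityMeasure (P n)] {K p : ℕ → ℕ} {M : ∀ n, FactorSample (Ω n) (K n) (p n) n}
  {γ : ℕ → ℝ}

/-- Uniform bounds for a sequence of factor models. -/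
def UniformlyBounded (P : ∀ n, Measure (Ω n)) (M : ∀ n, FactorSample (Ω n) (K n) (p n) n)
    (γ : ℕ → ℝ) (C σ A : ℝ) : Prop :=
  ∀ᶠ n in atTop, (M n).Bounded (P n) C σ ∧ 1 ≤ K n ∧
    Nonempty (LagrangeData ((M n).Sig (P n)) ((M n).mu (P n)) (γ n) σ A)

lemma exists_uniformlyBounded
    (hA : ∀ n ≥ 1, (M n).ConditionA (P n)) (hB : ConditionB P M) (hC : ConditionC M)
    (hdenom : ∃ c : ℝ, 0 < c ∧ ∀ n ≥ 1, c ≤ |(M n).denom (P n)|)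
    (hvarphi : ∃ C : ℝ, ∀ n ≥ 1, |(M n).varphi (P n) / (M n).denom (P n)| ≤ C)
    (hpsi : ∃ C : ℝ, ∀ n ≥ 1, |(M n).psi (P n) / (M n).denom (P n)| ≤ C)
    (hphi : ∃ C : ℝ, ∀ n ≥ 1, |(M n).phi (P n) / (M n).denom (P n)| ≤ C)
    (hγ : ∃ C : ℝ, ∀ n ≥ 1, |γ n| ≤ C) :
    ∃ C σ A : ℝ, 1 ≤ C ∧ 0 < σ ∧ UniformlyBounded P M γ C σ A := by
  obtain ⟨Cc, hCc⟩ := hB.c_bounded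
  obtain ⟨Cd, hCd⟩ := hB.d_bounded
  obtain ⟨Cb, hCb⟩ := hB.b_isBigO.bound
  obtain ⟨σ₁, hσ₁, hσf⟩ := hB.eigenvalues
  obtain ⟨σ₂, hσ₂, hσn⟩ := hC
  obtain ⟨c, hc, hden⟩ := hdenom
  obtain ⟨A₁, hA₁⟩ := hvarphi
  obtain ⟨A₂, hA₂⟩ := hpsi
  obtain ⟨A₃, hA₃⟩ := hphi
  obtain ⟨G, hG⟩ := hγ
  refine ⟨max (max 1 Cb) (max Cc Cd), min σ₁ σ₂, max A₁ (max A₂ A₃) * (1 + G) ^ 2,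
    (le_max_left _ _).trans (le_max_left _ _), lt_min hσ₁ hσ₂, ?_⟩
  filter_upwards [eventually_ge_atTop 1, hCb] with n hn hb
  have hd : (M n).denom (P n) ≠ 0 := abs_pos.1 (hc.trans_le (hden n hn))
  have hbd : (M n).Bounded (P n) (max (max 1 Cb) (max Cc Cd)) (min σ₁ σ₂) :=
    FactorSample.bounded_of_conditions (hA n hn) (hB.memLp_f n hn) (hB.memLp_noise n hn)
      ((hCc n hn).trans ((le_max_left _ _).trans (le_max_right _ _)))
      ((hCd n hn).trans ((le_max_right _ _).trans (le_max_right _ _)))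
      (by
        rw [Real.norm_natCast] at hb
        refine (Real.le_norm_self _).trans (hb.trans ?_)
        gcongr
        exact (le_max_right _ _).trans (le_max_left _ _))
      ((le_max_left _ _).trans (le_max_left _ _)) (lt_min hσ₁ hσ₂)
      (fun t ht => (min_le_left _ _).trans (hσf n hn t ht))
      (fun t ht => (min_le_right _ _).trans (hσn n hn t ht))
  exact ⟨hbd, hbd.one_le_K hd, hbd.exists_lagrangeData hd
    ((hA₁ n hn).trans (le_max_left _ _))
    ((hA₂ n hn).trans ((le_max_left _ _).trans (le_max_right _ _)))
    ((hA₃ n hn).trans ((le_max_right _ _).trans (le_max_right _ _))) (hG n hn)⟩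

variable {C σ A : ℝ}

/-- Optimal variances for a consistent positive semidefinite covariance estimator and the sample
mean. -/
lemma isLittleOInProb_sampleMean (hC : 1 ≤ C) (hσ : 0 < σ) (h : UniformlyBounded P M γ C σ A)
    {T : ∀ n, Ω n → Matrix (Fin (p n)) (Fin (p n)) ℝ}
    (hT0 : ∀ᶠ n in atTop, ∀ ω x, 0 ≤ x ⬝ᵥ (T n ω *ᵥ x)) {F : ℝ → ℕ → ℝ}
    (hF : ∀ η, Tendsto (F η) atTop (𝓝 0))
    (hT : ∀ n η, (M n).Bounded (P n) C σ → SmallRate C σ (logRate n) η n → 1 ≤ K n → 0 ≤ F η n ∧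
      P n {ω | ¬ QuadFormClose (T n ω) ((M n).Sig (P n))
        (covConst C σ * (η * ((p n : ℝ) ^ 2 * (K n : ℝ) ^ 2 * logRate n)))}
        ≤ ENNReal.ofReal (F η n)) :
    IsLittleOInProb P
      (fun n ω => optimalVariance (T n ω) (sampleMean ((M n).Y ω)) (γ n)
        - optimalVariance ((M n).Sig (P n)) ((M n).mu (P n)) (γ n))
      (fun n => (p n : ℝ) ^ 2 * (K n : ℝ) ^ 2 * logRate n) := fun ε hε => by
  have hcc : 0 < covConst C σ := by linarith [le_covConst hC hσ]
  obtain ⟨η, hη, hη1, hε1, -⟩ := exists_tolerance (LagrangeData.pertConst σ A) hcc hε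
  refine tendsto_measure_zero_of_le_ofReal (F := fun n => F η n
    + (2 * (C + A) / (η ^ 2 * (n * logRate n ^ 2)) + 16 * A / n)) ?_ ?_
  · simpa using (hF η).add ((tendsto_div_mul_logRate_sq (2 * (C + A)) η).add
      (tendsto_const_div_atTop_nhds_zero_nat (16 * A)))
  · filter_upwards [h, hT0, eventually_smallRate (C := C) hσ hη hη1] with n ⟨hb, hK, ⟨D⟩⟩ h0 hr
    obtain ⟨hF0, hTn⟩ := hT n η hb hr hK
    exact hb.measure_optimalVariance_sampleMean_le hr hK D hε1 hF0 h0 hTn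

/-- Optimal variances for a consistent positive semidefinite covariance estimator and the
factor-model estimator of the mean. -/
lemma isLittleOInProb_factorMeanEst (hC : 1 ≤ C) (hσ : 0 < σ)
    (h : UniformlyBounded P M γ C σ A)
    {T : ∀ n, Ω n → Matrix (Fin (p n)) (Fin (p n)) ℝ}
    (hT0 : ∀ᶠ n in atTop, ∀ ω x, 0 ≤ x ⬝ᵥ (T n ω *ᵥ x)) {F : ℝ → ℕ → ℝ}
    (hF : ∀ η, Tendsto (F η) atTop (𝓝 0))
    (hT : ∀ n η, (M n).Bounded (P n) C σ → SmallRate C σ (logRate n) η n → 1 ≤ K n → 0 ≤ F η n ∧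
      P n {ω | ¬ QuadFormClose (T n ω) ((M n).Sig (P n))
        (covConst C σ * (η * ((p n : ℝ) ^ 2 * (K n : ℝ) ^ 2 * logRate n)))}
        ≤ ENNReal.ofReal (F η n)) :
    IsLittleOInProb P
      (fun n ω => optimalVariance (T n ω) (factorMeanEst ((M n).X ω) ((M n).Y ω)) (γ n)
        - optimalVariance ((M n).Sig (P n)) ((M n).mu (P n)) (γ n))
      (fun n => (p n : ℝ) ^ 2 * (K n : ℝ) ^ 2 * logRate n) := fun ε hε => by
  have hcc : 0 < covConst C σ := by linarith [le_covConst hC hσ]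
  obtain ⟨η, hη, hη1, hε1, hε2⟩ := exists_tolerance (LagrangeData.pertConst σ A) hcc hε
  refine tendsto_measure_zero_of_le_ofReal (F := fun n => F η n
    + ((2 * (C + A) / (η ^ 2 * (n * logRate n ^ 2)) + 16 * A / n)
      + C / (η ^ 2 * (n * logRate n ^ 2)))) ?_ ?_
  · simpa using (hF η).add (((tendsto_div_mul_logRate_sq (2 * (C + A)) η).add
      (tendsto_const_div_atTop_nhds_zero_nat (16 * A))).add (tendsto_div_mul_logRate_sq C η))
  · filter_upwards [h, hT0, eventually_smallRate (C := C) hσ hη hη1,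
      eventually_mul_logRate_le (8 * (C + A)) (show 0 < ε * σ ^ 2 by positivity)]
      with n ⟨hb, hK, ⟨D⟩⟩ h0 hr hs
    obtain ⟨hF0, hTn⟩ := hT n η hb hr hK
    exact hb.measure_optimalVariance_factorMeanEst_le hr hK D hε1 hε2 hs hF0 h0 hTn

end UniformBounds

/-! ### Comparison of the rates -/

lemma sqrt_rate_eq (p K n : ℕ) :
    √((p : ℝ) ^ 4 * (K : ℝ) ^ 4 * Real.log n / n) = (p : ℝ) ^ 2 * (K : ℝ) ^ 2 * logRate n := by
  have e : (p : ℝ) ^ 4 * (K : ℝ) ^ 4 * Real.log n / n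
      = ((p : ℝ) ^ 2 * (K : ℝ) ^ 2) ^ 2 * (Real.log n / n) := by ring
  rw [e, Real.sqrt_mul (sq_nonneg _), Real.sqrt_sq (by positivity), logRate]

lemma rate_le_sqrt {p K n : ℕ} (h : K ≤ p) :
    (p : ℝ) ^ 2 * (K : ℝ) ^ 2 * logRate n ≤ √((p : ℝ) ^ 6 * (K : ℝ) ^ 2 * Real.log n / n) := by
  rw [← sqrt_rate_eq]
  have hK : (K : ℝ) ≤ p := by exact_mod_cast h
  have hlog := Real.log_natCast_nonneg n
  have h1 : (p : ℝ) ^ 4 * (K : ℝ) ^ 4 ≤ (p : ℝ) ^ 6 * (K : ℝ) ^ 2 := by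
    calc (p : ℝ) ^ 4 * (K : ℝ) ^ 4 = (p : ℝ) ^ 4 * (K : ℝ) ^ 2 * (K : ℝ) ^ 2 := by ring
      _ ≤ (p : ℝ) ^ 4 * (K : ℝ) ^ 2 * (p : ℝ) ^ 2 := by gcongr
      _ = _ := by ring
  gcongr

end Asymptotics

end

theorem theorem6 {Ω : ℕ → Type*} [∀ n, MeasurableSpace (Ω n)] (P : ∀ n, Measure (Ω n))
    [∀ n, IsProbabilityMeasure (P n)] (K p : ℕ → ℕ)
    (M : ∀ n, FactorSample (Ω n) (K n) (p n) n) (γ : ℕ → ℝ)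
    (hA : ∀ n ≥ 1, (M n).ConditionA (P n)) (hB : ConditionB P M) (hC : ConditionC M)
    (hdenom : ∃ c : ℝ, 0 < c ∧ ∀ n ≥ 1, c ≤ |(M n).denom (P n)|)
    (hvarphi : ∃ C : ℝ, ∀ n ≥ 1, |(M n).varphi (P n) / (M n).denom (P n)| ≤ C)
    (hpsi : ∃ C : ℝ, ∀ n ≥ 1, |(M n).psi (P n) / (M n).denom (P n)| ≤ C)
    (hphi : ∃ C : ℝ, ∀ n ≥ 1, |(M n).phi (P n) / (M n).denom (P n)| ≤ C)
    (hγ : ∃ C : ℝ, ∀ n ≥ 1, |γ n| ≤ C) :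
    -- factor-model estimators of the covariance matrix and of the mean
    IsLittleOInProb P
      (fun n ω =>
        optimalVariance (factorCovEst ((M n).X ω) ((M n).Y ω))
            (factorMeanEst ((M n).X ω) ((M n).Y ω)) (γ n)
          - optimalVariance ((M n).Sig (P n)) ((M n).mu (P n)) (γ n))
      (fun n => √((p n : ℝ) ^ 4 * (K n : ℝ) ^ 4 * Real.log n / n)) ∧
    -- sample covariance matrix and sample mean
    IsLittleOInProb P
      (fun n ω =>
        optimalVariance (sampleCov ((M n).Y ω)) (sampleMean ((M n).Y ω)) (γ n)
          - optimalVariance ((M n).Sig (P n)) ((M n).mu (P n)) (γ n))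
      (fun n => √((p n : ℝ) ^ 6 * (K n : ℝ) ^ 2 * Real.log n / n)) ∧
    -- sample covariance matrix and factor-model estimator of the mean
    IsLittleOInProb P
      (fun n ω =>
        optimalVariance (sampleCov ((M n).Y ω))
            (factorMeanEst ((M n).X ω) ((M n).Y ω)) (γ n)
          - optimalVariance ((M n).Sig (P n)) ((M n).mu (P n)) (γ n))
      (fun n => √((p n : ℝ) ^ 6 * (K n : ℝ) ^ 2 * Real.log n / n)) := by
  obtain ⟨C, σ, A, hC1, hσ, h⟩ :=
    exists_uniformlyBounded hA hB hC hdenom hvarphi hpsi hphi hγ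
  have hK : ∀ᶠ n in atTop, (p n : ℝ) ^ 2 * (K n : ℝ) ^ 2 * logRate n
      ≤ √((p n : ℝ) ^ 6 * (K n : ℝ) ^ 2 * Real.log n / n) := by
    filter_upwards [eventually_ge_atTop 1] with n hn
    exact rate_le_sqrt (hA n hn).le
  have hsam0 : ∀ᶠ n in atTop, ∀ ω (x : Fin (p n) → ℝ), 0 ≤ x ⬝ᵥ (sampleCov ((M n).Y ω) *ᵥ x) := by
    filter_upwards [eventually_ge_atTop 2] with n hn ω x
    exact quadForm_sampleCov_nonneg hn _ x
  have hfac0 : ∀ᶠ n in atTop, ∀ ω (x : Fin (p n) → ℝ),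
      0 ≤ x ⬝ᵥ (factorCovEst ((M n).X ω) ((M n).Y ω) *ᵥ x) := by
    filter_upwards [eventually_ge_atTop 2] with n hn ω x
    exact quadForm_factorCovEst_nonneg hn _ _ x
  have hsamF := tendsto_div_mul_logRate_sq (8 * C * (C ^ 2 / σ ^ 2 + 1) + C)
  refine ⟨?_, ?_, ?_⟩
  · simp only [sqrt_rate_eq]
    refine isLittleOInProb_factorMeanEst hC1 hσ h hfac0
      (F := fun η n => 5 * C / (η ^ 2 * (n * logRate n ^ 2)) + 12 * C * logRate n / (η * σ ^ 2))
      (fun η => ?_) fun n η hb hr hKn => ⟨?_, hb.measure_factorCovEst_bad_le hr hKn⟩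
    · simpa using (tendsto_div_mul_logRate_sq (5 * C) η).add
        ((tendsto_logRate.const_mul (12 * C)).div_const (η * σ ^ 2))
    · have := hr.s_pos
      have := hr.η_pos
      positivity
  -- The sample covariance matrix is treated at the smaller rate p²K²s, and monotonicity in the
  -- rate, from K ≤ p, gives the stated one.
  · exact (isLittleOInProb_sampleMean hC1 hσ h hsam0 hsamF fun n η hb hr hKn =>
      ⟨by positivity, hb.measure_sampleCov_bad_le hr hKn⟩).mono hK
  · exact (isLittleOInProb_factorMeanEst hC1 hσ h hsam0 hsamF fun n η hb hr hKn =>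
      ⟨by positivity, hb.measure_sampleCov_bad_le hr hKn⟩).mono hK
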